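/- Let $X_1$ and $X_2$ be closed (compact, without boundary, not necessarily connected) oriented smooth $n$-manifolds. For a closed oriented smooth $n$-manifold $X$, orientation-preserving diffeomorphisms $a,c$ of $X$ and a point $x\in X$, call $(a,c)$ *admissible at $x$* if * $a(x)=c(x)=x$; * the commutator $[a,c]=a\circ c\circ a^{-1}\circ c^{-1}$ is smoothly isotopic to the identity through diffeomorphisms which fix $x$ and whose differentials at $x$ are the identity of $T_xX$; * the dimension of the maximal subspace of $T_xX$ on which all generalized eigenvalues of $da_x$ and $dc_x$ are negative real numbers is odd. (Then $n\ge 3$.) Let $r_k=\mathrm{diag}(-1,-1,1)$ and $r_i=\mathrm{diag}(1,-1,-1)$. Call a triple $(a',c',\phi)$ a *standardized pair at $x$* if $a',c'$ are orientation-preserving diffeomorphisms of $X$, $\phi:O\to\mathbb R^n$ is a diffeomorphism from an open neighbourhood $O$ of $x$ onto $\mathbb R^n$ with $\phi(x)=0$, the maps $a'$ and $c'$ preserve $O$ and satisfy $\phi a'\phi^{-1}=r_k\oplus I_{n-3}$ and $\phi c'\phi^{-1}=r_i\oplus I_{n-3}$, and $[a',c']$ is smoothly isotopic to the identity through diffeomorphisms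 each of which fixes $O$ pointwise. Suppose that, for $j\in\{1,2\}$, $(a_j,c_j)$ is a pair of orientation-preserving diffeomorphisms of $X_j$ which is admissible at $x_j\in X_j$. Then: 1. There are standardized pairs $(a_1',c_1',\phi_1)$ on $X_1$ at $x_1$ with $\phi_1$ orientation-preserving, and $(a_2',c_2',\phi_2)$ on $X_2$ at $x_2$ with $\phi_2$ orientation-reversing. 2. Let $(a_j',c_j',\phi_j)$ be any standardized pairs on $X_j$ at $x_j$, $j\in\{1,2\}$, and form the connected sum $$X=X_1\#X_2=(X_1\setminus\phi_1^{-1}(B_1))\cup(X_2\setminus\phi_2^{-1}(B_1)),$$ where $B_1$ is the open unit ball and the boundary spheres are identified by $\phi_2^{-1}\circ\phi_1$; as a smooth manifold, $X$ is the union of $X_1\setminus\{x_1\}$ and $X_2\setminus\{x_2\}$ in which $\phi_1^{-1}(v)$ is identified with $\phi_2^{-1}(v/|v|^2)$ for all $v\in\mathbb R^n\setminus\{0\}$. Then $X$ is a closed smooth manifold, there are diffeomorphisms $a=a_1'\#a_2'$ and $c=c_1'\#c_2'$ of $X$ which restrict to $a_j'$ and $c_j'$ on $X_j\setminus\{x_j\}$,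 and $X$ has an orientation which is preserved by $a$ and $c$, which extends the orientation of $X_1\setminus\{x_1\}$, and which also extends the orientation of $X_2\setminus\{x_2\}$ whenever one of $\phi_1,\phi_2$ preserves and the other reverses orientation. If $n\ge4$, then with this orientation $(a,c)$ is admissible at the point $x=\phi_1^{-1}(0,0,0,2,0,\dots,0)\in X$. -/

import Mathlib

open Set Topology TopologicalSpace
open scoped Manifold ContDiff

/-! ### Orientations -/

section Orientation

/-- An orientation of a smooth `n`-manifold, given by an oriented smooth atlas: a family of charts
of the smooth structure which cover the manifold and whose coordinate changes have positive Jacobian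
determinant. -/
structure ManifoldOrientation (n : ℕ) (X : Type*) [TopologicalSpace X]
    [ChartedSpace (EuclideanSpace ℝ (Fin n)) X] where
  charts : Set (OpenPartialHomeomorph X (EuclideanSpace ℝ (Fin n)))
  charts_smooth : charts ⊆ IsManifold.maximalAtlas (𝓡 n) ∞ X
  charts_cover : ∀ p : X, ∃ e ∈ charts, p ∈ e.source
  det_pos : ∀ e ∈ charts, ∀ e' ∈ charts, ∀ p ∈ e.source, p ∈ e'.source →
    0 < (fderiv ℝ (e' ∘ e.symm) (e p)).det

namespace ManifoldOrientation

variable {n : ℕ} {X : Type*} [TopologicalSpace X] [ChartedSpace (EuclideanSpace ℝ (Fin n)) X]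
  {Y : Type*} [TopologicalSpace Y] [ChartedSpace (EuclideanSpace ℝ (Fin n)) Y]

/-- The self-diffeomorphism `f` preserves the orientation `o`, i.e. `f ∈ Diff⁺(X)`. -/
def Preserves (o : ManifoldOrientation n X) (f : X ≃ₘ⟮𝓡 n, 𝓡 n⟯ X) : Prop :=
  ∀ e ∈ o.charts, ∀ e' ∈ o.charts, ∀ p ∈ e.source, f p ∈ e'.source →
    0 < (fderiv ℝ (e' ∘ f ∘ e.symm) (e p)).det

open Classical in
/-- The map `f : U → Y`, defined on the open subset `U` of `X`, preserves orientation.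
The function differentiated is the coordinate expression `e' ∘ f ∘ e⁻¹` of `f`, which is defined
near `e p`. -/
def PreservesOn (o : ManifoldOrientation n X) (o' : ManifoldOrientation n Y) (U : Opens X)
    (f : U → Y) : Prop :=
  ∀ e ∈ o.charts, ∀ e' ∈ o'.charts, ∀ p : U, (p : X) ∈ e.source → f p ∈ e'.source →
    0 < (fderiv ℝ (fun v => if h : e.symm v ∈ U then e' (f ⟨e.symm v, h⟩) else 0) (e p)).det

/-- The chart `φ` is orientation-preserving. -/
def PositiveChart (o : ManifoldOrientation n X)
    (φ : OpenPartialHomeomorph X (EuclideanSpace ℝ (Fin n))) : Prop :=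
  ∀ e ∈ o.charts, ∀ p ∈ e.source, p ∈ φ.source → 0 < (fderiv ℝ (φ ∘ e.symm) (e p)).det

/-- The chart `φ` is orientation-reversing. -/
def NegativeChart (o : ManifoldOrientation n X)
    (φ : OpenPartialHomeomorph X (EuclideanSpace ℝ (Fin n))) : Prop :=
  ∀ e ∈ o.charts, ∀ p ∈ e.source, p ∈ φ.source → (fderiv ℝ (φ ∘ e.symm) (e p)).det < 0

end ManifoldOrientation

end Orientation

/-! ### Pairs of diffeomorphisms -/

section Pairs

variable {n : ℕ} {X : Type*} [TopologicalSpace X] [ChartedSpace (EuclideanSpace ℝ (Fin n)) X]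

/-- The commutator `[a, c] = a ∘ c ∘ a⁻¹ ∘ c⁻¹`. -/
noncomputable def diffCommutator (a c : X ≃ₘ⟮𝓡 n, 𝓡 n⟯ X) : X ≃ₘ⟮𝓡 n, 𝓡 n⟯ X :=
  (c.symm.trans a.symm).trans (c.trans a)

/-- `b` (restricted to times in `[0, 1]`) is a smooth isotopy from `f` to `g`. -/
def IsSmoothIsotopy (b : ℝ → (X ≃ₘ⟮𝓡 n, 𝓡 n⟯ X)) (f g : X ≃ₘ⟮𝓡 n, 𝓡 n⟯ X) : Prop :=
  ContMDiffOn (𝓘(ℝ, ℝ).prod (𝓡 n)) (𝓡 n) ∞ (fun q : ℝ × X => b q.1 q.2) (Icc 0 1 ×ˢ univ) ∧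
    b 0 = f ∧ b 1 = g

/-- The differential of `f` at a fixed point `x`, as an endomorphism of the tangent space at `x`.
(The type ascription identifies the tangent spaces at `f x` and at `x`, which are equal when
`f x = x`; the definition is only used in that case.) -/
noncomputable def fixedPointDifferential (f : X → X) (x : X) :
    Module.End ℝ (TangentSpace (𝓡 n) x) :=
  ContinuousLinearMap.toLinearMap
    (mfderiv (𝓡 n) (𝓡 n) f x : TangentSpace (𝓡 n) x →L[ℝ] TangentSpace (𝓡 n) x)

/-- For commuting endomorphisms `A` and `C`, the maximal subspace on which all generalized
eigenvalues of both `A` and `C` are negative real numbers. -/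
noncomputable def commonNegativeSubspace {V : Type*} [AddCommGroup V] [Module ℝ V]
    (A C : Module.End ℝ V) : Submodule ℝ V :=
  (⨆ μ ∈ Iio (0 : ℝ), A.maxGenEigenspace μ) ⊓ (⨆ μ ∈ Iio (0 : ℝ), C.maxGenEigenspace μ)

/-- The orientation-preserving diffeomorphisms `a` and `c` have the shared fixed point `x`, their
commutator is smoothly isotopic to the identity through diffeomorphisms fixing `x` with identity
differential at `x`, and the dimension of the maximal subspace of the tangent space at `x` on which
all generalized eigenvalues of both differentials are negative real numbers is odd. -/
structure IsAdmissiblePair (o : ManifoldOrientation n X) (a c : X ≃ₘ⟮𝓡 n, 𝓡 n⟯ X) (x : X) :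
    Prop where
  preserves_a : o.Preserves a
  preserves_c : o.Preserves c
  fixed_a : a x = x
  fixed_c : c x = x
  isotopy : ∃ b : ℝ → (X ≃ₘ⟮𝓡 n, 𝓡 n⟯ X),
    IsSmoothIsotopy b (diffCommutator a c) (Diffeomorph.refl (𝓡 n) X ∞) ∧
    ∀ t ∈ Icc (0 : ℝ) 1, b t x = x ∧ fixedPointDifferential (n := n) (b t) x = LinearMap.id
  odd_finrank : Odd (Module.finrank ℝ
    (commonNegativeSubspace (fixedPointDifferential (n := n) a x)
      (fixedPointDifferential (n := n) c x)))

/-- The linear map `r_k ⊕ I`, that is `diag(-1, -1, 1, 1, …, 1)`. -/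
noncomputable def rotK (n : ℕ) : EuclideanSpace ℝ (Fin n) →ₗ[ℝ] EuclideanSpace ℝ (Fin n) :=
  Matrix.toEuclideanLin (Matrix.diagonal fun j : Fin n => if j.val = 0 ∨ j.val = 1 then -1 else 1)

/-- The linear map `r_i ⊕ I`, that is `diag(1, -1, -1, 1, …, 1)`. -/
noncomputable def rotI (n : ℕ) : EuclideanSpace ℝ (Fin n) →ₗ[ℝ] EuclideanSpace ℝ (Fin n) :=
  Matrix.toEuclideanLin (Matrix.diagonal fun j : Fin n => if j.val = 1 ∨ j.val = 2 then -1 else 1)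

/-- The pair `a, c` is standardized near `x` in the local coordinates `φ : O → ℝⁿ`, `O = φ.source`:
`φ` is a diffeomorphism of the open neighbourhood `O` of `x` onto `ℝⁿ` taking `x` to the origin,
`φ ∘ a ∘ φ⁻¹ = r_k ⊕ I`, `φ ∘ c ∘ φ⁻¹ = r_i ⊕ I`, and `[a, c]` is smoothly isotopic to the identity
through diffeomorphisms fixing every point of `O`. -/
structure IsStandardizedPair (o : ManifoldOrientation n X) (a c : X ≃ₘ⟮𝓡 n, 𝓡 n⟯ X)
    (φ : OpenPartialHomeomorph X (EuclideanSpace ℝ (Fin n))) (x : X) : Prop where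
  preserves_a : o.Preserves a
  preserves_c : o.Preserves c
  smooth_chart : φ ∈ IsManifold.maximalAtlas (𝓡 n) ∞ X
  target_chart : φ.target = univ
  mem_source : x ∈ φ.source
  map_center : φ x = 0
  local_a : ∀ p ∈ φ.source, a p ∈ φ.source ∧ φ (a p) = rotK n (φ p)
  local_c : ∀ p ∈ φ.source, c p ∈ φ.source ∧ φ (c p) = rotI n (φ p)
  isotopy : ∃ b : ℝ → (X ≃ₘ⟮𝓡 n, 𝓡 n⟯ X),
    IsSmoothIsotopy b (diffCommutator a c) (Diffeomorph.refl (𝓡 n) X ∞) ∧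
    ∀ t ∈ Icc (0 : ℝ) 1, ∀ p ∈ φ.source, b t p = p

end Pairs

/-! ### Gluing two spaces along open subsets -/

section Glue

variable {X₁ : Type*} {X₂ : Type*} [TopologicalSpace X₁] [TopologicalSpace X₂]

/-- The relation on `U₁ ⊔ U₂` identifying `p ∈ U₁` with `g p` whenever the latter is defined and
lies in `U₂`. -/
def GlueRel (U₁ : Opens X₁) (U₂ : Opens X₂) (g : OpenPartialHomeomorph X₁ X₂) :
    U₁ ⊕ U₂ → U₁ ⊕ U₂ → Prop
  | .inl p, .inl p' => p = p'
  | .inl p, .inr q => (p : X₁) ∈ g.source ∧ g p = q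
  | .inr q, .inl p => (p : X₁) ∈ g.source ∧ g p = q
  | .inr q, .inr q' => q = q'

theorem glueRel_equivalence (U₁ : Opens X₁) (U₂ : Opens X₂) (g : OpenPartialHomeomorph X₁ X₂) :
    Equivalence (GlueRel U₁ U₂ g) where
  refl p := by cases p <;> simp [GlueRel]
  symm {p q} h := by
    cases p <;> cases q <;> simp only [GlueRel] at h ⊢ <;> first | exact h | exact h.symm
  trans {p q r} h h' := by
    rcases p with p | p <;> rcases q with q | q <;> rcases r with r | r <;>
      simp only [GlueRel] at h h' ⊢
    · exact h.trans h'
    · subst h; exact h'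
    · exact Subtype.ext (g.injOn h.1 h'.1 (h.2.trans h'.2.symm))
    · subst h'; exact h
    · subst h'; exact h
    · exact Subtype.ext (h.2.symm.trans h'.2)
    · subst h; exact h'
    · exact h.trans h'

/-- The result of gluing `U₁` and `U₂` along `g`. -/
def Glue (U₁ : Opens X₁) (U₂ : Opens X₂) (g : OpenPartialHomeomorph X₁ X₂) : Type _ :=
  Quotient (⟨GlueRel U₁ U₂ g, glueRel_equivalence U₁ U₂ g⟩ : Setoid (U₁ ⊕ U₂))

namespace Glue

variable (U₁ : Opens X₁) (U₂ : Opens X₂) (g : OpenPartialHomeomorph X₁ X₂)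

instance : TopologicalSpace (Glue U₁ U₂ g) :=
  inferInstanceAs (TopologicalSpace (Quotient _))

/-- The inclusion of `U₁`. -/
def inl (p : U₁) : Glue U₁ U₂ g := Quotient.mk _ (Sum.inl p)

/-- The inclusion of `U₂`. -/
def inr (q : U₂) : Glue U₁ U₂ g := Quotient.mk _ (Sum.inr q)

variable {U₁ U₂ g}

theorem inl_eq_inl {p p' : U₁} : inl U₁ U₂ g p = inl U₁ U₂ g p' ↔ p = p' :=
  Quotient.eq (r := ⟨GlueRel U₁ U₂ g, glueRel_equivalence U₁ U₂ g⟩)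

theorem inr_eq_inr {q q' : U₂} : inr U₁ U₂ g q = inr U₁ U₂ g q' ↔ q = q' :=
  Quotient.eq (r := ⟨GlueRel U₁ U₂ g, glueRel_equivalence U₁ U₂ g⟩)

theorem inl_eq_inr {p : U₁} {q : U₂} :
    inl U₁ U₂ g p = inr U₁ U₂ g q ↔ (p : X₁) ∈ g.source ∧ g p = q :=
  Quotient.eq (r := ⟨GlueRel U₁ U₂ g, glueRel_equivalence U₁ U₂ g⟩)

theorem isOpen_iff {s : Set (Glue U₁ U₂ g)} :
    IsOpen s ↔ IsOpen (inl U₁ U₂ g ⁻¹' s) ∧ IsOpen (inr U₁ U₂ g ⁻¹' s) := by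
  refine (isQuotientMap_quotient_mk' (s := (⟨GlueRel U₁ U₂ g, glueRel_equivalence U₁ U₂ g⟩ :
    Setoid (U₁ ⊕ U₂)))).isOpen_preimage.symm.trans ?_
  rw [isOpen_sum_iff]
  rfl

theorem isOpenEmbedding_inl : IsOpenEmbedding (inl U₁ U₂ g) := by
  refine .of_continuous_injective_isOpenMap
    (continuous_quotient_mk'.comp continuous_inl) (fun _ _ h => inl_eq_inl.1 h) fun V hV => ?_
  refine isOpen_iff.2 ⟨?_, ?_⟩
  · rwa [preimage_image_eq _ fun _ _ h => inl_eq_inl.1 h]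
  · have h : inr U₁ U₂ g ⁻¹' (inl U₁ U₂ g '' V) =
        Subtype.val ⁻¹' (g '' (g.source ∩ (Subtype.val '' V))) := by
      ext q
      constructor
      · rintro ⟨p, hp, h⟩
        exact ⟨p, ⟨(inl_eq_inr.1 h).1, p, hp, rfl⟩, (inl_eq_inr.1 h).2⟩
      · rintro ⟨_, ⟨hs, p, hp, rfl⟩, h⟩
        exact ⟨p, hp, inl_eq_inr.2 ⟨hs, h⟩⟩
    rw [h]
    exact (g.isOpen_image_source_inter (U₁.isOpenEmbedding'.isOpenMap V hV)).preimage
      continuous_subtype_val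

theorem isOpenEmbedding_inr : IsOpenEmbedding (inr U₁ U₂ g) := by
  refine .of_continuous_injective_isOpenMap
    (continuous_quotient_mk'.comp continuous_inr) (fun _ _ h => inr_eq_inr.1 h) fun V hV => ?_
  refine isOpen_iff.2 ⟨?_, ?_⟩
  · have h : inl U₁ U₂ g ⁻¹' (inr U₁ U₂ g '' V) =
        Subtype.val ⁻¹' (g.source ∩ g ⁻¹' (Subtype.val '' V)) := by
      ext p
      constructor
      · rintro ⟨q, hq, h⟩
        exact ⟨(inl_eq_inr.1 h.symm).1, q, hq, (inl_eq_inr.1 h.symm).2.symm⟩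
      · rintro ⟨hs, q, hq, h⟩
        exact ⟨q, hq, (inl_eq_inr.2 ⟨hs, h.symm⟩).symm⟩
    rw [h]
    exact (g.isOpen_inter_preimage (U₂.isOpenEmbedding'.isOpenMap V hV)).preimage
      continuous_subtype_val
  · rwa [preimage_image_eq _ fun _ _ h => inr_eq_inr.1 h]

theorem exists_rep (p : Glue U₁ U₂ g) : (∃ q, inl U₁ U₂ g q = p) ∨ (∃ q, inr U₁ U₂ g q = p) := by
  obtain ⟨q | q, rfl⟩ := Quotient.exists_rep p
  · exact .inl ⟨q, rfl⟩
  · exact .inr ⟨q, rfl⟩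

variable {H : Type*} [TopologicalSpace H] [Nonempty H] [ChartedSpace H X₁] [ChartedSpace H X₂]

open Classical in
/-- The manifold structure on a glued space: its atlas consists of the charts of the two open
pieces, transported along the two inclusions. -/
noncomputable instance : ChartedSpace H (Glue U₁ U₂ g) where
  atlas := ((fun e => e.lift_openEmbedding (isOpenEmbedding_inl (U₁ := U₁) (U₂ := U₂) (g := g))) ''
      atlas H U₁) ∪
    ((fun e => e.lift_openEmbedding (isOpenEmbedding_inr (U₁ := U₁) (U₂ := U₂) (g := g))) ''
      atlas H U₂)
  chartAt p := if h : ∃ q, inl U₁ U₂ g q = p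
    then (chartAt H h.choose).lift_openEmbedding isOpenEmbedding_inl
    else (chartAt H ((exists_rep p).resolve_left h).choose).lift_openEmbedding isOpenEmbedding_inr
  mem_chart_source p := by
    split_ifs with h
    · rw [OpenPartialHomeomorph.lift_openEmbedding_source]
      exact ⟨_, mem_chart_source H _, h.choose_spec⟩
    · rw [OpenPartialHomeomorph.lift_openEmbedding_source]
      exact ⟨_, mem_chart_source H _, ((exists_rep p).resolve_left h).choose_spec⟩
  chart_mem_atlas p := by
    split_ifs with h
    · exact .inl ⟨_, chart_mem_atlas H _, rfl⟩
    · exact .inr ⟨_, chart_mem_atlas H _, rfl⟩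

end Glue

end Glue

/-! ### Connected sums -/

section ConnectedSum

variable {n : ℕ}

theorem sphereInversion_aux {v : EuclideanSpace ℝ (Fin n)} (hv : v ≠ 0) :
    (‖(‖v‖ ^ 2)⁻¹ • v‖ ^ 2)⁻¹ • (‖v‖ ^ 2)⁻¹ • v = v := by
  have h : ‖v‖ ≠ 0 := norm_ne_zero_iff.2 hv
  have h' : (‖(‖v‖ ^ 2)⁻¹ • v‖ ^ 2)⁻¹ * (‖v‖ ^ 2)⁻¹ = 1 := by
    rw [norm_smul, norm_inv, norm_pow, norm_norm]
    field_simp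
  rw [smul_smul, h', one_smul]

theorem continuousOn_sphereInversion_aux :
    ContinuousOn (fun v : EuclideanSpace ℝ (Fin n) => (‖v‖ ^ 2)⁻¹ • v) {0}ᶜ :=
  fun _ hv => (((continuous_norm.pow 2).continuousAt.inv₀
    (pow_ne_zero 2 (norm_ne_zero_iff.2 hv))).smul continuousAt_id).continuousWithinAt

theorem mapsTo_sphereInversion_aux {v : EuclideanSpace ℝ (Fin n)}
    (hv : v ∈ ({0}ᶜ : Set (EuclideanSpace ℝ (Fin n)))) :
    (‖v‖ ^ 2)⁻¹ • v ∈ ({0}ᶜ : Set (EuclideanSpace ℝ (Fin n))) :=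
  smul_ne_zero (inv_ne_zero (pow_ne_zero 2 (norm_ne_zero_iff.2 hv))) hv

/-- The inversion `v ↦ v / ‖v‖²` of `ℝⁿ \ {0}` in the unit sphere. -/
noncomputable def sphereInversion (n : ℕ) :
    OpenPartialHomeomorph (EuclideanSpace ℝ (Fin n)) (EuclideanSpace ℝ (Fin n)) where
  toFun v := (‖v‖ ^ 2)⁻¹ • v
  invFun v := (‖v‖ ^ 2)⁻¹ • v
  source := {0}ᶜ
  target := {0}ᶜ
  map_source' _ hv := mapsTo_sphereInversion_aux hv
  map_target' _ hv := mapsTo_sphereInversion_aux hv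
  left_inv' _ hv := sphereInversion_aux hv
  right_inv' _ hv := sphereInversion_aux hv
  open_source := isOpen_compl_singleton
  open_target := isOpen_compl_singleton
  continuousOn_toFun := continuousOn_sphereInversion_aux
  continuousOn_invFun := continuousOn_sphereInversion_aux

/-- The complement of the centre `φ⁻¹(0)` of a coordinate system `φ`. -/
def puncture {X : Type*} [TopologicalSpace X] [T1Space X]
    (φ : OpenPartialHomeomorph X (EuclideanSpace ℝ (Fin n))) : Opens X :=
  ⟨{φ.symm 0}ᶜ, isOpen_compl_singleton⟩

variable {X₁ : Type*} {X₂ : Type*} [TopologicalSpace X₁] [TopologicalSpace X₂]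
  [T1Space X₁] [T1Space X₂]

/-- The connected sum of `X₁` and `X₂` along coordinates `φᵢ : Oᵢ → ℝⁿ` (onto `ℝⁿ`): the punctured
manifolds `Xᵢ \ {φᵢ⁻¹(0)}` are glued by identifying `φ₁⁻¹(v)` with `φ₂⁻¹(v / ‖v‖²)` for `v ≠ 0`.
Equivalently, the complements of the open unit balls `φᵢ⁻¹(B₁)` are glued along their boundary
spheres by `φ₂⁻¹ ∘ φ₁`, with the smooth structure given by the radial collars. -/
abbrev ConnectedSum (φ₁ : OpenPartialHomeomorph X₁ (EuclideanSpace ℝ (Fin n)))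
    (φ₂ : OpenPartialHomeomorph X₂ (EuclideanSpace ℝ (Fin n))) : Type _ :=
  Glue (puncture φ₁) (puncture φ₂) ((φ₁.trans (sphereInversion n)).trans φ₂.symm)

namespace ConnectedSum

variable (φ₁ : OpenPartialHomeomorph X₁ (EuclideanSpace ℝ (Fin n)))
  (φ₂ : OpenPartialHomeomorph X₂ (EuclideanSpace ℝ (Fin n)))

/-- The inclusion of the punctured `X₁` into the connected sum. -/
noncomputable def inl (p : puncture φ₁) : ConnectedSum φ₁ φ₂ := Glue.inl _ _ _ p

/-- The inclusion of the punctured `X₂` into the connected sum. -/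
noncomputable def inr (q : puncture φ₂) : ConnectedSum φ₁ φ₂ := Glue.inr _ _ _ q

/-- `f` is the connected sum `f₁ # f₂` of the self-maps `f₁` and `f₂`: it restricts to `f₁` and `f₂`
on the two pieces. -/
def IsSumMap (f₁ : X₁ → X₁) (f₂ : X₂ → X₂) (f : ConnectedSum φ₁ φ₂ → ConnectedSum φ₁ φ₂) : Prop :=
  (∀ p p' : puncture φ₁, f₁ p = p' → f (inl φ₁ φ₂ p) = inl φ₁ φ₂ p') ∧
    (∀ q q' : puncture φ₂, f₂ q = q' → f (inr φ₁ φ₂ q) = inr φ₁ φ₂ q')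

end ConnectedSum

end ConnectedSum

/-! Standardizing a pair. Fix a chart ψ centred at x. A commutator of diffeomorphisms fixing x has
trivial differential at x exactly when the two differentials commute. Hence one of the
diffeomorphisms may be multiplied by a family supported near x as long as its differential keeps
commuting with the other one: the commutators then form an isotopy with trivial differential at x,
to be composed with the given one. Differentials can therefore be moved along every continuous path
of invertible maps commuting with the other differential (`IsRealized.of_path`). The supply of such
families comes from `exists_cutoff_family`: a map with derivative close to the identity at 0 can be
cut off in a small ball and stays a perturbation of the identity with Lipschitz constant 1/2.

What remains is linear algebra (`IsDeformable.exists_normal_form`). A straight segment joins each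
differential to the involution that is -1 on its negative generalized eigenspaces and 1 on the
complementary summand. The two commuting involutions are diagonalized together. The number of (-,-)
entries is odd by assumption, and positivity of both determinants forces the numbers of (-,+) and
(+,-) entries to be odd too. Two entries of equal type span a plane on which both maps are scalar,
so a half turn cancels them. One entry of each type survives, which is the pair r_k, r_i.

Once the differentials are the model ones, the germs are made linear by multiplying with a cut-off
of a⁻¹ ∘ da, which is tangent to the identity (`exists_linearized`). The commutator is then the
identity near x, and the isotopy is corrected by a cut-off of its own germ until it fixes a
neighbourhood (`IsotopicToIdAt.exists_isotopy_rel`). A radial rescaling of a small ellipsoid yields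
a chart onto ℝⁿ. A reflection in the first coordinate commutes with all diagonal matrices, so either
sign of the chart can be obtained.

Connected sums. Diagonal sign matrices are linear isometries, so they commute with the inversion v ↦
v/|v|², and diffeomorphisms having the same such form on both charts glue. Isotopies that fix both
charts pointwise glue as well. The inversion reverses orientation, so charts of opposite sign give a
coherent orientation; for charts of equal sign the second orientation is reversed first, which `a₂'`
and `c₂'` still preserve. At 2e₃ (coordinates counted from 0) the glued maps are r_k ⊕ I and r_i ⊕ I
in the first chart, both fix this point, and their common negative subspace is the line spanned by
e₁. The glued isotopy is the identity near this point, so the sum is admissible. -/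

set_option linter.unusedSectionVars false

open Filter

/-! ### Derivatives in coordinates -/

section CoordinateDerivative

variable {n : ℕ}
  {X : Type*} [TopologicalSpace X] [ChartedSpace (EuclideanSpace ℝ (Fin n)) X]
  {Y : Type*} [TopologicalSpace Y] [ChartedSpace (EuclideanSpace ℝ (Fin n)) Y]
  {Z : Type*} [TopologicalSpace Z] [ChartedSpace (EuclideanSpace ℝ (Fin n)) Z]

/-- The derivative of `f` at `p` in the coordinates `e` and `e'`. -/
noncomputable def coordDeriv (e : OpenPartialHomeomorph X (EuclideanSpace ℝ (Fin n)))
    (e' : OpenPartialHomeomorph Y (EuclideanSpace ℝ (Fin n))) (f : X → Y) (p : X) :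
    EuclideanSpace ℝ (Fin n) →L[ℝ] EuclideanSpace ℝ (Fin n) :=
  fderiv ℝ (e' ∘ f ∘ e.symm) (e p)

variable {e e₁ : OpenPartialHomeomorph X (EuclideanSpace ℝ (Fin n))}
  {e' : OpenPartialHomeomorph Y (EuclideanSpace ℝ (Fin n))}
  {e'' : OpenPartialHomeomorph Z (EuclideanSpace ℝ (Fin n))}
  {f : X → Y} {g : Y → Z} {p : X}

theorem contDiffAt_coord (he : e ∈ IsManifold.maximalAtlas (𝓡 n) ∞ X)
    (he' : e' ∈ IsManifold.maximalAtlas (𝓡 n) ∞ Y) (hp : p ∈ e.source) (hfp : f p ∈ e'.source)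
    (hf : ContMDiffAt (𝓡 n) (𝓡 n) ∞ f p) : ContDiffAt ℝ ∞ (e' ∘ f ∘ e.symm) (e p) := by
  rw [← contMDiffAt_iff_contDiffAt]
  have h1 : ContMDiffAt (𝓡 n) (𝓡 n) ∞ e.symm (e p) :=
    contMDiffAt_symm_of_mem_maximalAtlas he (e.map_source hp)
  have h2 : ContMDiffAt (𝓡 n) (𝓡 n) ∞ f (e.symm (e p)) := by rwa [e.left_inv hp]
  have h3 : ContMDiffAt (𝓡 n) (𝓡 n) ∞ e' (f (e.symm (e p))) := by
    rw [e.left_inv hp]; exact contMDiffAt_of_mem_maximalAtlas he' hfp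
  exact h3.comp (e p) (f := f ∘ e.symm) (h2.comp (e p) h1)

theorem differentiableAt_coord (he : e ∈ IsManifold.maximalAtlas (𝓡 n) ∞ X)
    (he' : e' ∈ IsManifold.maximalAtlas (𝓡 n) ∞ Y) (hp : p ∈ e.source) (hfp : f p ∈ e'.source)
    (hf : ContMDiffAt (𝓡 n) (𝓡 n) ∞ f p) : DifferentiableAt ℝ (e' ∘ f ∘ e.symm) (e p) :=
  (contDiffAt_coord he he' hp hfp hf).differentiableAt (by simp)

theorem coordDeriv_comp (he : e ∈ IsManifold.maximalAtlas (𝓡 n) ∞ X)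
    (he' : e' ∈ IsManifold.maximalAtlas (𝓡 n) ∞ Y) (he'' : e'' ∈ IsManifold.maximalAtlas (𝓡 n) ∞ Z)
    (hp : p ∈ e.source) (hfp : f p ∈ e'.source) (hgp : g (f p) ∈ e''.source)
    (hf : ContMDiffAt (𝓡 n) (𝓡 n) ∞ f p) (hg : ContMDiffAt (𝓡 n) (𝓡 n) ∞ g (f p)) :
    coordDeriv e e'' (g ∘ f) p = (coordDeriv e' e'' g (f p)).comp (coordDeriv e e' f p) := by
  have hF := differentiableAt_coord he he' hp hfp hf
  have hG := differentiableAt_coord he' he'' hfp hgp hg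
  have h0 : (e' ∘ f ∘ e.symm) (e p) = e' (f p) := by simp [e.left_inv hp]
  unfold coordDeriv
  rw [← h0] at hG ⊢
  rw [← fderiv_comp _ hG hF]
  apply Filter.EventuallyEq.fderiv_eq
  have hc : ContinuousAt (f ∘ e.symm) (e p) :=
    ContinuousAt.comp (by rw [e.left_inv hp]; exact hf.continuousAt)
      (e.continuousAt_symm (e.map_source hp))
  have : ∀ᶠ v in 𝓝 (e p), (f ∘ e.symm) v ∈ e'.source :=
    hc.eventually_mem (e'.open_source.mem_nhds (by simpa [e.left_inv hp] using hfp))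
  filter_upwards [this] with v hv
  simp only [Function.comp_apply] at hv ⊢
  rw [e'.left_inv hv]

theorem coordDeriv_congr {f' : X → Y} (hp : p ∈ e.source) (h : f =ᶠ[𝓝 p] f') :
    coordDeriv e e' f p = coordDeriv e e' f' p := by
  apply Filter.EventuallyEq.fderiv_eq
  have hc := e.continuousAt_symm (e.map_source hp)
  rw [ContinuousAt, e.left_inv hp] at hc
  filter_upwards [hc.eventually h] with v hv
  simp [hv]

theorem coordDeriv_id (hp : p ∈ e.source) :
    coordDeriv e e id p = ContinuousLinearMap.id ℝ _ := by
  rw [← fderiv_id (x := e p)]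
  apply Filter.EventuallyEq.fderiv_eq
  filter_upwards [e.open_target.mem_nhds (e.map_source hp)] with v hv
  simp [e.right_inv hv]

theorem coordDeriv_id_comp_id (he : e ∈ IsManifold.maximalAtlas (𝓡 n) ∞ X)
    (he₁ : e₁ ∈ IsManifold.maximalAtlas (𝓡 n) ∞ X) (hp : p ∈ e.source) (hp₁ : p ∈ e₁.source) :
    (coordDeriv e₁ e id p).comp (coordDeriv e e₁ id p) = ContinuousLinearMap.id ℝ _ := by
  rw [← coordDeriv_id hp, ← Function.comp_id (id : X → X)]
  exact (coordDeriv_comp (f := id) (g := id) he he₁ he hp hp₁ hp contMDiffAt_id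
    contMDiffAt_id).symm

theorem det_coordDeriv_comp (he : e ∈ IsManifold.maximalAtlas (𝓡 n) ∞ X)
    (he' : e' ∈ IsManifold.maximalAtlas (𝓡 n) ∞ Y) (he'' : e'' ∈ IsManifold.maximalAtlas (𝓡 n) ∞ Z)
    (hp : p ∈ e.source) (hfp : f p ∈ e'.source) (hgp : g (f p) ∈ e''.source)
    (hf : ContMDiffAt (𝓡 n) (𝓡 n) ∞ f p) (hg : ContMDiffAt (𝓡 n) (𝓡 n) ∞ g (f p)) :
    (coordDeriv e e'' (g ∘ f) p).det =
      (coordDeriv e' e'' g (f p)).det * (coordDeriv e e' f p).det := by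
  rw [coordDeriv_comp he he' he'' hp hfp hgp hf hg]
  exact LinearMap.det_comp _ _

theorem det_coordDeriv_id_mul (he : e ∈ IsManifold.maximalAtlas (𝓡 n) ∞ X)
    (he₁ : e₁ ∈ IsManifold.maximalAtlas (𝓡 n) ∞ X) (hp : p ∈ e.source) (hp₁ : p ∈ e₁.source) :
    (coordDeriv e₁ e id p).det * (coordDeriv e e₁ id p).det = 1 := by
  refine (LinearMap.det_comp _ _).symm.trans (Eq.trans ?_
    (LinearMap.det_id (A := ℝ) (M := EuclideanSpace ℝ (Fin n))))
  exact congrArg ContinuousLinearMap.det (coordDeriv_id_comp_id he he₁ hp hp₁)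

/-- The derivative in coordinates depends continuously on the point. -/
theorem continuousAt_coordDeriv (he : e ∈ IsManifold.maximalAtlas (𝓡 n) ∞ X)
    (he' : e' ∈ IsManifold.maximalAtlas (𝓡 n) ∞ Y) (hp : p ∈ e.source) (hfp : f p ∈ e'.source)
    (hf : ContMDiffAt (𝓡 n) (𝓡 n) ∞ f p) : ContinuousAt (coordDeriv e e' f) p := by
  have h := (contDiffAt_coord he he' hp hfp hf).fderiv_right (m := 0) (by simp)
  exact ContinuousAt.comp (f := e) h.continuousAt (e.continuousAt hp)

end CoordinateDerivative

theorem IsPreconnected.pos_of_ne_zero {α : Type*} [TopologicalSpace α] {s : Set α}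
    (hs : IsPreconnected s) {g : α → ℝ} (hg : ContinuousOn g s) (h0 : ∀ x ∈ s, g x ≠ 0) {x y : α}
    (hx : x ∈ s) (hy : y ∈ s) (hgx : 0 < g x) : 0 < g y := by
  by_contra! h
  obtain ⟨z, hz, hz'⟩ := hs.intermediate_value hy hx hg ⟨h, hgx.le⟩
  exact h0 z hz hz'

/-! ### Signs of charts relative to an orientation. -/

namespace ManifoldOrientation

variable {n : ℕ}
  {X : Type*} [TopologicalSpace X] [ChartedSpace (EuclideanSpace ℝ (Fin n)) X]
  (o : ManifoldOrientation n X)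

theorem det_coordDeriv_pos {e e'} (he : e ∈ o.charts) (he' : e' ∈ o.charts) {p : X}
    (hp : p ∈ e.source) (hp' : p ∈ e'.source) : 0 < (coordDeriv e e' id p).det :=
  o.det_pos e he e' he' p hp hp'

variable {o} in
theorem Preserves.trans {f g : X ≃ₘ⟮𝓡 n, 𝓡 n⟯ X} (hf : o.Preserves f) (hg : o.Preserves g) :
    o.Preserves (f.trans g) := by
  intro e he e' he' p hp hp'
  obtain ⟨e₁, he₁, hp₁⟩ := o.charts_cover (f p)
  have := det_coordDeriv_comp (f := f) (g := g) (o.charts_smooth he) (o.charts_smooth he₁)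
    (o.charts_smooth he') hp hp₁ hp' f.contMDiff.contMDiffAt g.contMDiff.contMDiffAt
  exact this ▸ mul_pos (hg e₁ he₁ e' he' _ hp₁ hp') (hf e he e₁ he₁ p hp hp₁)

/-- The coordinate system `φ` behaves in the same way towards the orientation at all points. -/
def CoherentChart (φ : OpenPartialHomeomorph X (EuclideanSpace ℝ (Fin n))) : Prop :=
  ∀ e ∈ o.charts, ∀ e' ∈ o.charts, ∀ p ∈ e.source, ∀ p' ∈ e'.source, p ∈ φ.source →
    p' ∈ φ.source → 0 < (coordDeriv e φ id p).det * (coordDeriv e' φ id p').det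

variable {o}

theorem CoherentChart.positive_or_negative {φ} (h : o.CoherentChart φ) :
    o.PositiveChart φ ∨ o.NegativeChart φ := by
  by_cases h0 : o.NegativeChart φ
  · exact .inr h0
  · left
    simp only [NegativeChart, not_forall, not_lt] at h0
    obtain ⟨e, he, p, hp, hp', h1⟩ := h0
    exact fun e' he' p' hp' hφ' => pos_of_mul_pos_right (h e he e' he' p hp p' hp' ‹_› hφ') h1

theorem det_coordDeriv_id_ne_zero {φ e : OpenPartialHomeomorph X (EuclideanSpace ℝ (Fin n))}
    (hφ : φ ∈ IsManifold.maximalAtlas (𝓡 n) ∞ X) (he : e ∈ IsManifold.maximalAtlas (𝓡 n) ∞ X)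
    {p : X} (hp : p ∈ e.source) (hp' : p ∈ φ.source) : (coordDeriv e φ id p).det ≠ 0 :=
  right_ne_zero_of_mul_eq_one (det_coordDeriv_id_mul he hφ hp hp')

/-- The sign of the coordinate change to φ is locally constant: near q one oriented chart serves
both points, and its determinant is continuous and nonzero. Replacing an oriented chart by another
multiplies by a positive factor, so the relation may quantify over all charts and is an equivalence
that spreads over a connected set. -/
theorem coherentChart_of_isPreconnected {φ : OpenPartialHomeomorph X (EuclideanSpace ℝ (Fin n))}
    (hφ : φ ∈ IsManifold.maximalAtlas (𝓡 n) ∞ X) (hs : IsPreconnected φ.source) :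
    o.CoherentChart φ := by
  have key : ∀ p ∈ φ.source, ∀ p' ∈ φ.source, ∀ e ∈ o.charts, ∀ e' ∈ o.charts, p ∈ e.source →
      p' ∈ e'.source → 0 < (coordDeriv e φ id p).det * (coordDeriv e' φ id p').det := by
    intro p hp p' hp'
    have comp : ∀ e ∈ o.charts, ∀ e' ∈ o.charts, ∀ q ∈ φ.source, q ∈ e.source → q ∈ e'.source →
        (coordDeriv e φ id q).det = (coordDeriv e' φ id q).det * (coordDeriv e e' id q).det :=
      fun e he e' he' q hq hqe hqe' => det_coordDeriv_comp (f := id) (g := id)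
        (o.charts_smooth he) (o.charts_smooth he') hφ hqe hqe' hq contMDiffAt_id contMDiffAt_id
    refine hs.induction₂ (fun p p' => ∀ e ∈ o.charts, ∀ e' ∈ o.charts, p ∈ e.source →
      p' ∈ e'.source → 0 < (coordDeriv e φ id p).det * (coordDeriv e' φ id p').det) ?_ ?_ ?_ hp hp'
    · intro q hq
      obtain ⟨e₀, he₀, hqe₀⟩ := o.charts_cover q
      have hc : ContinuousAt (fun q' => (coordDeriv e₀ φ id q).det * (coordDeriv e₀ φ id q').det) q :=
        continuousAt_const.mul (ContinuousLinearMap.continuous_det.continuousAt.comp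
          (continuousAt_coordDeriv (o.charts_smooth he₀) hφ hqe₀ hq contMDiffAt_id))
      have hpos : 0 < (coordDeriv e₀ φ id q).det * (coordDeriv e₀ φ id q).det :=
        mul_self_pos.2 (det_coordDeriv_id_ne_zero hφ (o.charts_smooth he₀) hqe₀ hq)
      apply mem_nhdsWithin_of_mem_nhds
      filter_upwards [hc.eventually (lt_mem_nhds hpos), e₀.open_source.mem_nhds hqe₀,
        φ.open_source.mem_nhds hq] with q' hq' hqe' hqφ e he e' he' hqe hqe''
      rw [comp e he e₀ he₀ q hq hqe hqe₀, comp e' he' e₀ he₀ q' hqφ hqe'' hqe']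
      have h1 := o.det_coordDeriv_pos he he₀ hqe hqe₀
      have h2 := o.det_coordDeriv_pos he' he₀ hqe'' hqe'
      have := mul_pos hq' (mul_pos h1 h2)
      linarith
    · intro q₁ q₂ q₃ h₁ h₂ h₃ h12 h23 e he e' he' hq hq'
      obtain ⟨e₀, he₀, hqe₀⟩ := o.charts_cover q₂
      have h1 := mul_pos (h12 e he e₀ he₀ hq hqe₀) (h23 e₀ he₀ e' he' hqe₀ hq')
      have h2 : 0 < (coordDeriv e₀ φ id q₂).det * (coordDeriv e₀ φ id q₂).det :=
        mul_self_pos.2 (det_coordDeriv_id_ne_zero hφ (o.charts_smooth he₀) hqe₀ h₂)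
      refine pos_of_mul_pos_right (a := (coordDeriv e₀ φ id q₂).det * (coordDeriv e₀ φ id q₂).det) ?_ h2.le
      linarith
    · intro q₁ q₂ h₁ h₂ h12 e he e' he' hq hq'
      rw [mul_comm]
      exact h12 e' he' e he hq' hq
  exact fun e he e' he' p hp p' hp' hφ hφ' => key p hφ p' hφ' e he e' he' hp hp'

end ManifoldOrientation

/-! ### Diffeomorphisms of a vector space supported in a small ball -/

section Cutoff

variable {E : Type*} [NormedAddCommGroup E] [NormedSpace ℝ E] [FiniteDimensional ℝ E]

/-- In finite dimension an injective derivative is invertible, so the inverse function theorem gives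
a smooth local inverse, and this agrees with the global inverse nearby. -/
theorem contDiff_symm_of_injective_fderiv (f : E ≃ E) (hf : ContDiff ℝ ∞ f)
    (hinj : ∀ x, Function.Injective (fderiv ℝ f x)) : ContDiff ℝ ∞ f.symm := by
  rw [contDiff_iff_contDiffAt]
  intro y
  obtain ⟨x, rfl⟩ := f.surjective y
  let L : E ≃L[ℝ] E :=
    (LinearEquiv.ofInjectiveEndo (fderiv ℝ f x).toLinearMap (hinj x)).toContinuousLinearEquiv
  have hd : HasFDerivAt f (L : E →L[ℝ] E) x :=
    (hf.differentiable (by simp) x).hasFDerivAt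
  have hx := hf.contDiffAt (x := x)
  refine (hx.to_localInverse hd (by simp)).congr_of_eventuallyEq ?_
  have hs := hx.hasStrictFDerivAt' hd (by simp)
  filter_upwards [hs.eventually_right_inverse] with z hz
  exact f.symm_apply_eq.2 hz.symm

/-- Injectivity holds since a difference in the kernel would satisfy ‖v - w‖ ≤ ‖v - w‖ / 2. A
preimage of y is the Banach fixed point of w ↦ y - u w. -/
theorem bijective_add_of_lipschitzWith {u : E → E} (hu : LipschitzWith (1 / 2) u) :
    Function.Bijective fun v => v + u v := by
  constructor
  · intro v w h
    have h1 : v - w = u w - u v := by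
      simp only at h
      rw [sub_eq_sub_iff_add_eq_add, h, add_comm]
    have h2 := hu.dist_le_mul w v
    rw [dist_eq_norm, dist_eq_norm, ← h1, norm_sub_rev w v] at h2
    have : ‖v - w‖ = 0 := by
      have := norm_nonneg (v - w)
      push_cast at h2
      linarith
    exact sub_eq_zero.1 (norm_eq_zero.1 this)
  · intro y
    have hc : ContractingWith (1 / 2) fun w => y - u w :=
      ⟨by rw [← NNReal.coe_lt_coe]; norm_num, by simpa using (LipschitzWith.const y).sub hu⟩
    refine ⟨hc.fixedPoint, ?_⟩
    have h : y - u hc.fixedPoint = hc.fixedPoint := hc.fixedPoint_isFixedPt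
    simp only
    nth_rewrite 1 [← h]
    abel

/-- Perturbations of the identity by a smooth family of maps with Lipschitz constant `1/2` form a
smooth family of diffeomorphisms. -/
theorem exists_equiv_add_of_lipschitzWith {u : ℝ × E → E} (hu : ContDiff ℝ ∞ u)
    (hL : ∀ t, LipschitzWith (1 / 2) fun v => u (t, v)) :
    ∃ D : ℝ → E ≃ E, (∀ t v, D t v = v + u (t, v)) ∧
      ContDiff ℝ ∞ (fun q : ℝ × E => (D q.1).symm q.2) := by
  let D : ℝ → E ≃ E := fun t => Equiv.ofBijective _ (bijective_add_of_lipschitzWith (hL t))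
  have hD : ∀ t v, D t v = v + u (t, v) := fun t v => rfl
  refine ⟨D, hD, ?_⟩
  -- Including the parameter as a coordinate gives joint smoothness of the inverses from a single
  -- application of the inverse function theorem.
  let K : ℝ × E ≃ ℝ × E :=
    { toFun := fun q => (q.1, D q.1 q.2)
      invFun := fun q => (q.1, (D q.1).symm q.2)
      left_inv := fun q => by simp
      right_inv := fun q => by simp }
  have hK : ContDiff ℝ ∞ K := contDiff_fst.prodMk (contDiff_snd.add hu)
  refine contDiff_snd.comp (contDiff_symm_of_injective_fderiv K hK fun q => ?_)
  have hud : DifferentiableAt ℝ u q := hu.differentiable (by simp) q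
  have hKd : HasFDerivAt K ((ContinuousLinearMap.fst ℝ ℝ E).prod
      (ContinuousLinearMap.snd ℝ ℝ E + fderiv ℝ u q)) q :=
    hasFDerivAt_fst.prodMk (hasFDerivAt_snd.add hud.hasFDerivAt)
  rw [hKd.fderiv, injective_iff_map_eq_zero]
  rintro ⟨s, w⟩ h
  simp only [ContinuousLinearMap.prod_apply, ContinuousLinearMap.coe_fst',
    add_apply, ContinuousLinearMap.coe_snd', Prod.mk_eq_zero] at h
  obtain ⟨rfl, h⟩ := h
  have h1 : HasFDerivAt (fun v => u (q.1, v)) ((fderiv ℝ u q).comp (ContinuousLinearMap.inr ℝ ℝ E))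
      q.2 := HasFDerivAt.comp q.2 (g := u) (f := fun v => (q.1, v)) hud.hasFDerivAt
        (hasFDerivAt_prodMk_right q.1 q.2)
  have h2 := h1.le_of_lipschitz (hL q.1)
  have h3 : ‖fderiv ℝ u q (0, w)‖ ≤ 1 / 2 * ‖w‖ := by
    simpa using ((fderiv ℝ u q).comp (ContinuousLinearMap.inr ℝ ℝ E)).le_of_opNorm_le h2 w
  rw [eq_neg_of_add_eq_zero_right h, norm_neg] at h3
  have : ‖w‖ = 0 := by linarith [norm_nonneg w]
  simp [norm_eq_zero.1 this]

variable (E) in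
/-- Maps tangent to a linear map close to the identity may be cut off outside a small ball to
yield diffeomorphisms; this works in families. -/
theorem exists_cutoff_family : ∃ δ > 0, ∀ (h : ℝ × E → E) (W : Set (ℝ × E)), IsOpen W →
    ContDiffOn ℝ ∞ h W → (∀ t ∈ Icc (0 : ℝ) 1, (t, (0 : E)) ∈ W) →
    (∀ t ∈ Icc (0 : ℝ) 1, h (t, 0) = 0) →
    (∀ t ∈ Icc (0 : ℝ) 1, ‖fderiv ℝ (fun v => h (t, v)) 0 - ContinuousLinearMap.id ℝ E‖ ≤ δ) →
    ∀ r > 0, ∃ ρ > 0, 2 * ρ < r ∧ ∃ D : ℝ → E ≃ E,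
      ContDiff ℝ ∞ (fun q : ℝ × E => D q.1 q.2) ∧
      ContDiff ℝ ∞ (fun q : ℝ × E => (D q.1).symm q.2) ∧
      (∀ t ∈ Icc (0 : ℝ) 1, ∀ v : E, ‖v‖ ≤ ρ → (t, v) ∈ W) ∧
      (∀ t v, 2 * ρ ≤ ‖v‖ → D t v = v) ∧
      (∀ t v, ‖v‖ ≤ ρ → D t v = h (Real.smoothTransition t, v)) ∧
      (∀ t, (∀ v, ‖v‖ < r → h (Real.smoothTransition t, v) = v) → ∀ v, D t v = v) ∧
      (∀ t v, ‖v‖ ≤ 2 * ‖D t v‖) := by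
  let χ : ContDiffBump (0 : E) := ⟨1, 2, one_pos, one_lt_two⟩
  have hχ1 : ∀ v : E, ‖v‖ ≤ 1 → χ v = 1 := fun v hv =>
    χ.one_of_mem_closedBall (by simpa using hv)
  have hχ0 : ∀ v : E, 2 ≤ ‖v‖ → χ v = 0 := fun v hv =>
    χ.zero_of_le_dist (by simpa using hv)
  have hχs : ContDiff ℝ ∞ χ := χ.contDiff
  obtain ⟨C, hC⟩ := (χ.hasCompactSupport.fderiv (𝕜 := ℝ)).exists_bound_of_continuous
    (hχs.continuous_fderiv (by simp))
  have hC0 : 0 ≤ C := (norm_nonneg _).trans (hC 0)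
  -- Chosen so that (2 + 4C)δ = 1/2, which is the Lipschitz bound obtained below; C bounds the
  -- derivative of the bump function.
  refine ⟨1 / (4 + 8 * C), by positivity, ?_⟩
  set δ := 1 / (4 + 8 * C) with hδ
  have hδ0 : 0 < δ := by positivity
  have hδC : (2 + 4 * C) * δ ≤ 1 / 2 := by
    rw [hδ]; field_simp; linarith
  intro h W hW hh hW0 hh0 hhd r hr
  -- a tube on which the derivative is close to the identity
  have hdq : ∀ q ∈ W, HasFDerivAt (fun v => h (q.1, v))
      ((fderiv ℝ h q).comp (ContinuousLinearMap.inr ℝ ℝ E)) q.2 := fun q hq =>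
    HasFDerivAt.comp q.2 (g := h) (f := fun v => (q.1, v))
      ((hh.contDiffAt (hW.mem_nhds hq)).differentiableAt (by simp)).hasFDerivAt
        (hasFDerivAt_prodMk_right q.1 q.2)
  let N : ℝ × E → ℝ := fun q =>
    ‖(fderiv ℝ h q).comp (ContinuousLinearMap.inr ℝ ℝ E) - ContinuousLinearMap.id ℝ E‖
  have hN : ContinuousOn N W :=
    (((hh.continuousOn_fderiv_of_isOpen hW (by simp)).clm_comp continuousOn_const).sub
      continuousOn_const).norm
  have hopen : IsOpen (W ∩ N ⁻¹' Iio (2 * δ)) := hN.isOpen_inter_preimage hW isOpen_Iio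
  have hsub : Icc (0 : ℝ) 1 ×ˢ ({0} : Set E) ⊆ W ∩ N ⁻¹' Iio (2 * δ) := by
    rintro ⟨t, v⟩ ⟨ht, hv⟩
    obtain rfl : v = 0 := hv
    refine ⟨hW0 t ht, ?_⟩
    have := hhd t ht
    rw [(hdq (t, 0) (hW0 t ht)).fderiv] at this
    exact this.trans_lt (by linarith)
  -- Compactness of the time interval turns the estimate at v = 0 into an estimate on a ball of
  -- radius independent of t, at the cost of weakening δ to 2δ.
  obtain ⟨A, B, -, hB, hA', hB', hAB⟩ :=
    generalized_tube_lemma isCompact_Icc isCompact_singleton hopen hsub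
  obtain ⟨ρ₀, hρ₀, hball⟩ := Metric.isOpen_iff.1 hB 0 (hB' rfl)
  have hmem : ∀ t ∈ Icc (0 : ℝ) 1, ∀ v : E, ‖v‖ < ρ₀ → (t, v) ∈ W ∩ N ⁻¹' Iio (2 * δ) :=
    fun t ht v hv => hAB ⟨hA' ht, hball (by simpa using hv)⟩
  obtain ⟨ρ, hρ, hρ'⟩ : ∃ ρ > 0, 2 * ρ < min ρ₀ r :=
    ⟨min ρ₀ r / 4, by positivity, by linarith [lt_min hρ₀ hr]⟩
  have hρ1 : 2 * ρ < ρ₀ := hρ'.trans_le (min_le_left _ _)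
  have hρ2 : 2 * ρ < r := hρ'.trans_le (min_le_right _ _)
  let c : E → ℝ := fun v => χ (ρ⁻¹ • v)
  have hcs : ContDiff ℝ ∞ c := hχs.comp (contDiff_const_smul _)
  have hnorm : ∀ v : E, ‖ρ⁻¹ • v‖ = ρ⁻¹ * ‖v‖ := fun v => by
    rw [norm_smul, norm_inv, Real.norm_of_nonneg hρ.le]
  have hc1 : ∀ v, ‖v‖ ≤ ρ → c v = 1 := fun v hv => hχ1 _ (by
    rw [hnorm, inv_mul_le_iff₀ hρ]; linarith)
  have hc0 : ∀ v, 2 * ρ ≤ ‖v‖ → c v = 0 := fun v hv => hχ0 _ (by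
    rw [hnorm, le_inv_mul_iff₀ hρ]; linarith)
  have hcd : ∀ v, ‖fderiv ℝ c v‖ ≤ C * ρ⁻¹ := fun v => by
    have : HasFDerivAt c ((fderiv ℝ χ (ρ⁻¹ • v)).comp (ρ⁻¹ • ContinuousLinearMap.id ℝ E)) v :=
      HasFDerivAt.comp v (g := χ) (f := fun v => ρ⁻¹ • v)
        (hχs.differentiable (by simp) _).hasFDerivAt ((hasFDerivAt_id v).const_smul ρ⁻¹)
    rw [this.fderiv, ContinuousLinearMap.comp_smul, norm_smul, ContinuousLinearMap.comp_id,
      norm_inv, Real.norm_of_nonneg hρ.le, mul_comm]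
    gcongr
    exact hC _
  let w : ℝ → E → E := fun s v => h (s, v) - v
  have hwd : ∀ s ∈ Icc (0 : ℝ) 1, ∀ v : E, ‖v‖ < ρ₀ → ∃ w', HasFDerivAt (w s) w' v ∧
      ‖w'‖ ≤ 2 * δ := fun s hs v hv =>
    ⟨_, (hdq (s, v) (hmem s hs v hv).1).sub (hasFDerivAt_id v), (hmem s hs v hv).2.le⟩
  have hwn : ∀ s ∈ Icc (0 : ℝ) 1, ∀ v : E, ‖v‖ < ρ₀ → ‖w s v‖ ≤ 2 * δ * ‖v‖ := by
    intro s hs v hv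
    have := (convex_ball (0 : E) ρ₀).norm_image_sub_le_of_norm_fderiv_le (𝕜 := ℝ) (f := w s)
      (C := 2 * δ) (fun y hy => by
        obtain ⟨w', hw', -⟩ := hwd s hs y (by simpa using hy)
        exact hw'.differentiableAt)
      (fun y hy => by
        obtain ⟨w', hw', h'⟩ := hwd s hs y (by simpa using hy)
        rwa [hw'.fderiv]) (Metric.mem_ball_self hρ₀) (by simpa using hv : v ∈ Metric.ball 0 ρ₀)
    simpa [w, hh0 s hs] using this
  have hσ : ∀ t, Real.smoothTransition t ∈ Icc (0 : ℝ) 1 := fun t =>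
    ⟨Real.smoothTransition.nonneg t, Real.smoothTransition.le_one t⟩
  -- The smooth transition maps all real times into [0, 1], the only times at which h is controlled.
  let u : ℝ × E → E := fun q => c q.2 • w (Real.smoothTransition q.1) q.2
  have hu : ContDiff ℝ ∞ u := by
    rw [contDiff_iff_contDiffAt]
    rintro ⟨t, v⟩
    rcases lt_or_ge ‖v‖ ρ₀ with hv | hv
    · have h1 : ContDiffAt ℝ ∞ h (Real.smoothTransition t, v) :=
        hh.contDiffAt (hW.mem_nhds (hmem _ (hσ t) v hv).1)
      have h2 : ContDiffAt ℝ ∞ (fun q : ℝ × E => h (Real.smoothTransition q.1, q.2)) (t, v) :=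
        ContDiffAt.comp (t, v) (g := h) (f := fun q : ℝ × E => (Real.smoothTransition q.1, q.2)) h1
          ((Real.smoothTransition.contDiff.comp contDiff_fst).prodMk contDiff_snd).contDiffAt
      exact (hcs.comp contDiff_snd).contDiffAt.smul (h2.sub contDiffAt_snd)
    · refine contDiffAt_const (c := (0 : E)) |>.congr_of_eventuallyEq ?_
      have : ∀ᶠ q : ℝ × E in 𝓝 (t, v), 2 * ρ < ‖q.2‖ :=
        continuous_snd.norm.continuousAt.eventually (lt_mem_nhds (hρ1.trans_le hv))
      filter_upwards [this] with q hq
      simp [u, hc0 q.2 hq.le]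
  have hL : ∀ t, LipschitzWith (1 / 2) fun v => u (t, v) := by
    intro t
    have hut : ContDiff ℝ ∞ fun v => u (t, v) := hu.comp (contDiff_const.prodMk contDiff_id)
    refine lipschitzWith_of_nnnorm_fderiv_le (𝕜 := ℝ) (hut.differentiable (by simp)) fun v => ?_
    rw [← NNReal.coe_le_coe, coe_nnnorm]
    push_cast
    rcases le_or_gt ‖v‖ (2 * ρ) with hv | hv
    · have hv' := hv.trans_lt hρ1
      obtain ⟨w', hw', hw2⟩ := hwd _ (hσ t) v hv'
      have hd : HasFDerivAt (fun v => u (t, v)) _ v :=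
        ((hcs.differentiable (by simp) v).hasFDerivAt).smul hw'
      rw [hd.fderiv]
      have hcn : ‖c v‖ ≤ 1 := by
        rw [Real.norm_of_nonneg (χ.nonneg)]; exact χ.le_one
      -- The cut-off has slope C/ρ, but w vanishes at 0 with slope at most 2δ and only ‖v‖ ≤ 2ρ
      -- matters, so the factors of ρ cancel.
      calc _ ≤ ‖c v • w'‖ + ‖(fderiv ℝ c v).smulRight (w (Real.smoothTransition t) v)‖ :=
            norm_add_le _ _
        _ ≤ 1 * (2 * δ) + (C * ρ⁻¹) * (2 * δ * (2 * ρ)) := by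
            rw [norm_smul, ContinuousLinearMap.norm_smulRight_apply]
            gcongr
            · exact hcd v
            · exact (hwn _ (hσ t) v hv').trans (by gcongr)
        _ = (2 + 4 * C) * δ := by field_simp; ring
        _ ≤ 1 / 2 := hδC
    · have : (fun v => u (t, v)) =ᶠ[𝓝 v] fun _ => 0 := by
        filter_upwards [continuous_norm.continuousAt.eventually (lt_mem_nhds hv)] with y hy
        simp [u, hc0 y hy.le]
      rw [this.fderiv_eq]
      simp
  obtain ⟨D, hD, hDs⟩ := exists_equiv_add_of_lipschitzWith hu hL
  refine ⟨ρ, hρ, hρ2, D, ?_, hDs, fun t ht v hv => (hmem t ht v (by linarith)).1, ?_, ?_, ?_, ?_⟩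
  · simp only [hD]
    exact contDiff_snd.add hu
  · intro t v hv
    simp [hD, u, hc0 v hv]
  · intro t v hv
    simp [hD, u, hc1 v hv, w]
  · intro t ht v
    rw [hD]
    rcases lt_or_ge ‖v‖ r with hv | hv
    · simp [u, w, ht v hv]
    · simp [u, hc0 v (hρ2.le.trans hv)]
  · intro t v
    rw [hD]
    have h0 : u (t, 0) = 0 := by simp [u, w, hh0 _ (hσ t)]
    have h1 := (hL t).dist_le_mul v 0
    simp only [h0, dist_zero_right] at h1
    push_cast at h1
    have h2 : ‖v‖ ≤ ‖v + u (t, v)‖ + ‖u (t, v)‖ := by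
      simpa using norm_sub_le (v + u (t, v)) (u (t, v))
    linarith

end Cutoff

/-! ### Extending diffeomorphisms from a chart -/

section ChartExtend

variable {n : ℕ} {X : Type*} [TopologicalSpace X] [ChartedSpace (EuclideanSpace ℝ (Fin n)) X]

/-- A smooth family of diffeomorphisms, parametrized by the real line. -/
structure IsSmoothFamily (b : ℝ → (X ≃ₘ⟮𝓡 n, 𝓡 n⟯ X)) : Prop where
  contMDiff : ContMDiff (𝓘(ℝ, ℝ).prod (𝓡 n)) (𝓡 n) ∞ (fun q : ℝ × X => b q.1 q.2)
  contMDiff_symm : ContMDiff (𝓘(ℝ, ℝ).prod (𝓡 n)) (𝓡 n) ∞ (fun q : ℝ × X => (b q.1).symm q.2)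

theorem fderiv_det_ne_zero_of_equiv {E : Type*} [NormedAddCommGroup E] [NormedSpace ℝ E]
    (D : E ≃ E) (hD : ContDiff ℝ ∞ D) (hDs : ContDiff ℝ ∞ D.symm) (v : E) :
    (fderiv ℝ D v).det ≠ 0 := by
  have h : (fderiv ℝ D.symm (D v)).comp (fderiv ℝ D v) = ContinuousLinearMap.id ℝ E := by
    rw [← fderiv_comp v (hDs.differentiable (by simp) _) (hD.differentiable (by simp) _)]
    simp
  have h' := congrArg ContinuousLinearMap.det h
  have h'' := (LinearMap.det_comp (fderiv ℝ D.symm (D v)).toLinearMap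
    (fderiv ℝ D v).toLinearMap).symm.trans (h'.trans (LinearMap.det_id (A := ℝ) (M := E)))
  exact right_ne_zero_of_mul_eq_one h''

/-- The determinant is continuous, never zero, and equal to 1 far out where D is the identity.
Positive dimension guarantees that there are vectors far out. -/
theorem fderiv_det_pos_of_support (hn : 0 < n)
    (D : EuclideanSpace ℝ (Fin n) ≃ EuclideanSpace ℝ (Fin n)) (hD : ContDiff ℝ ∞ D)
    (hDs : ContDiff ℝ ∞ D.symm) {r : ℝ} (hr : ∀ v, r ≤ ‖v‖ → D v = v)
    (v : EuclideanSpace ℝ (Fin n)) : 0 < (fderiv ℝ D v).det := by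
  have : Nonempty (Fin n) := ⟨⟨0, hn⟩⟩
  obtain ⟨w, hw⟩ := exists_norm_eq (EuclideanSpace ℝ (Fin n)) (c := |r| + 1) (by positivity)
  have hc : Continuous fun v => (fderiv ℝ D v).det :=
    ContinuousLinearMap.continuous_det.comp (hD.continuous_fderiv (by simp))
  refine isPreconnected_univ.pos_of_ne_zero hc.continuousOn
    (fun v _ => fderiv_det_ne_zero_of_equiv D hD hDs v) (mem_univ w) (mem_univ v) ?_
  have : D =ᶠ[𝓝 w] id := by
    have hw' : r < ‖w‖ := by rw [hw]; linarith [le_abs_self r]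
    filter_upwards [continuous_norm.continuousAt.eventually (lt_mem_nhds hw')] with y hy
    exact hr y hy.le
  rw [this.fderiv_eq, fderiv_id]
  exact one_pos.trans_eq (LinearMap.det_id (A := ℝ) (M := EuclideanSpace ℝ (Fin n))).symm

open Classical in
/-- The map which is `τ` in the coordinates `ψ` and the identity outside their domain. -/
noncomputable def chartExtend (ψ : OpenPartialHomeomorph X (EuclideanSpace ℝ (Fin n)))
    (τ : EuclideanSpace ℝ (Fin n) → EuclideanSpace ℝ (Fin n)) (p : X) : X :=
  if p ∈ ψ.source then ψ.symm (τ (ψ p)) else p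

variable {ψ : OpenPartialHomeomorph X (EuclideanSpace ℝ (Fin n))}
  {τ : EuclideanSpace ℝ (Fin n) → EuclideanSpace ℝ (Fin n)}

theorem chartExtend_of_mem {p : X} (hp : p ∈ ψ.source) :
    chartExtend ψ τ p = ψ.symm (τ (ψ p)) := if_pos hp

theorem chartExtend_of_notMem {p : X} (hp : p ∉ ψ.source) : chartExtend ψ τ p = p := if_neg hp

theorem chartExtend_mem (hτ : MapsTo τ ψ.target ψ.target) {p : X} (hp : p ∈ ψ.source) :
    chartExtend ψ τ p ∈ ψ.source ∧ ψ (chartExtend ψ τ p) = τ (ψ p) := by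
  have := hτ (ψ.map_source hp)
  rw [chartExtend_of_mem hp]
  exact ⟨ψ.map_target this, ψ.right_inv this⟩

theorem chartExtend_chartExtend {τ' : EuclideanSpace ℝ (Fin n) → EuclideanSpace ℝ (Fin n)}
    (hτ : MapsTo τ ψ.target ψ.target) (h : ∀ v, τ' (τ v) = v) (p : X) :
    chartExtend ψ τ' (chartExtend ψ τ p) = p := by
  by_cases hp : p ∈ ψ.source
  · obtain ⟨h1, h2⟩ := chartExtend_mem hτ hp
    rw [chartExtend_of_mem h1, h2, h, ψ.left_inv hp]
  · rw [chartExtend_of_notMem hp, chartExtend_of_notMem hp]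

/-- A vector thrown out of the ball would land on a fixed point of D, and injectivity would make it
that fixed point. -/
theorem mapsTo_target_of_support (D : EuclideanSpace ℝ (Fin n) ≃ EuclideanSpace ℝ (Fin n)) {r : ℝ}
    (hr : ∀ v, r ≤ ‖v‖ → D v = v) {s : Set (EuclideanSpace ℝ (Fin n))}
    (hs : Metric.closedBall 0 r ⊆ s) : MapsTo D s s := by
  intro v hv
  rcases le_or_gt r ‖v‖ with h | h
  · rwa [hr v h]
  · apply hs
    rw [mem_closedBall_zero_iff]
    by_contra! h'
    have := D.injective (hr _ h'.le)
    rw [this] at h'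
    exact absurd h' (not_lt.2 h.le)

/-- Only points outside the chart need an argument. The ball carrying the support is compact, hence
closed in the Hausdorff space X, so such points have a neighbourhood on which the map is the
identity. -/
theorem contMDiff_chartExtend [T2Space X] (hψ : ψ ∈ IsManifold.maximalAtlas (𝓡 n) ∞ X) {r : ℝ}
    (hrt : Metric.closedBall 0 r ⊆ ψ.target) {G : ℝ → EuclideanSpace ℝ (Fin n) →
      EuclideanSpace ℝ (Fin n)} (hG : ContDiff ℝ ∞ fun q : ℝ × EuclideanSpace ℝ (Fin n) => G q.1 q.2)
    (hm : ∀ t, MapsTo (G t) ψ.target ψ.target) (hr : ∀ t v, r ≤ ‖v‖ → G t v = v) :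
    ContMDiff (𝓘(ℝ, ℝ).prod (𝓡 n)) (𝓡 n) ∞ (fun q : ℝ × X => chartExtend ψ (G q.1) q.2) := by
  rintro ⟨t, p⟩
  by_cases hp : p ∈ ψ.source
  · have h1 : ContMDiffAt (𝓘(ℝ, ℝ).prod (𝓡 n)) 𝓘(ℝ, ℝ × EuclideanSpace ℝ (Fin n)) ∞
        (fun q : ℝ × X => (q.1, ψ q.2)) (t, p) :=
      contMDiffAt_fst.prodMk_space
        ((contMDiffAt_of_mem_maximalAtlas hψ hp).comp (t, p) contMDiffAt_snd)
    have h2 : ContMDiffAt (𝓘(ℝ, ℝ).prod (𝓡 n)) (𝓡 n) ∞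
        (fun q : ℝ × X => G q.1 (ψ q.2)) (t, p) :=
      hG.contMDiff.contMDiffAt.comp (t, p) h1
    have h3 : ContMDiffAt (𝓘(ℝ, ℝ).prod (𝓡 n)) (𝓡 n) ∞
        (fun q : ℝ × X => ψ.symm (G q.1 (ψ q.2))) (t, p) :=
      (contMDiffAt_symm_of_mem_maximalAtlas hψ (hm t (ψ.map_source hp))).comp (t, p)
        (f := fun q : ℝ × X => G q.1 (ψ q.2)) h2
    refine h3.congr_of_eventuallyEq ?_
    filter_upwards [continuous_snd.continuousAt.eventually (ψ.open_source.mem_nhds hp)] with q hq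
    exact chartExtend_of_mem hq
  · have hK : IsClosed (ψ.symm '' Metric.closedBall 0 r) :=
      ((isCompact_closedBall _ _).image_of_continuousOn (ψ.continuousOn_symm.mono hrt)).isClosed
    have hpK : p ∉ ψ.symm '' Metric.closedBall 0 r := by
      rintro ⟨v, hv, rfl⟩
      exact hp (ψ.map_target (hrt hv))
    refine contMDiffAt_snd.congr_of_eventuallyEq ?_
    filter_upwards [continuous_snd.continuousAt.eventually (hK.isOpen_compl.mem_nhds hpK)]
      with q hq
    by_cases hqs : q.2 ∈ ψ.source
    · rw [chartExtend_of_mem hqs, hr, ψ.left_inv hqs]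
      by_contra! h
      exact hq ⟨ψ q.2, by simpa using h.le, ψ.left_inv hqs⟩
    · exact chartExtend_of_notMem hqs

theorem exists_family_chartExtend [T2Space X] (hψ : ψ ∈ IsManifold.maximalAtlas (𝓡 n) ∞ X) {r : ℝ}
    (hrt : Metric.closedBall 0 r ⊆ ψ.target)
    {D : ℝ → EuclideanSpace ℝ (Fin n) ≃ EuclideanSpace ℝ (Fin n)}
    (hD : ContDiff ℝ ∞ fun q : ℝ × EuclideanSpace ℝ (Fin n) => D q.1 q.2)
    (hDs : ContDiff ℝ ∞ fun q : ℝ × EuclideanSpace ℝ (Fin n) => (D q.1).symm q.2)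
    (hr : ∀ t v, r ≤ ‖v‖ → D t v = v) :
    ∃ T : ℝ → (X ≃ₘ⟮𝓡 n, 𝓡 n⟯ X), IsSmoothFamily T ∧ (∀ t p, T t p = chartExtend ψ (D t) p) ∧
      ∀ t, ∀ p ∈ ψ.source, T t p ∈ ψ.source ∧ ψ (T t p) = D t (ψ p) := by
  have hm : ∀ t, MapsTo (D t) ψ.target ψ.target := fun t => mapsTo_target_of_support _ (hr t) hrt
  have hr' : ∀ t v, r ≤ ‖v‖ → (D t).symm v = v := fun t v hv => by
    rw [Equiv.symm_apply_eq, hr t v hv]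
  have hm' : ∀ t, MapsTo (D t).symm ψ.target ψ.target :=
    fun t => mapsTo_target_of_support _ (hr' t) hrt
  have h1 := contMDiff_chartExtend hψ hrt hD hm hr
  have h2 := contMDiff_chartExtend hψ hrt hDs hm' hr'
  have hi : ∀ t, ContMDiff (𝓡 n) (𝓘(ℝ, ℝ).prod (𝓡 n)) ∞ (fun p : X => ((t, p) : ℝ × X)) :=
    fun t => contMDiff_const.prodMk contMDiff_id
  let T : ℝ → (X ≃ₘ⟮𝓡 n, 𝓡 n⟯ X) := fun t =>
    { toFun := chartExtend ψ (D t)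
      invFun := chartExtend ψ (D t).symm
      left_inv := chartExtend_chartExtend (hm t) (D t).symm_apply_apply
      right_inv := chartExtend_chartExtend (hm' t) (D t).apply_symm_apply
      contMDiff_toFun := h1.comp (hi t)
      contMDiff_invFun := h2.comp (hi t) }
  exact ⟨T, ⟨h1, h2⟩, fun t p => rfl, fun t p hp => chartExtend_mem (hm t) hp⟩

theorem coordDeriv_of_eq {f : X → X} {τ : EuclideanSpace ℝ (Fin n) → EuclideanSpace ℝ (Fin n)}
    (h : ∀ p ∈ ψ.source, ψ (f p) = τ (ψ p)) {p : X} (hp : p ∈ ψ.source) :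
    coordDeriv ψ ψ f p = fderiv ℝ τ (ψ p) := by
  apply Filter.EventuallyEq.fderiv_eq
  filter_upwards [ψ.open_target.mem_nhds (ψ.map_source hp)] with v hv
  simp [h _ (ψ.map_target hv), ψ.right_inv hv]

/-- Inside the chart, the determinant in oriented charts is that of D multiplied by coordinate
changes at p and at f p. Coherence makes their product positive although p and f p may lie in
different oriented charts. -/
theorem ManifoldOrientation.CoherentChart.preserves [T2Space X] {o : ManifoldOrientation n X}
    (hn : 0 < n) (hc : o.CoherentChart ψ) (hψ : ψ ∈ IsManifold.maximalAtlas (𝓡 n) ∞ X) {r : ℝ}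
    (hrt : Metric.closedBall 0 r ⊆ ψ.target)
    {D : EuclideanSpace ℝ (Fin n) ≃ EuclideanSpace ℝ (Fin n)}
    (hD : ContDiff ℝ ∞ D) (hDs : ContDiff ℝ ∞ D.symm)
    (hr : ∀ v, r ≤ ‖v‖ → D v = v) {f : X ≃ₘ⟮𝓡 n, 𝓡 n⟯ X} (hf : ∀ p, f p = chartExtend ψ D p) :
    o.Preserves f := by
  have hm : MapsTo D ψ.target ψ.target := mapsTo_target_of_support _ hr hrt
  have hf' : ∀ p ∈ ψ.source, f p ∈ ψ.source ∧ ψ (f p) = D (ψ p) := fun p hp => by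
    rw [hf]; exact chartExtend_mem hm hp
  intro e he e' he' p hp hp'
  have hes := o.charts_smooth he
  have hes' := o.charts_smooth he'
  change 0 < (coordDeriv e e' f p).det
  by_cases hpψ : p ∈ ψ.source
  · have hfψ := (hf' p hpψ).1
    have h1 : (coordDeriv e e' f p).det = _ := det_coordDeriv_comp (f := f) (g := id) hes hψ hes' hp
      hfψ hp' f.contMDiff.contMDiffAt contMDiffAt_id
    have h2 : (coordDeriv e ψ f p).det = _ := det_coordDeriv_comp (f := id) (g := f) hes hψ hψ hp
      hpψ hfψ contMDiffAt_id f.contMDiff.contMDiffAt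
    have h3 := hc e he e' he' p hp (f p) hp' hpψ hfψ
    have h4 := det_coordDeriv_id_mul hes' hψ hp' hfψ
    have h5 : 0 < (coordDeriv ψ ψ f p).det := by
      rw [coordDeriv_of_eq (fun p hp => (hf' p hp).2) hpψ]
      exact fderiv_det_pos_of_support hn D hD hDs hr _
    have h6 : 0 < (coordDeriv ψ e' id (f p)).det * (coordDeriv e ψ id p).det := by
      have : (coordDeriv ψ e' id (f p)).det * (coordDeriv e ψ id p).det =
        ((coordDeriv e ψ id p).det * (coordDeriv e' ψ id (f p)).det) *
          ((coordDeriv ψ e' id (f p)).det) ^ 2 := by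
        linear_combination (-(coordDeriv e ψ id p).det * (coordDeriv ψ e' id (f p)).det) * h4
      rw [this]
      exact mul_pos h3 (sq_pos_of_ne_zero (left_ne_zero_of_mul_eq_one h4))
    rw [h1, h2]
    have := mul_pos h5 h6
    simp only [id_eq] at this ⊢
    linarith
  · have hK : IsClosed (ψ.symm '' Metric.closedBall 0 r) :=
      ((isCompact_closedBall _ _).image_of_continuousOn (ψ.continuousOn_symm.mono hrt)).isClosed
    have hpK : p ∉ ψ.symm '' Metric.closedBall 0 r := by
      rintro ⟨v, hv, rfl⟩
      exact hpψ (ψ.map_target (hrt hv))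
    have hfp : f p = p := by rw [hf, chartExtend_of_notMem hpψ]
    rw [coordDeriv_congr (f' := id) hp]
    · exact o.det_coordDeriv_pos he he' hp (hfp ▸ hp')
    · filter_upwards [hK.isOpen_compl.mem_nhds hpK] with q hq
      rw [hf]
      by_cases hqs : q ∈ ψ.source
      · rw [chartExtend_of_mem hqs, hr, ψ.left_inv hqs]; rfl
        by_contra! h
        exact hq ⟨ψ q, by simpa using h.le, ψ.left_inv hqs⟩
      · exact chartExtend_of_notMem hqs

end ChartExtend

/-! ### Differentials at a fixed point -/

section FixedPoint

theorem finrank_commonNegativeSubspace_conj {V V' : Type*} [AddCommGroup V] [Module ℝ V]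
    [AddCommGroup V'] [Module ℝ V'] (L : V ≃ₗ[ℝ] V') (A C : Module.End ℝ V) :
    Module.finrank ℝ (commonNegativeSubspace (L.conj A) (L.conj C)) =
      Module.finrank ℝ (commonNegativeSubspace A C) := by
  have h1 : ∀ (B : Module.End ℝ V) (μ : ℝ), (L.conj B).maxGenEigenspace μ =
      (B.maxGenEigenspace μ).map L.toLinearMap := by
    intro B μ
    ext v
    rw [Submodule.mem_map_equiv, Module.End.mem_maxGenEigenspace, Module.End.mem_maxGenEigenspace]
    have : ∀ k : ℕ, ((L.conj B - μ • 1) ^ k) v = L (((B - μ • 1) ^ k) (L.symm v)) := fun k => by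
      induction k with
      | zero => simp
      | succ k ih => simp [pow_succ', ih, LinearEquiv.conj_apply_apply]
    simp only [this, LinearEquiv.map_eq_zero_iff]
  have h2 : commonNegativeSubspace (L.conj A) (L.conj C) =
      (commonNegativeSubspace A C).map L.toLinearMap := by
    simp only [commonNegativeSubspace, h1, ← Submodule.map_iSup]
    exact (Submodule.map_inf _ L.injective).symm
  rw [h2]
  exact LinearEquiv.finrank_map_eq L _

variable {n : ℕ} {X : Type*} [TopologicalSpace X] [ChartedSpace (EuclideanSpace ℝ (Fin n)) X]

theorem fixedPointDifferential_eq [IsManifold (𝓡 n) ∞ X] {f : X → X} {x : X}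
    (hf : ContMDiffAt (𝓡 n) (𝓡 n) ∞ f x) (hx : f x = x) :
    fixedPointDifferential (n := n) f x =
      (coordDeriv (chartAt (EuclideanSpace ℝ (Fin n)) x) (chartAt (EuclideanSpace ℝ (Fin n)) x) f
        x).toLinearMap := by
  have h : mfderiv (𝓡 n) (𝓡 n) f x = fderiv ℝ
      (chartAt (EuclideanSpace ℝ (Fin n)) (f x) ∘ f ∘ (chartAt (EuclideanSpace ℝ (Fin n)) x).symm)
      (chartAt (EuclideanSpace ℝ (Fin n)) x x) := by
    rw [(hf.mdifferentiableAt (by simp)).mfderiv]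
    simp [writtenInExtChartAt, extChartAt, OpenPartialHomeomorph.extend]
    rfl
  unfold fixedPointDifferential coordDeriv
  rw [h, hx]

/-- In any coordinates, differentials at a fixed point are expressed through a conjugation. -/
theorem exists_conj_fixedPointDifferential [IsManifold (𝓡 n) ∞ X]
    {ψ : OpenPartialHomeomorph X (EuclideanSpace ℝ (Fin n))}
    (hψ : ψ ∈ IsManifold.maximalAtlas (𝓡 n) ∞ X) {x : X} (hx : x ∈ ψ.source) :
    ∃ L : EuclideanSpace ℝ (Fin n) ≃ₗ[ℝ] EuclideanSpace ℝ (Fin n), ∀ f : X → X,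
      ContMDiffAt (𝓡 n) (𝓡 n) ∞ f x → f x = x →
      fixedPointDifferential (n := n) f x = L.conj (coordDeriv ψ ψ f x).toLinearMap := by
  set c := chartAt (EuclideanSpace ℝ (Fin n)) x
  have hc : c ∈ IsManifold.maximalAtlas (𝓡 n) ∞ X := IsManifold.chart_mem_maximalAtlas x
  have hxc : x ∈ c.source := mem_chart_source _ x
  have h1 := coordDeriv_id_comp_id hc hψ hxc hx
  have h2 := coordDeriv_id_comp_id hψ hc hx hxc
  refine ⟨LinearEquiv.ofLinearMap (coordDeriv ψ c id x).toLinearMap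
    (coordDeriv c ψ id x).toLinearMap (congrArg ContinuousLinearMap.toLinearMap h1)
    (congrArg ContinuousLinearMap.toLinearMap h2), fun f hf hfx => ?_⟩
  rw [fixedPointDifferential_eq hf hfx]
  have h3 := coordDeriv_comp (f := f) (g := id) hc hψ hc hxc (by rwa [hfx])
    (by simpa only [hfx]) hf contMDiffAt_id
  have h4 := coordDeriv_comp (f := id) (g := f) hc hψ hψ hxc hx
    (by simpa only [id_eq, hfx]) contMDiffAt_id hf
  rw [Function.comp_id] at h4
  rw [Function.id_comp, h4, hfx] at h3
  exact congrArg ContinuousLinearMap.toLinearMap h3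

theorem fixedPointDifferential_eq_id_iff [IsManifold (𝓡 n) ∞ X]
    {ψ : OpenPartialHomeomorph X (EuclideanSpace ℝ (Fin n))}
    (hψ : ψ ∈ IsManifold.maximalAtlas (𝓡 n) ∞ X) {x : X} (hx : x ∈ ψ.source) {f : X → X}
    (hf : ContMDiffAt (𝓡 n) (𝓡 n) ∞ f x) (hfx : f x = x) :
    fixedPointDifferential (n := n) f x = LinearMap.id ↔ coordDeriv ψ ψ f x = 1 := by
  obtain ⟨L, hL⟩ := exists_conj_fixedPointDifferential hψ hx
  rw [hL f hf hfx]
  constructor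
  · intro h
    have : L.conj (coordDeriv ψ ψ f x).toLinearMap = L.conj LinearMap.id :=
      h.trans L.conj_id.symm
    ext1 v
    exact LinearMap.congr_fun (L.conj.injective this) v
  · intro h
    rw [h]
    exact L.conj_id

variable {ψ : OpenPartialHomeomorph X (EuclideanSpace ℝ (Fin n))} {x : X}

theorem coordDeriv_trans (hψ : ψ ∈ IsManifold.maximalAtlas (𝓡 n) ∞ X) (hx : x ∈ ψ.source)
    {f g : X ≃ₘ⟮𝓡 n, 𝓡 n⟯ X} (hf : f x = x) (hg : g x = x) :
    coordDeriv ψ ψ (f.trans g) x = coordDeriv ψ ψ g x * coordDeriv ψ ψ f x := by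
  have := coordDeriv_comp (f := f) (g := g) hψ hψ hψ hx (by rwa [hf]) (by rwa [hf, hg])
    f.contMDiff.contMDiffAt g.contMDiff.contMDiffAt
  rw [hf] at this
  exact this

theorem Diffeomorph.symm_fixed {f : X ≃ₘ⟮𝓡 n, 𝓡 n⟯ X} (hf : f x = x) : f.symm x = x := by
  rw [← hf, f.symm_apply_apply, hf]

theorem coordDeriv_refl (hx : x ∈ ψ.source) :
    coordDeriv ψ ψ (Diffeomorph.refl (𝓡 n) X ∞) x = 1 := coordDeriv_id hx

theorem coordDeriv_symm_mul (hψ : ψ ∈ IsManifold.maximalAtlas (𝓡 n) ∞ X) (hx : x ∈ ψ.source)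
    {f : X ≃ₘ⟮𝓡 n, 𝓡 n⟯ X} (hf : f x = x) :
    coordDeriv ψ ψ f.symm x * coordDeriv ψ ψ f x = 1 := by
  rw [← coordDeriv_trans hψ hx hf (Diffeomorph.symm_fixed hf), Diffeomorph.self_trans_symm,
    coordDeriv_refl hx]

theorem coordDeriv_mul_symm (hψ : ψ ∈ IsManifold.maximalAtlas (𝓡 n) ∞ X) (hx : x ∈ ψ.source)
    {f : X ≃ₘ⟮𝓡 n, 𝓡 n⟯ X} (hf : f x = x) :
    coordDeriv ψ ψ f x * coordDeriv ψ ψ f.symm x = 1 := by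
  rw [← coordDeriv_trans hψ hx (Diffeomorph.symm_fixed hf) hf, Diffeomorph.symm_trans_self,
    coordDeriv_refl hx]

theorem diffCommutator_fixed {a c : X ≃ₘ⟮𝓡 n, 𝓡 n⟯ X} (ha : a x = x) (hc : c x = x) :
    diffCommutator a c x = x := by
  simp [diffCommutator, Diffeomorph.symm_fixed ha, Diffeomorph.symm_fixed hc, ha, hc]

/-- The link between geometry and linear algebra: the differential of the commutator is A C A⁻¹ C⁻¹.
Deformations need only keep the differentials commuting. -/
theorem coordDeriv_diffCommutator (hψ : ψ ∈ IsManifold.maximalAtlas (𝓡 n) ∞ X)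
    (hx : x ∈ ψ.source) {a c : X ≃ₘ⟮𝓡 n, 𝓡 n⟯ X} (ha : a x = x) (hc : c x = x) :
    coordDeriv ψ ψ (diffCommutator a c) x = 1 ↔
      Commute (coordDeriv ψ ψ a x) (coordDeriv ψ ψ c x) := by
  have ha' := Diffeomorph.symm_fixed ha
  have hc' := Diffeomorph.symm_fixed hc
  rw [diffCommutator, coordDeriv_trans hψ hx (by simp [ha', hc']) (by simp [ha, hc]),
    coordDeriv_trans hψ hx hc ha, coordDeriv_trans hψ hx hc' ha']
  have h1 := coordDeriv_symm_mul hψ hx ha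
  have h2 := coordDeriv_symm_mul hψ hx hc
  have h3 := coordDeriv_mul_symm hψ hx ha
  have h4 := coordDeriv_mul_symm hψ hx hc
  set A := coordDeriv ψ ψ a x
  set C := coordDeriv ψ ψ c x
  set A' := coordDeriv ψ ψ a.symm x
  set C' := coordDeriv ψ ψ c.symm x
  constructor
  · intro h
    calc A * C = (A * C * (A' * C')) * (C * A) := by
          rw [show A * C * (A' * C') * (C * A) = A * C * (A' * (C' * C) * A) by noncomm_ring, h2,
            mul_one, h1, mul_one]
      _ = C * A := by rw [h, one_mul]
  · intro h
    rw [h.eq, show C * A * (A' * C') = C * (A * A') * C' by noncomm_ring, h3, mul_one, h4]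

theorem IsSmoothFamily.const (f : X ≃ₘ⟮𝓡 n, 𝓡 n⟯ X) : IsSmoothFamily fun _ : ℝ => f :=
  ⟨f.contMDiff.comp contMDiff_snd, f.symm.contMDiff.comp contMDiff_snd⟩

theorem contMDiff_family_comp {f g : ℝ → X → X}
    (hf : ContMDiff (𝓘(ℝ, ℝ).prod (𝓡 n)) (𝓡 n) ∞ (fun q : ℝ × X => f q.1 q.2))
    (hg : ContMDiff (𝓘(ℝ, ℝ).prod (𝓡 n)) (𝓡 n) ∞ (fun q : ℝ × X => g q.1 q.2)) :
    ContMDiff (𝓘(ℝ, ℝ).prod (𝓡 n)) (𝓡 n) ∞ (fun q : ℝ × X => g q.1 (f q.1 q.2)) :=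
  hg.comp (contMDiff_fst.prodMk hf)

theorem contMDiff_family_reparam {f : ℝ → X → X}
    (hf : ContMDiff (𝓘(ℝ, ℝ).prod (𝓡 n)) (𝓡 n) ∞ (fun q : ℝ × X => f q.1 q.2)) {s : ℝ → ℝ}
    (hs : ContDiff ℝ ∞ s) :
    ContMDiff (𝓘(ℝ, ℝ).prod (𝓡 n)) (𝓡 n) ∞ (fun q : ℝ × X => f (s q.1) q.2) :=
  hf.comp ((hs.contMDiff.comp contMDiff_fst).prodMk contMDiff_snd)

theorem IsSmoothFamily.trans {f g : ℝ → (X ≃ₘ⟮𝓡 n, 𝓡 n⟯ X)} (hf : IsSmoothFamily f)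
    (hg : IsSmoothFamily g) : IsSmoothFamily fun t => (f t).trans (g t) :=
  ⟨contMDiff_family_comp (f := fun t => f t) (g := fun t => g t) hf.1 hg.1,
    contMDiff_family_comp (f := fun t => (g t).symm) (g := fun t => (f t).symm) hg.2 hf.2⟩

theorem IsSmoothFamily.symm {f : ℝ → (X ≃ₘ⟮𝓡 n, 𝓡 n⟯ X)} (hf : IsSmoothFamily f) :
    IsSmoothFamily fun t => (f t).symm :=
  ⟨hf.2, hf.1⟩

theorem IsSmoothFamily.diffCommutator {f g : ℝ → (X ≃ₘ⟮𝓡 n, 𝓡 n⟯ X)} (hf : IsSmoothFamily f)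
    (hg : IsSmoothFamily g) : IsSmoothFamily fun t => diffCommutator (f t) (g t) :=
  (hg.symm.trans hf.symm).trans (hg.trans hf)

theorem IsSmoothFamily.reparam {f : ℝ → (X ≃ₘ⟮𝓡 n, 𝓡 n⟯ X)} (hf : IsSmoothFamily f) {s : ℝ → ℝ}
    (hs : ContDiff ℝ ∞ s) : IsSmoothFamily fun t => f (s t) :=
  ⟨contMDiff_family_reparam (f := fun t => f t) hf.1 hs,
    contMDiff_family_reparam (f := fun t => (f t).symm) hf.2 hs⟩

variable (ψ x) in
/-- The diffeomorphism `f` is smoothly isotopic to the identity through diffeomorphisms which fix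
`x` and have identity differential there. -/
def IsotopicToIdAt (f : X ≃ₘ⟮𝓡 n, 𝓡 n⟯ X) : Prop :=
  ∃ b : ℝ → (X ≃ₘ⟮𝓡 n, 𝓡 n⟯ X),
    ContMDiff (𝓘(ℝ, ℝ).prod (𝓡 n)) (𝓡 n) ∞ (fun q : ℝ × X => b q.1 q.2) ∧
    b 0 = f ∧ b 1 = Diffeomorph.refl (𝓡 n) X ∞ ∧ ∀ t, b t x = x ∧ coordDeriv ψ ψ (b t) x = 1

/-- The isotopy is b(t) followed by F(0)⁻¹ and then F(1 - t). Composing rather than concatenating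
avoids any smoothing at a junction: the value is F(1) at time 0 and the identity at time 1. -/
theorem IsotopicToIdAt.of_family (hψ : ψ ∈ IsManifold.maximalAtlas (𝓡 n) ∞ X) (hx : x ∈ ψ.source)
    {F : ℝ → (X ≃ₘ⟮𝓡 n, 𝓡 n⟯ X)} (hF : IsSmoothFamily F) (hFx : ∀ t, F t x = x)
    (hFd : ∀ t, coordDeriv ψ ψ (F t) x = 1) (h : IsotopicToIdAt ψ x (F 0)) :
    IsotopicToIdAt ψ x (F 1) := by
  obtain ⟨b, hb, hb0, hb1, hbx⟩ := h
  have hF0 := Diffeomorph.symm_fixed (hFx 0)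
  have hF0d : coordDeriv ψ ψ (F 0).symm x = 1 := by
    have := coordDeriv_symm_mul hψ hx (hFx 0)
    rwa [hFd 0, mul_one] at this
  have hG : IsSmoothFamily fun t => (F 0).symm.trans (F (1 - t)) :=
    (IsSmoothFamily.const (F 0).symm).trans (hF.reparam (contDiff_const.sub contDiff_id))
  have hGx : ∀ t, ((F 0).symm.trans (F (1 - t))) x = x := fun t =>
    (congrArg (F (1 - t)) hF0).trans (hFx _)
  refine ⟨fun t => (b t).trans ((F 0).symm.trans (F (1 - t))), ?_, ?_, ?_, fun t => ⟨?_, ?_⟩⟩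
  · exact contMDiff_family_comp (f := fun t => b t)
      (g := fun t => (F 0).symm.trans (F (1 - t))) hb hG.1
  · ext p
    simp [hb0]
  · ext p
    simp [hb1]
  · exact (congrArg _ (hbx t).1).trans (hGx t)
  · rw [coordDeriv_trans hψ hx (hbx t).1 (hGx t),
      coordDeriv_trans hψ hx hF0 (hFx _), hF0d, (hbx t).2, hFd, one_mul, mul_one]

theorem IsotopicToIdAt.deform (hψ : ψ ∈ IsManifold.maximalAtlas (𝓡 n) ∞ X) (hx : x ∈ ψ.source)
    {α γ : ℝ → (X ≃ₘ⟮𝓡 n, 𝓡 n⟯ X)} (hα : IsSmoothFamily α) (hγ : IsSmoothFamily γ)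
    (hαx : ∀ t, α t x = x) (hγx : ∀ t, γ t x = x)
    (hcomm : ∀ t, Commute (coordDeriv ψ ψ (α t) x) (coordDeriv ψ ψ (γ t) x))
    (h : IsotopicToIdAt ψ x (diffCommutator (α 0) (γ 0))) :
    IsotopicToIdAt ψ x (diffCommutator (α 1) (γ 1)) :=
  IsotopicToIdAt.of_family hψ hx (hα.diffCommutator hγ)
    (fun t => diffCommutator_fixed (hαx t) (hγx t))
    (fun t => (coordDeriv_diffCommutator hψ hx (hαx t) (hγx t)).2 (hcomm t)) h

/-- [c, a] is the inverse of [a, c], and an isotopy from f to the identity, run backwards and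
followed by f⁻¹, is one from f⁻¹ to the identity. -/
theorem IsotopicToIdAt.commutator_swap (hψ : ψ ∈ IsManifold.maximalAtlas (𝓡 n) ∞ X)
    (hx : x ∈ ψ.source) {a c : X ≃ₘ⟮𝓡 n, 𝓡 n⟯ X}
    (h : IsotopicToIdAt ψ x (_root_.diffCommutator a c)) :
    IsotopicToIdAt ψ x (_root_.diffCommutator c a) := by
  obtain ⟨b, hb, hb0, hb1, hbx⟩ := h
  have h0 := hbx 0
  have h0' := Diffeomorph.symm_fixed h0.1
  have h0d : coordDeriv ψ ψ (b 0).symm x = 1 := by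
    have := coordDeriv_symm_mul hψ hx h0.1
    rwa [h0.2, mul_one] at this
  refine ⟨fun t => (b (1 - t)).trans (b 0).symm, ?_, ?_, ?_, fun t => ⟨?_, ?_⟩⟩
  · exact contMDiff_family_comp (f := fun t => b (1 - t)) (g := fun t => (b 0).symm)
      (contMDiff_family_reparam (f := fun t => b t) hb (contDiff_const.sub contDiff_id))
      (IsSmoothFamily.const (b 0).symm).1
  · ext p
    simp [hb0, hb1, _root_.diffCommutator]
    rfl
  · ext p
    simp
  · simp [(hbx _).1, h0']
  · rw [coordDeriv_trans hψ hx (hbx _).1 h0', h0d, (hbx _).2, one_mul]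

end FixedPoint

/-! ### Deforming the differentials of a pair of diffeomorphisms -/

section Deformation

variable {n : ℕ} {X : Type*} [TopologicalSpace X] [ChartedSpace (EuclideanSpace ℝ (Fin n)) X]

/-- The linear maps `A` and `C` are the differentials at `x`, in the coordinates `ψ`, of
orientation-preserving diffeomorphisms whose commutator is isotopic to the identity relative to the
first order germ at `x`. -/
def IsRealized (o : ManifoldOrientation n X)
    (ψ : OpenPartialHomeomorph X (EuclideanSpace ℝ (Fin n))) (x : X)
    (A C : EuclideanSpace ℝ (Fin n) →L[ℝ] EuclideanSpace ℝ (Fin n)) : Prop :=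
  ∃ a c : X ≃ₘ⟮𝓡 n, 𝓡 n⟯ X, o.Preserves a ∧ o.Preserves c ∧ a x = x ∧ c x = x ∧
    coordDeriv ψ ψ a x = A ∧ coordDeriv ψ ψ c x = C ∧ IsotopicToIdAt ψ x (diffCommutator a c)

variable {o : ManifoldOrientation n X} {ψ : OpenPartialHomeomorph X (EuclideanSpace ℝ (Fin n))}
  {x : X} {A C : EuclideanSpace ℝ (Fin n) →L[ℝ] EuclideanSpace ℝ (Fin n)}

theorem IsRealized.swap (hψ : ψ ∈ IsManifold.maximalAtlas (𝓡 n) ∞ X) (hx : x ∈ ψ.source)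
    (h : IsRealized o ψ x A C) : IsRealized o ψ x C A := by
  obtain ⟨a, c, ha, hc, hax, hcx, hA, hC, hi⟩ := h
  exact ⟨c, a, hc, ha, hcx, hax, hC, hA, hi.commutator_swap hψ hx⟩

theorem IsRealized.commute (hψ : ψ ∈ IsManifold.maximalAtlas (𝓡 n) ∞ X) (hx : x ∈ ψ.source)
    (h : IsRealized o ψ x A C) : Commute A C := by
  obtain ⟨a, c, ha, hc, hax, hcx, rfl, rfl, b, hb, hb0, hb1, hbx⟩ := h
  rw [← coordDeriv_diffCommutator hψ hx hax hcx, ← hb0]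
  exact (hbx 0).2

theorem det_coordDeriv_pos_of_preserves (hψ : ψ ∈ IsManifold.maximalAtlas (𝓡 n) ∞ X)
    (hx : x ∈ ψ.source) {a : X ≃ₘ⟮𝓡 n, 𝓡 n⟯ X} (ha : o.Preserves a) (hax : a x = x) :
    0 < (coordDeriv ψ ψ a x).det := by
  obtain ⟨e, he, hxe⟩ := o.charts_cover x
  have hes := o.charts_smooth he
  have h0 : 0 < (coordDeriv e e a x).det := ha e he e he x hxe (by rwa [hax])
  have h1 := det_coordDeriv_comp (f := a) (g := id) hes hψ hes hxe (by rwa [hax])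
    (by simpa only [id_eq, hax]) a.contMDiff.contMDiffAt contMDiffAt_id
  have h2 := det_coordDeriv_comp (f := id) (g := a) hes hψ hψ hxe hx
    (by simpa only [id_eq, hax]) contMDiffAt_id a.contMDiff.contMDiffAt
  have h3 := det_coordDeriv_id_mul hes hψ hxe hx
  rw [Function.comp_id] at h2
  rw [Function.id_comp, h2, hax] at h1
  have h4 : (coordDeriv e e a x).det = (coordDeriv ψ ψ a x).det := by
    rw [h1]
    simp only [id_eq]
    linear_combination (coordDeriv ψ ψ a x).det * h3
  rwa [← h4]

theorem IsRealized.det_pos (hψ : ψ ∈ IsManifold.maximalAtlas (𝓡 n) ∞ X) (hx : x ∈ ψ.source)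
    (h : IsRealized o ψ x A C) : 0 < A.det := by
  obtain ⟨a, c, ha, hc, hax, hcx, rfl, rfl, -⟩ := h
  exact det_coordDeriv_pos_of_preserves hψ hx ha hax

/-- Diffeomorphisms supported near `x` which interpolate between the identity and a given germ. -/
theorem exists_family_of_germ [T2Space X] (hn : 0 < n) (hc : o.CoherentChart ψ)
    (hψ : ψ ∈ IsManifold.maximalAtlas (𝓡 n) ∞ X) (hx : x ∈ ψ.source) (hx0 : ψ x = 0) :
    ∃ δ > 0, ∀ (h : ℝ × EuclideanSpace ℝ (Fin n) → EuclideanSpace ℝ (Fin n))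
      (W : Set (ℝ × EuclideanSpace ℝ (Fin n))), IsOpen W →
    ContDiffOn ℝ ∞ h W → (∀ t ∈ Icc (0 : ℝ) 1, (t, 0) ∈ W) →
    (∀ t ∈ Icc (0 : ℝ) 1, h (t, 0) = 0) →
    (∀ t ∈ Icc (0 : ℝ) 1, ‖fderiv ℝ (fun v => h (t, v)) 0 - ContinuousLinearMap.id ℝ _‖ ≤ δ) →
    ∀ r > 0, ∃ ρ > 0, ρ < r ∧ Metric.closedBall 0 ρ ⊆ ψ.target ∧ ∃ T : ℝ → (X ≃ₘ⟮𝓡 n, 𝓡 n⟯ X),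
      IsSmoothFamily T ∧ (∀ t, o.Preserves (T t)) ∧ (∀ t, T t x = x) ∧
      (∀ t ∈ Icc (0 : ℝ) 1, ∀ v : EuclideanSpace ℝ (Fin n), ‖v‖ ≤ ρ → (t, v) ∈ W) ∧
      (∀ t p, T t p ∈ ψ.source ↔ p ∈ ψ.source) ∧
      (∀ t, ∀ p ∈ ψ.source, ‖ψ p‖ ≤ ρ → ψ (T t p) = h (Real.smoothTransition t, ψ p)) ∧
      (∀ t, (∀ v, ‖v‖ < r → h (Real.smoothTransition t, v) = v) →
        T t = Diffeomorph.refl (𝓡 n) X ∞) ∧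
      (∀ t, ∀ p ∈ ψ.source, ‖ψ p‖ ≤ 2 * ‖ψ (T t p)‖) ∧
      ∀ t, coordDeriv ψ ψ (T t) x = fderiv ℝ (fun v => h (Real.smoothTransition t, v)) 0 := by
  obtain ⟨δ, hδ, H⟩ := exists_cutoff_family (EuclideanSpace ℝ (Fin n))
  refine ⟨δ, hδ, fun h W hW hh hW0 hh0 hhd r hr => ?_⟩
  obtain ⟨r₀, hr₀, hball⟩ := Metric.isOpen_iff.1 ψ.open_target 0 (hx0 ▸ ψ.map_source hx)
  obtain ⟨ρ, hρ, hρr, D, hD, hDs, hDW, hsupp, heq, hid, hnorm⟩ :=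
    H h W hW hh hW0 hh0 hhd (min r r₀) (lt_min hr hr₀)
  have hρ1 : 2 * ρ < r := hρr.trans_le (min_le_left _ _)
  have hρ2 : Metric.closedBall 0 (2 * ρ) ⊆ ψ.target :=
    (Metric.closedBall_subset_ball (hρr.trans_le (min_le_right _ _))).trans hball
  obtain ⟨T, hT, hTe, hTψ⟩ := exists_family_chartExtend hψ hρ2 hD hDs hsupp
  have hσ : ∀ t, Real.smoothTransition t ∈ Icc (0 : ℝ) 1 := fun t =>
    ⟨Real.smoothTransition.nonneg t, Real.smoothTransition.le_one t⟩
  have hDt : ∀ t, ContDiff ℝ ∞ (D t) := fun t => hD.comp (contDiff_const.prodMk contDiff_id)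
  have hDst : ∀ t, ContDiff ℝ ∞ (D t).symm := fun t =>
    hDs.comp (contDiff_const.prodMk contDiff_id)
  refine ⟨ρ, hρ, by linarith, (Metric.closedBall_subset_closedBall (by linarith)).trans hρ2, T, hT,
    fun t => hc.preserves hn hψ hρ2 (hDt t) (hDst t) (hsupp t) (hTe t), fun t => ?_,
    hDW, fun t p => ⟨fun h => ?_, fun hp => (hTψ t p hp).1⟩, fun t p hp hpρ => ?_, fun t ht => ?_, fun t p hp => ?_,
    fun t => ?_⟩
  · refine ψ.injOn (hTψ t x hx).1 hx ?_
    rw [(hTψ t x hx).2, hx0, heq t 0 (by simpa using hρ.le), hh0 _ (hσ t)]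
  · by_contra hp
    rw [hTe, chartExtend_of_notMem hp] at h
    exact hp h
  · rw [(hTψ t p hp).2, heq t _ hpρ]
  · ext p
    have hDid : ∀ v, D t v = v := hid t fun v hv => ht v (hv.trans_le (min_le_left _ _))
    rw [hTe]
    by_cases hp : p ∈ ψ.source
    · rw [chartExtend_of_mem hp, hDid, ψ.left_inv hp]; rfl
    · exact chartExtend_of_notMem hp
  · rw [(hTψ t p hp).2]
    exact hnorm t _
  · rw [coordDeriv_of_eq (fun p hp => (hTψ t p hp).2) hx, hx0]
    apply Filter.EventuallyEq.fderiv_eq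
    filter_upwards [Metric.ball_mem_nhds _ hρ] with v hv
    exact heq t v (mem_ball_zero_iff.1 hv).le

/-- The map A(1 + s(Q - 1)) is the affine interpolation between A and AQ, and commuting with C is a
linear condition. -/
theorem commute_mul_interpolation {E : Type*} [NormedAddCommGroup E] [NormedSpace ℝ E]
    {A C Q : E →L[ℝ] E} (h : Commute A C) (h' : Commute (A * Q) C) (s : ℝ) :
    Commute (A * (1 + s • (Q - 1))) C := by
  have : A * (1 + s • (Q - 1)) = A + s • (A * Q - A) := by
    rw [mul_add, mul_one, mul_smul_comm, mul_sub, mul_one]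
  rw [this]
  exact h.add_left ((h'.sub_left h).smul_left _)

/-- A differential may be multiplied by a linear map close to the identity. -/
theorem exists_isRealized_mul [T2Space X] (hn : 0 < n) (hc : o.CoherentChart ψ)
    (hψ : ψ ∈ IsManifold.maximalAtlas (𝓡 n) ∞ X) (hx : x ∈ ψ.source) (hx0 : ψ x = 0) :
    ∃ δ > 0, ∀ A C Q : EuclideanSpace ℝ (Fin n) →L[ℝ] EuclideanSpace ℝ (Fin n),
      IsRealized o ψ x A C → Commute (A * Q) C → ‖Q - 1‖ ≤ δ → IsRealized o ψ x (A * Q) C := by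
  obtain ⟨δ, hδ, H⟩ := exists_family_of_germ hn hc hψ hx hx0
  refine ⟨δ, hδ, fun A C Q hr hcomm hQ => ?_⟩
  have hAC := hr.commute hψ hx
  obtain ⟨a, c, ha, hcc, hax, hcx, hA, hC, hi⟩ := hr
  -- A linear germ at each time, whose derivative 1 + t(Q - 1) stays within δ of the identity and
  -- runs from 1 to Q.
  let h : ℝ × EuclideanSpace ℝ (Fin n) → EuclideanSpace ℝ (Fin n) :=
    fun q => q.2 + q.1 • (Q - 1) q.2
  have hd : ∀ t, fderiv ℝ (fun v => h (t, v)) 0 = 1 + t • (Q - 1) := fun t =>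
    ((hasFDerivAt_id _).add (((Q - 1).hasFDerivAt).const_smul t)).fderiv
  obtain ⟨ρ, hρ, hρr, hρt, T, hT, hTo, hTx, -, -, hTeq, hTid, -, hTd⟩ := H h univ isOpen_univ
    (contDiff_snd.add (contDiff_fst.smul ((Q - 1).contDiff.comp contDiff_snd))).contDiffOn
    (fun _ _ => mem_univ _) (fun t _ => by simp [h])
    (fun t ht => by
      rw [hd]
      change ‖1 + t • (Q - 1) - 1‖ ≤ δ
      rw [add_sub_cancel_left, norm_smul, Real.norm_of_nonneg ht.1]
      exact (mul_le_of_le_one_left (norm_nonneg _) ht.2).trans hQ) 1 one_pos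
  have hαx : ∀ t, ((T t).trans a) x = x := fun t => (congrArg a (hTx t)).trans hax
  have hαd : ∀ t, coordDeriv ψ ψ ((T t).trans a) x =
      A * (1 + Real.smoothTransition t • (Q - 1)) := fun t => by
    rw [coordDeriv_trans hψ hx (hTx t) hax, hTd, hd, hA]
  refine ⟨(T 1).trans a, c, (hTo 1).trans ha, hcc, hαx 1, hcx, ?_, hC, ?_⟩
  · rw [hαd, Real.smoothTransition.one]
    simp
  · refine IsotopicToIdAt.deform hψ hx (α := fun t => (T t).trans a) (γ := fun _ => c)
      (hT.trans (.const a)) (.const c) hαx (fun _ => hcx) (fun t => ?_) ?_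
    · rw [hαd, hC]
      exact commute_mul_interpolation hAC hcomm _
    · have : T 0 = Diffeomorph.refl (𝓡 n) X ∞ := hTid 0 fun v _ => by
        simp [h, Real.smoothTransition.zero]
      simpa only [this, Diffeomorph.refl_trans] using hi

/-- For close s and t the quotient f(s)⁻¹ f(t) is near 1, so `exists_isRealized_mul` moves from f(s)
to f(t) and back. Its δ depends neither on the differentials nor on the diffeomorphisms realizing
them, so the steps can be chained along the connected interval. -/
theorem IsRealized.of_path [T2Space X] (hn : 0 < n) (hc : o.CoherentChart ψ)
    (hψ : ψ ∈ IsManifold.maximalAtlas (𝓡 n) ∞ X) (hx : x ∈ ψ.source) (hx0 : ψ x = 0)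
    {f : ℝ → (EuclideanSpace ℝ (Fin n) →L[ℝ] EuclideanSpace ℝ (Fin n))}
    (hf : ContinuousOn f (Icc 0 1)) (hu : ∀ t ∈ Icc (0 : ℝ) 1, IsUnit (f t))
    (hcomm : ∀ t ∈ Icc (0 : ℝ) 1, Commute (f t) C) (h : IsRealized o ψ x (f 0) C) :
    IsRealized o ψ x (f 1) C := by
  obtain ⟨δ, hδ, H⟩ := exists_isRealized_mul hn hc hψ hx hx0
  have step : ∀ s ∈ Icc (0 : ℝ) 1, ∀ t ∈ Icc (0 : ℝ) 1, ‖Ring.inverse (f s) * f t - 1‖ ≤ δ →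
      IsRealized o ψ x (f s) C → IsRealized o ψ x (f t) C := by
    intro s hs t ht hst hr
    have h1 : f s * (Ring.inverse (f s) * f t) = f t := by
      rw [← mul_assoc, Ring.mul_inverse_cancel _ (hu s hs), one_mul]
    have h2 := H (f s) C _ hr (h1.symm ▸ hcomm t ht) hst
    rwa [h1] at h2
  have hnear : ∀ s ∈ Icc (0 : ℝ) 1, ∀ᶠ t in 𝓝[Icc 0 1] s,
      ‖Ring.inverse (f s) * f t - 1‖ ≤ δ ∧ ‖Ring.inverse (f t) * f s - 1‖ ≤ δ := by
    intro s hs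
    obtain ⟨U, hU⟩ := hu s hs
    have hinv : ContinuousWithinAt (fun t => Ring.inverse (f t)) (Icc 0 1) s := by
      refine ContinuousAt.comp_continuousWithinAt (g := Ring.inverse) ?_ (hf s hs)
      rw [← hU]
      exact NormedRing.inverse_continuousAt U
    have h1 : ContinuousWithinAt (fun t => ‖Ring.inverse (f s) * f t - 1‖) (Icc 0 1) s :=
      ((continuousWithinAt_const.mul (hf s hs)).sub continuousWithinAt_const).norm
    have h2 : ContinuousWithinAt (fun t => ‖Ring.inverse (f t) * f s - 1‖) (Icc 0 1) s :=
      ((hinv.mul continuousWithinAt_const).sub continuousWithinAt_const).norm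
    have h0 : ‖Ring.inverse (f s) * f s - 1‖ < δ := by
      rw [Ring.inverse_mul_cancel _ (hu s hs), sub_self, norm_zero]
      exact hδ
    filter_upwards [h1.eventually (gt_mem_nhds h0), h2.eventually (gt_mem_nhds h0)] with t h3 h4
    exact ⟨h3.le, h4.le⟩
  refine (isPreconnected_Icc.induction₂' (fun s t => s ∈ Icc (0 : ℝ) 1 → t ∈ Icc (0 : ℝ) 1 →
    IsRealized o ψ x (f s) C → IsRealized o ψ x (f t) C) (s := Icc (0 : ℝ) 1) ?_ ?_
    (left_mem_Icc.2 zero_le_one) (right_mem_Icc.2 zero_le_one)) (left_mem_Icc.2 zero_le_one)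
    (right_mem_Icc.2 zero_le_one) h
  · intro s hs
    filter_upwards [hnear s hs] with t ht
    exact ⟨fun hs ht' => step s hs t ht' ht.1, fun ht' hs => step t ht' s hs ht.2⟩
  · exact fun s t r _ ht _ h1 h2 hs' hr' h' => h2 ht hr' (h1 hs' ht h')

end Deformation

/-! ### Commuting pairs of linear maps -/

section LinearAlgebra

open Module

variable {V : Type*} [AddCommGroup V] [Module ℝ V]

/-- Powers of distinct linear factors are coprime, so the kernel of their product is the sum of
their kernels, each of which consists of generalized eigenvectors. -/
theorem ker_aeval_prod_pow_le (A : End ℝ V) (S : Finset ℝ) (k : ℕ) :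
    LinearMap.ker (Polynomial.aeval A ((∏ μ ∈ S, (Polynomial.X - Polynomial.C μ)) ^ k)) ≤
      ⨆ μ ∈ S, A.maxGenEigenspace μ := by
  classical
  induction S using Finset.induction_on with
  | empty => simp [Module.End.one_eq_id]
  | insert μ S hμ ih =>
    have hco : IsCoprime ((Polynomial.X - Polynomial.C μ) ^ k)
        ((∏ ν ∈ S, (Polynomial.X - Polynomial.C ν)) ^ k) := by
      refine IsCoprime.pow (IsCoprime.prod_right fun ν hν => ?_)
      refine Polynomial.isCoprime_X_sub_C_of_isUnit_sub (sub_ne_zero.2 ?_).isUnit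
      rintro rfl
      exact hμ hν
    rw [Finset.prod_insert hμ, mul_pow, ← Polynomial.sup_ker_aeval_eq_ker_aeval_mul_of_coprime A hco,
      Finset.iSup_insert]
    refine sup_le_sup (fun v hv => ?_) ih
    rw [Module.End.mem_maxGenEigenspace]
    refine ⟨k, ?_⟩
    simpa [Algebra.algebraMap_eq_smul_one] using hv

theorem commute_aeval {A B : End ℝ V} (h : Commute A B) (p : Polynomial ℝ) :
    Commute (Polynomial.aeval A p) B := by
  induction p using Polynomial.induction_on' with
  | add p q hp hq => rw [map_add]; exact hp.add_left hq
  | monomial k r =>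
    rw [Polynomial.aeval_monomial]
    exact Commute.mul_left (Algebra.commutes r B) (h.pow_left k)

/-- Fitting decomposition of f = ∏ (A - μ), the product over the negative eigenvalues: for large k
the kernel and the range of f^k are complementary, the kernel being the negative part. As f is a
polynomial in A, both summands are invariant under every operator commuting with A. -/
theorem exists_isCompl_negative [FiniteDimensional ℝ V] (A : End ℝ V) :
    ∃ N : Submodule ℝ V, IsCompl (⨆ μ ∈ Iio (0 : ℝ), A.maxGenEigenspace μ) N ∧
      (∀ v ∈ (⨆ μ ∈ Iio (0 : ℝ), A.maxGenEigenspace μ), ∀ μ : ℝ, A v = μ • v → v ≠ 0 → μ < 0) ∧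
      (∀ v ∈ N, ∀ μ : ℝ, A v = μ • v → v ≠ 0 → 0 ≤ μ) ∧
      ∀ B : End ℝ V, Commute A B →
        (∀ v ∈ (⨆ μ ∈ Iio (0 : ℝ), A.maxGenEigenspace μ),
          B v ∈ (⨆ μ ∈ Iio (0 : ℝ), A.maxGenEigenspace μ)) ∧ ∀ v ∈ N, B v ∈ N := by
  classical
  let S : Finset ℝ := A.finite_hasEigenvalue.toFinset.filter (· < 0)
  have hS : ∀ μ, μ ∈ S ↔ A.HasEigenvalue μ ∧ μ < 0 := fun μ => by simp [S]
  let q : Polynomial ℝ := ∏ μ ∈ S, (Polynomial.X - Polynomial.C μ)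
  let f : End ℝ V := Polynomial.aeval A q
  -- Besides the splitting, k ≥ dim V is needed so that ker f^k already contains the kernels of all
  -- powers of f.
  obtain ⟨k, hk, hk'⟩ := (f.eventually_isCompl_ker_pow_range_pow.and
    (Filter.eventually_ge_atTop (finrank ℝ V))).exists
  have hfk : f ^ k = Polynomial.aeval A (q ^ k) := by rw [map_pow]
  have hcomm : ∀ B : End ℝ V, Commute A B → Commute (f ^ k) B := fun B hB => by
    rw [hfk]
    exact commute_aeval hB _
  have hfac : ∀ μ ∈ S, ∃ g : End ℝ V, Commute g (A - μ • 1) ∧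
      f = g * (A - μ • 1) := fun μ hμ =>
    ⟨Polynomial.aeval A (∏ ν ∈ S.erase μ, (Polynomial.X - Polynomial.C ν)),
      commute_aeval ((Commute.refl A).sub_right ((Commute.one_right A).smul_right μ)) _, by
      simp only [f, q]
      rw [← Finset.prod_erase_mul _ _ hμ, map_mul]
      simp [Algebra.algebraMap_eq_smul_one]⟩
  have hev : ∀ v (μ : ℝ), A v = μ • v → (f ^ k) v = (q.eval μ) ^ k • v := fun v μ hv => by
    rw [hfk, Module.End.aeval_apply_of_mem_apply_eq_smul hv, Polynomial.eval_pow]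
  have hM : LinearMap.ker (f ^ k) = ⨆ μ ∈ Iio (0 : ℝ), A.maxGenEigenspace μ := by
    apply le_antisymm
    · rw [hfk]
      exact (ker_aeval_prod_pow_le A S k).trans (iSup₂_le fun μ hμ =>
        le_iSup₂_of_le μ ((hS μ).1 hμ).2 le_rfl)
    · refine iSup₂_le fun μ hμ v hv => ?_
      by_cases hv0 : v = 0
      · simp [hv0]
      have hμS : μ ∈ S := by
        refine (hS μ).2 ⟨?_, hμ⟩
        -- A nonzero generalized eigenvector forces an ordinary eigenvector, so μ belongs to the
        -- finite set S.
        refine (Module.End.hasUnifEigenvalue_iff_hasUnifEigenvalue_one (k := ⊤) (by simp)).1 ?_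
        intro h
        exact hv0 ((Submodule.mem_bot ℝ).1 (h ▸ hv))
      obtain ⟨m, hm⟩ := (Module.End.mem_maxGenEigenspace _ _ _).1 hv
      obtain ⟨g, hg, hfg⟩ := hfac μ hμS
      have h1 : v ∈ LinearMap.ker (f ^ m) := by
        rw [LinearMap.mem_ker, hfg, hg.mul_pow, Module.End.mul_apply, hm, map_zero]
      have h2 := Module.End.ker_pow_le_ker_pow_finrank f m h1
      rw [LinearMap.mem_ker] at h2 ⊢
      rw [← Nat.sub_add_cancel hk', pow_add, Module.End.mul_apply, h2, map_zero]
  have hqS : ∀ μ, q.eval μ = 0 ↔ μ ∈ S := fun μ => by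
    simp [q, Polynomial.eval_prod, Finset.prod_eq_zero_iff, sub_eq_zero]
  rw [← hM]
  refine ⟨_, hk, fun v hv μ hvμ hv0 => ?_, fun v hv μ hvμ hv0 => ?_, fun B hB => ⟨?_, ?_⟩⟩
  · rw [LinearMap.mem_ker, hev v μ hvμ, smul_eq_zero, or_iff_left hv0] at hv
    exact ((hS μ).1 ((hqS μ).1 (eq_zero_of_pow_eq_zero hv))).2
  · by_contra! hμ
    have hμS : μ ∈ S := (hS μ).2 ⟨Module.End.hasEigenvalue_of_hasEigenvector
      ⟨Module.End.mem_eigenspace_iff.2 hvμ, hv0⟩, hμ⟩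
    obtain ⟨g, hg, hfg⟩ := hfac μ hμS
    have h1 : f v = 0 := by simp [hfg, hvμ]
    have h2 : v ∈ LinearMap.ker (f ^ k) := by
      -- The exponent is zero only if V is zero, because k ≥ dim V.
      rcases Nat.eq_zero_or_pos k with rfl | hk0
      · have : finrank ℝ V = 0 := by omega
        have := finrank_zero_iff.1 this
        exact absurd (Subsingleton.elim v 0) hv0
      · rw [LinearMap.mem_ker, ← Nat.sub_add_cancel hk0, pow_succ, Module.End.mul_apply, h1,
          map_zero]
    exact hv0 ((Submodule.disjoint_def.1 hk.disjoint) v h2 hv)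
  · intro v hv
    rw [LinearMap.mem_ker] at hv ⊢
    rw [← Module.End.mul_apply, (hcomm B hB).eq, Module.End.mul_apply, hv, map_zero]
  · rintro _ ⟨w, rfl⟩
    exact ⟨B w, by rw [← Module.End.mul_apply, (hcomm B hB).eq, Module.End.mul_apply]⟩

/-- An invertible operator deforms, within the polynomials in it, to an involution whose
`(-1)`-eigenspace is the sum of the generalized eigenspaces for negative eigenvalues. -/
theorem exists_involution_negative [FiniteDimensional ℝ V] (A : End ℝ V) (hA : IsUnit A) :
    ∃ A' : End ℝ V, A' * A' = 1 ∧ (∀ B, Commute A B → Commute A' B) ∧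
      (∀ v, v ∈ (⨆ μ ∈ Iio (0 : ℝ), A.maxGenEigenspace μ) ↔ A' v = -v) ∧
      ∀ t ∈ Icc (0 : ℝ) 1, IsUnit ((1 - t) • A + t • A') := by
  obtain ⟨N, hN, hneg, hpos, hinv⟩ := exists_isCompl_negative A
  set M := ⨆ μ ∈ Iio (0 : ℝ), A.maxGenEigenspace μ
  -- This is -1 on M and 1 on N.
  let A' : End ℝ V := 1 - (2 : ℝ) • M.projection N hN
  have hAM : ∀ v ∈ M, A' v = -v := fun v hv => by
    have h : A' v = v - (2 : ℝ) • M.projection N hN v := rfl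
    rw [h, Submodule.projection_apply_of_mem_left hN hv, two_smul]
    abel
  have hAN : ∀ v ∈ N, A' v = v := fun v hv => by
    simp [A', (Submodule.projection_apply_eq_zero_iff hN).2 hv]
  have hdec : ∀ x : V, ∃ v ∈ M, ∃ w ∈ N, x = v + w := fun x => by
    obtain ⟨v, hv, w, hw, h⟩ := Submodule.mem_sup.1 (hN.sup_eq_top ▸ Submodule.mem_top (x := x))
    exact ⟨v, hv, w, hw, h.symm⟩
  refine ⟨A', ?_, fun B hB => ?_, fun v => ⟨hAM v, fun hv => ?_⟩, fun t ht => ?_⟩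
  · ext x
    obtain ⟨v, hv, w, hw, rfl⟩ := hdec x
    simp [hAM v hv, hAN w hw]
  · ext x
    obtain ⟨v, hv, w, hw, rfl⟩ := hdec x
    simp [hAM v hv, hAN w hw, hAM _ ((hinv B hB).1 v hv), hAN _ ((hinv B hB).2 w hw)]
  · obtain ⟨v, hv', w, hw, rfl⟩ := hdec v
    rw [map_add, hAM v hv', hAN w hw] at hv
    have : w = 0 := by
      have h2 : (2 : ℝ) • w = 0 := by
        rw [two_smul]
        have := congrArg (· + v + w) hv
        simpa using this
      simpa using h2
    simpa [this] using hv'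
  -- A vector killed by the segment splits into components in M and N. On M it would give A the
  -- eigenvalue t/(1 - t) ≥ 0; on N it would give -t/(1 - t), which must be nonnegative, hence t =
  -- 0, contradicting invertibility of A.
  · rw [LinearMap.isUnit_iff_ker_eq_bot, LinearMap.ker_eq_bot']
    intro x hx
    obtain ⟨v, hv, w, hw, rfl⟩ := hdec x
    have hAv := (hinv A (Commute.refl A)).1 v hv
    have hAw := (hinv A (Commute.refl A)).2 w hw
    have h1 : ((1 - t) • A v - t • v) + ((1 - t) • A w + t • w) = 0 := by
      rw [← hx]
      simp only [LinearMap.add_apply, LinearMap.smul_apply, map_add, hAM v hv, hAN w hw]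
      module
    have hvM : (1 - t) • A v - t • v ∈ M := M.sub_mem (M.smul_mem _ hAv) (M.smul_mem _ hv)
    have hwN : (1 - t) • A w + t • w ∈ N := N.add_mem (N.smul_mem _ hAw) (N.smul_mem _ hw)
    have hv' : (1 - t) • A v - t • v = 0 := Submodule.disjoint_def.1 hN.disjoint _ hvM
      (by rw [eq_neg_of_add_eq_zero_left h1]; exact N.neg_mem hwN)
    have hw' : (1 - t) • A w + t • w = 0 := by rwa [hv', zero_add] at h1
    have hv0 : v = 0 := by
      by_contra hv0
      rcases eq_or_ne t 1 with rfl | ht1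
      · exact hv0 (by simpa using hv')
      · have ht' : 0 < 1 - t := sub_pos.2 (lt_of_le_of_ne ht.2 ht1)
        have := hneg v hv (t / (1 - t)) (by
          rw [div_eq_inv_mul, mul_smul, eq_inv_smul_iff₀ ht'.ne']
          exact sub_eq_zero.1 hv') hv0
        exact absurd this (not_lt.2 (div_nonneg ht.1 ht'.le))
    have hw0 : w = 0 := by
      by_contra hw0
      rcases eq_or_ne t 1 with rfl | ht1
      · exact hw0 (by simpa using hw')
      · have ht' : 0 < 1 - t := sub_pos.2 (lt_of_le_of_ne ht.2 ht1)
        have h2 := hpos w hw (-t / (1 - t)) (by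
          rw [div_eq_inv_mul, mul_smul, eq_inv_smul_iff₀ ht'.ne', neg_smul]
          exact eq_neg_of_add_eq_zero_left hw') hw0
        have h3 : t = 0 := by
          by_contra ht0
          have : -t / (1 - t) < 0 := div_neg_of_neg_of_pos
            (neg_neg_of_pos (lt_of_le_of_ne ht.1 (Ne.symm ht0))) ht'
          linarith
        have h4 : A w = 0 := by simpa [h3] using hw'
        exact hw0 ((LinearMap.ker_eq_bot'.1 ((LinearMap.isUnit_iff_ker_eq_bot A).1 hA)) w h4)
    rw [hv0, hw0, add_zero]

/-- The sign attached to a truth value: `true` is negative. -/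
def boolSign (s : Bool) : ℝ := if s then -1 else 1

theorem boolSign_mul_self (s : Bool) : boolSign s * boolSign s = 1 := by
  cases s <;> simp [boolSign]

/-- Commuting involutions are simultaneously diagonalizable. -/
theorem exists_basis_of_involutions [FiniteDimensional ℝ V] {n : ℕ} (hn : finrank ℝ V = n)
    {A C : End ℝ V} (hA : A * A = 1) (hC : C * C = 1) (hAC : Commute A C) :
    ∃ (b : Basis (Fin n) ℝ V) (κ : Fin n → Bool × Bool),
      (∀ i, A (b i) = boolSign (κ i).1 • b i) ∧ (∀ i, C (b i) = boolSign (κ i).2 • b i) ∧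
      ∀ k, (Finset.univ.filter fun i => κ i = k).card =
        finrank ℝ ((A.eigenspace (boolSign k.1) ⊓ C.eigenspace (boolSign k.2) : Submodule ℝ V)) := by
  let W : Bool × Bool → Submodule ℝ V := fun k =>
    A.eigenspace (boolSign k.1) ⊓ C.eigenspace (boolSign k.2)
  have hind : iSupIndep W := by
    -- The four numbers ±1 ± 2 are distinct, so the joint eigenspaces lie in distinct eigenspaces of
    -- the single operator A + 2C.
    have h1 := (A + (2 : ℝ) • C).eigenspaces_iSupIndep.comp
      (f := fun k : Bool × Bool => boolSign k.1 + 2 * boolSign k.2) (by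
        rintro ⟨_ | _, _ | _⟩ ⟨_ | _, _ | _⟩ h <;> simp [boolSign] at h ⊢ <;> norm_num at h)
    refine h1.mono fun k v hv => ?_
    have h2 := Module.End.mem_eigenspace_iff.1 hv.1
    have h3 := Module.End.mem_eigenspace_iff.1 hv.2
    rw [Function.comp_apply, Module.End.mem_eigenspace_iff]
    simp [h2, h3, add_smul, mul_smul]
  have hA' : ∀ v, A (A v) = v := fun v => LinearMap.congr_fun hA v
  have hC' : ∀ v, C (C v) = v := fun v => LinearMap.congr_fun hC v
  have hAC' : ∀ v, A (C v) = C (A v) := fun v => LinearMap.congr_fun hAC.eq v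
  have htop : iSup W = ⊤ := by
    rw [eq_top_iff]
    intro v _
    -- The vector (1 + εA)(1 + ηC)v lies in the joint eigenspace for the signs ε, η, and v is the
    -- average of these four vectors.
    have hmem : ∀ k : Bool × Bool, v + boolSign k.1 • A v + boolSign k.2 • C v +
        (boolSign k.1 * boolSign k.2) • C (A v) ∈ iSup W := by
      intro k
      refine Submodule.mem_iSup_of_mem k ⟨?_, ?_⟩
      · rw [SetLike.mem_coe, Module.End.mem_eigenspace_iff]
        simp only [map_add, map_smul, hA', hAC', smul_add, smul_smul, ← mul_assoc,
          boolSign_mul_self, one_smul, one_mul]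
        abel
      · rw [SetLike.mem_coe, Module.End.mem_eigenspace_iff]
        simp only [map_add, map_smul, hC', smul_add, smul_smul, mul_left_comm (boolSign k.2),
          boolSign_mul_self, one_smul, mul_one, mul_comm (boolSign k.2) (boolSign k.1)]
        abel
    have h4 : v = (1 / 4 : ℝ) • ∑ k : Bool × Bool, (v + boolSign k.1 • A v + boolSign k.2 • C v +
        (boolSign k.1 * boolSign k.2) • C (A v)) := by
      simp only [Fintype.sum_prod_type, Fintype.sum_bool, boolSign]
      simp only [if_true, Bool.false_eq_true, if_false]
      module
    rw [h4]
    exact Submodule.smul_mem _ _ (Submodule.sum_mem _ fun k _ => hmem k)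
  have hint : DirectSum.IsInternal W :=
    (DirectSum.isInternal_submodule_iff_iSupIndep_and_iSup_eq_top W).2 ⟨hind, htop⟩
  let b₀ := hint.collectedBasis fun k => finBasis ℝ (W k)
  have hcard : Fintype.card (Σ k, Fin (finrank ℝ (W k))) = Fintype.card (Fin n) := by
    rw [← finrank_eq_card_basis b₀, hn, Fintype.card_fin]
  let e := Fintype.equivOfCardEq hcard
  have hb₀ : ∀ i, b₀ i ∈ W i.1 := fun i => hint.collectedBasis_mem _ i
  refine ⟨b₀.reindex e, fun i => (e.symm i).1, fun i => ?_, fun i => ?_, fun k => ?_⟩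
  · rw [Basis.reindex_apply]
    exact Module.End.mem_eigenspace_iff.1 (hb₀ _).1
  · rw [Basis.reindex_apply]
    exact Module.End.mem_eigenspace_iff.1 (hb₀ _).2
  · rw [← Fintype.card_subtype, ← Fintype.card_fin (finrank ℝ (W k))]
    refine Fintype.card_congr ((e.symm.subtypeEquiv (q := fun j => j.1 = k) fun i => Iff.rfl).trans ?_)
    exact Equiv.sigmaSubtype k

end LinearAlgebra

/-! ### Deforming commuting pairs to a normal form -/

section NormalForm

open Module

variable {E : Type*} [NormedAddCommGroup E] [NormedSpace ℝ E] [FiniteDimensional ℝ E] {n : ℕ}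

/-- A relation between linear maps which implies that they commute and preserve orientation, and
is stable under deformations of one of them among the invertible maps commuting with the other. -/
structure IsDeformable (P : (E →L[ℝ] E) → (E →L[ℝ] E) → Prop) : Prop where
  swap : ∀ {A C}, P A C → P C A
  commute : ∀ {A C}, P A C → Commute A C
  det_pos : ∀ {A C}, P A C → 0 < A.det
  of_path : ∀ {C} {f : ℝ → (E →L[ℝ] E)}, ContinuousOn f (Icc 0 1) →
    (∀ t ∈ Icc (0 : ℝ) 1, IsUnit (f t)) → (∀ t ∈ Icc (0 : ℝ) 1, Commute (f t) C) →
    P (f 0) C → P (f 1) C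

/-- The linear map with prescribed values on a basis, as a continuous linear map. -/
noncomputable def basisMap (b : Basis (Fin n) ℝ E) (w : Fin n → E) : E →L[ℝ] E :=
  LinearMap.toContinuousLinearMap (b.constr ℝ w)

@[simp]
theorem basisMap_apply (b : Basis (Fin n) ℝ E) (w : Fin n → E) (i : Fin n) :
    basisMap b w (b i) = w i := b.constr_basis ℝ w i

theorem continuous_basisMap (b : Basis (Fin n) ℝ E) : Continuous (basisMap b) := by
  let L : (Fin n → E) →ₗ[ℝ] (E →L[ℝ] E) :=
    ((b.constr ℝ).trans LinearMap.toContinuousLinearMap).toLinearMap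
  exact L.continuous_of_finiteDimensional

theorem Module.Basis.clm_ext (b : Basis (Fin n) ℝ E) {f g : E →L[ℝ] E}
    (h : ∀ i, f (b i) = g (b i)) : f = g :=
  ContinuousLinearMap.coe_injective (b.ext h)

/-- The diagonal linear map with entries `α` in the basis `b`. -/
noncomputable def diagMap (b : Basis (Fin n) ℝ E) (α : Fin n → ℝ) : E →L[ℝ] E :=
  basisMap b fun i => α i • b i

@[simp]
theorem diagMap_apply (b : Basis (Fin n) ℝ E) (α : Fin n → ℝ) (i : Fin n) :
    diagMap b α (b i) = α i • b i := basisMap_apply _ _ _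

/-- A rotation-like map of the plane spanned by two basis vectors, diagonal on the others. -/
noncomputable def rotMap (b : Basis (Fin n) ℝ E) (α : Fin n → ℝ) (i j : Fin n) (c s : ℝ) :
    E →L[ℝ] E :=
  basisMap b fun k => if k = i then c • b i + s • b j else if k = j then -s • b i + c • b j else
    α k • b k

theorem rotMap_mul (b : Basis (Fin n) ℝ E) {α : Fin n → ℝ} (hα : ∀ k, α k * α k = 1) {i j : Fin n}
    (hij : i ≠ j) {c s : ℝ} (h : c * c + s * s = 1) :
    rotMap b α i j c s * rotMap b α i j c (-s) = 1 := by
  refine b.clm_ext fun k => ?_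
  by_cases hki : k = i
  · subst hki
    simp only [rotMap, mul_apply_eq_comp, basisMap_apply, if_true, map_add, map_smul,
      hij.symm, if_false, one_apply_eq_self]
    rw [show c • (c • b k + s • b j) + -s • (-s • b k + c • b j) = (c * c + s * s) • b k by module,
      h, one_smul]
  · by_cases hkj : k = j
    · subst hkj
      simp only [rotMap, mul_apply_eq_comp, basisMap_apply, if_true, map_add, map_smul,
        hki, if_false, one_apply_eq_self]
      rw [show -(-s) • (c • b i + s • b k) + c • (-s • b i + c • b k) =
        (c * c + s * s) • b k by module, h, one_smul]
    · simp [rotMap, hki, hkj, smul_smul, hα]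

variable {P : (E →L[ℝ] E) → (E →L[ℝ] E) → Prop}

/-- Two equal negative entries of a diagonal map may be made positive. -/
theorem IsDeformable.flip (hP : IsDeformable P) (b : Basis (Fin n) ℝ E) {α γ α' : Fin n → ℝ}
    {i j : Fin n} (hij : i ≠ j) (hα : ∀ k, α k * α k = 1) (hi : α i = -1) (hj : α j = -1)
    (hγ : γ i = γ j) (hi' : α' i = 1) (hj' : α' j = 1) (hα' : ∀ k, k ≠ i → k ≠ j → α' k = α k)
    (h : P (diagMap b α) (diagMap b γ)) : P (diagMap b α') (diagMap b γ) := by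
  -- Rotation by an angle decreasing from π to 0 in the plane of the two basis vectors. It commutes
  -- with the other map, which is scalar on this plane since γ i = γ j.
  let f : ℝ → (E →L[ℝ] E) := fun t =>
    rotMap b α i j (Real.cos (Real.pi * (1 - t))) (Real.sin (Real.pi * (1 - t)))
  have hf0 : f 0 = diagMap b α := by
    refine b.clm_ext fun k => ?_
    by_cases hki : k = i
    · subst hki; simp [f, rotMap, hi]
    · by_cases hkj : k = j
      · subst hkj; simp [f, rotMap, hj, hki]
      · simp [f, rotMap, hki, hkj]
  have hf1 : f 1 = diagMap b α' := by
    refine b.clm_ext fun k => ?_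
    by_cases hki : k = i
    · subst hki; simp [f, rotMap, hi']
    · by_cases hkj : k = j
      · subst hkj; simp [f, rotMap, hj', hki]
      · simp [f, rotMap, hki, hkj, hα' k hki hkj]
  rw [← hf1]
  refine hP.of_path ?_ (fun t _ => ?_) (fun t _ => ?_) (hf0 ▸ h)
  · refine ((continuous_basisMap b).comp (continuous_pi fun k => ?_)).continuousOn
    split_ifs <;> fun_prop
  · have h1 := Real.cos_sq_add_sin_sq (Real.pi * (1 - t))
    refine ⟨⟨f t, rotMap b α i j (Real.cos (Real.pi * (1 - t))) (-Real.sin (Real.pi * (1 - t))),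
      rotMap_mul b hα hij (by linarith), ?_⟩, rfl⟩
    have := rotMap_mul b hα hij (c := Real.cos (Real.pi * (1 - t)))
      (s := -Real.sin (Real.pi * (1 - t))) (by linarith)
    rwa [neg_neg] at this
  · refine b.clm_ext fun k => ?_
    by_cases hki : k = i
    · subst hki
      simp [f, rotMap, smul_add, smul_smul, hγ, mul_comm]
    · by_cases hkj : k = j
      · subst hkj
        simp [f, rotMap, smul_add, smul_smul, hγ, hki, mul_comm]
      · simp [f, rotMap, hki, hkj, smul_smul, mul_comm]

/-- The first map is flipped and then, after swapping the roles, the second; a sign that is already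
positive is left alone. Equality of types makes the other map scalar on the plane at each stage. -/
theorem IsDeformable.flip_pair (hP : IsDeformable P) (b : Basis (Fin n) ℝ E)
    {κ : Fin n → Bool × Bool} {i j : Fin n} (hij : i ≠ j) (h : κ i = κ j)
    (hP' : P (diagMap b fun k => boolSign (κ k).1) (diagMap b fun k => boolSign (κ k).2)) :
    P (diagMap b fun k => boolSign ((fun k => if k = i ∨ k = j then (false, false) else κ k) k).1)
      (diagMap b fun k => boolSign ((fun k => if k = i ∨ k = j then (false, false) else κ k) k).2) := by
  have key : ∀ (s t : Fin n → Bool), s i = s j → t i = t j →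
      P (diagMap b fun k => boolSign (s k)) (diagMap b fun k => boolSign (t k)) →
      P (diagMap b fun k => boolSign (if k = i ∨ k = j then false else s k))
        (diagMap b fun k => boolSign (t k)) := by
    intro s t hs ht hst
    cases hsi : s i with
    | false =>
      have : (fun k => if k = i ∨ k = j then false else s k) = s := by
        ext k
        split_ifs with hk
        · rcases hk with rfl | rfl
          · rw [hsi]
          · rw [← hs, hsi]
        · rfl
      simpa only [congrFun this] using hst
    | true =>
      refine hP.flip b hij (fun k => boolSign_mul_self _) ?_ ?_ ?_ ?_ ?_ ?_ hst
      · simp [hsi, boolSign]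
      · simp [← hs, hsi, boolSign]
      · simp [ht]
      · simp [boolSign]
      · simp [boolSign]
      · intro k h1 h2
        simp [h1, h2]
  have h1 := key _ _ (congrArg Prod.fst h) (congrArg Prod.snd h) hP'
  have h2 := key _ _ (congrArg Prod.snd h) (by simp) (hP.swap h1)
  have h3 := hP.swap h2
  convert h3 using 4 <;> · simp only; split_ifs <;> rfl

/-- Pairs of equal entries can be removed until each type occurs exactly once. -/
theorem IsDeformable.exists_reduced (hP : IsDeformable P) (b : Basis (Fin n) ℝ E)
    (κ : Fin n → Bool × Bool)
    (hodd : ∀ k ≠ (false, false), Odd (Finset.univ.filter fun i => κ i = k).card)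
    (h : P (diagMap b fun k => boolSign (κ k).1) (diagMap b fun k => boolSign (κ k).2)) :
    ∃ κ' : Fin n → Bool × Bool,
      (∀ k ≠ (false, false), (Finset.univ.filter fun i => κ' i = k).card = 1) ∧
      P (diagMap b fun k => boolSign (κ' k).1) (diagMap b fun k => boolSign (κ' k).2) := by
  induction hm : (Finset.univ.filter fun i => κ i ≠ (false, false)).card using Nat.strong_induction_on
    generalizing κ with
  | _ m ih =>
    by_cases hall : ∀ k ≠ (false, false), (Finset.univ.filter fun i => κ i = k).card = 1
    · exact ⟨κ, hall, h⟩
    push Not at hall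
    obtain ⟨k, hk, hk1⟩ := hall
    have h1 : 1 < (Finset.univ.filter fun i => κ i = k).card :=
      lt_of_le_of_ne (hodd k hk).pos (Ne.symm hk1)
    obtain ⟨i, hi, j, hj, hij⟩ := Finset.one_lt_card.1 h1
    simp only [Finset.mem_filter, Finset.mem_univ, true_and] at hi hj
    let κ' : Fin n → Bool × Bool := fun l => if l = i ∨ l = j then (false, false) else κ l
    -- Only the count of type k changes, and it drops by two, so all the odd parities survive.
    have hsub : ∀ k' ≠ (false, false), (Finset.univ.filter fun l => κ' l = k') =
        (Finset.univ.filter fun l => κ l = k') \ (if k' = k then {i, j} else ∅) := by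
      intro k' hk'
      ext l
      simp only [κ', Finset.mem_filter, Finset.mem_univ, true_and, Finset.mem_sdiff]
      by_cases hl : l = i ∨ l = j
      · have : κ l = k := by rcases hl with rfl | rfl <;> assumption
        by_cases hkk : k' = k
        · simp [hl, hkk, hk.symm]
        · simp [hl, this, Ne.symm hk', Ne.symm hkk]
      · split_ifs with hkk <;> simp [hl]
    refine ih _ ?_ κ' (fun k' hk' => ?_) (hP.flip_pair b hij (hi.trans hj.symm) h) rfl
    · rw [← hm]
      refine Finset.card_lt_card (Finset.ssubset_iff_subset_ne.2 ⟨fun l hl => ?_, fun heq => ?_⟩)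
      · simp only [κ', Finset.mem_filter, Finset.mem_univ, true_and] at hl ⊢
        intro h0
        exact hl (by split_ifs <;> simp [h0])
      · have : i ∈ (Finset.univ.filter fun l => κ l ≠ (false, false)) := by simp [hi, hk]
        rw [← heq] at this
        simp [κ'] at this
    · rw [hsub k' hk']
      split_ifs with hkk
      · subst hkk
        rw [Finset.card_sdiff_of_subset (by
          intro l hl
          simp only [Finset.mem_insert, Finset.mem_singleton] at hl
          rcases hl with rfl | rfl <;> simp [hi, hj]), Finset.card_pair hij]
        exact Nat.Odd.sub_even (by omega) (hodd k' hk') even_two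
      · simpa using hodd k' hk'

theorem det_diagMap (b : Basis (Fin n) ℝ E) (α : Fin n → ℝ) : (diagMap b α).det = ∏ i, α i := by
  have : LinearMap.toMatrix b b (diagMap b α).toLinearMap = Matrix.diagonal α := by
    ext i j
    rw [LinearMap.toMatrix_apply]
    change b.repr (diagMap b α (b j)) i = _
    rw [diagMap_apply, map_smul, Finsupp.smul_apply, Basis.repr_self, Matrix.diagonal_apply]
    by_cases hij : i = j
    · subst hij; simp
    · simp [hij]
  rw [ContinuousLinearMap.det, ← LinearMap.det_toMatrix b, this, Matrix.det_diagonal]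

theorem even_of_prod_boolSign_pos (s : Fin n → Bool) (h : 0 < ∏ i, boolSign (s i)) :
    Even (Finset.univ.filter fun i => s i = true).card := by
  have : ∏ i, boolSign (s i) = (-1) ^ (Finset.univ.filter fun i => s i = true).card := by
    simp only [boolSign, Finset.prod_ite, Finset.prod_const, one_pow, mul_one]
  rw [this] at h
  by_contra hodd
  rw [Nat.not_even_iff_odd] at hodd
  rw [hodd.neg_one_pow] at h
  norm_num at h

/-- A commuting pair of linear maps, with odd-dimensional common negative subspace, deforms to a
pair of half turns about two perpendicular axes of a three-dimensional subspace. -/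
theorem IsDeformable.exists_normal_form (hP : IsDeformable P) (hn : finrank ℝ E = n)
    {A C : E →L[ℝ] E} (h : P A C) (hu : IsUnit A) (hu' : IsUnit C)
    (hodd : Odd (finrank ℝ (commonNegativeSubspace A.toLinearMap C.toLinearMap))) :
    ∃ b : Basis (Fin n) ℝ E, 3 ≤ n ∧
      P (diagMap b fun j => if j.val = 0 ∨ j.val = 1 then -1 else 1)
        (diagMap b fun j => if j.val = 1 ∨ j.val = 2 then -1 else 1) := by
  have lin : ∀ {B C : E →L[ℝ] E}, Commute B C → Commute B.toLinearMap C.toLinearMap :=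
    fun h => congrArg ContinuousLinearMap.toLinearMap h.eq
  have unlin : ∀ {B C : End ℝ E}, Commute B C →
      Commute (LinearMap.toContinuousLinearMap B) (LinearMap.toContinuousLinearMap C) :=
    fun h => ContinuousLinearMap.coe_injective h.eq
  have unitlin : ∀ {B : E →L[ℝ] E}, IsUnit B → IsUnit B.toLinearMap := fun ⟨U, hU⟩ => by
    subst hU
    exact ⟨⟨U.1.toLinearMap, U.2.toLinearMap, congrArg ContinuousLinearMap.toLinearMap U.3,
      congrArg ContinuousLinearMap.toLinearMap U.4⟩, rfl⟩
  have unitunlin : ∀ {B : End ℝ E}, IsUnit B → IsUnit (LinearMap.toContinuousLinearMap B) :=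
    fun ⟨U, hU⟩ => by
    subst hU
    exact ⟨⟨LinearMap.toContinuousLinearMap U.1, LinearMap.toContinuousLinearMap U.2,
      ContinuousLinearMap.coe_injective U.3, ContinuousLinearMap.coe_injective U.4⟩, rfl⟩
  -- The straight segment from B to B' commutes with D throughout, because B' commutes with
  -- everything that commutes with B.
  have move : ∀ {B D : E →L[ℝ] E} {B' : End ℝ E}, P B D →
      (∀ F, Commute B.toLinearMap F → Commute B' F) →
      (∀ t ∈ Icc (0 : ℝ) 1, IsUnit ((1 - t) • B.toLinearMap + t • B')) →
      P (LinearMap.toContinuousLinearMap B') D := by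
    intro B D B' hBD hcomm hunit
    let f : ℝ → (E →L[ℝ] E) := fun t => (1 - t) • B + t • LinearMap.toContinuousLinearMap B'
    have hf0 : f 0 = B := by simp [f]
    have hf1 : f 1 = LinearMap.toContinuousLinearMap B' := by simp [f]
    rw [← hf1]
    refine hP.of_path (by fun_prop) (fun t ht => unitunlin (hunit t ht)) (fun t ht => ?_)
      (hf0.symm ▸ hBD)
    exact ((hP.commute hBD).smul_left _).add_left
      ((unlin (hcomm _ (lin (hP.commute hBD)))).smul_left _)
  obtain ⟨A', hA', hA'c, hA'n, hA'u⟩ := exists_involution_negative A.toLinearMap (unitlin hu)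
  obtain ⟨C', hC', hC'c, hC'n, hC'u⟩ := exists_involution_negative C.toLinearMap (unitlin hu')
  have h1 := move h hA'c hA'u
  have h2 := hP.swap (move (hP.swap h1) hC'c hC'u)
  have hcomm : Commute A' C' := lin (hP.commute h2)
  obtain ⟨b, κ, hbA, hbC, hcard⟩ := exists_basis_of_involutions hn hA' hC' hcomm
  have hAd : LinearMap.toContinuousLinearMap A' = diagMap b fun k => boolSign (κ k).1 :=
    b.clm_ext fun i => by simpa using hbA i
  have hCd : LinearMap.toContinuousLinearMap C' = diagMap b fun k => boolSign (κ k).2 :=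
    b.clm_ext fun i => by simpa using hbC i
  rw [hAd, hCd] at h2
  have htt : Odd (Finset.univ.filter fun i => κ i = (true, true)).card := by
    rw [hcard]
    have : (A'.eigenspace (boolSign true) ⊓ C'.eigenspace (boolSign true) : Submodule ℝ E) =
        commonNegativeSubspace A.toLinearMap C.toLinearMap := by
      ext v
      simp only [commonNegativeSubspace, Submodule.mem_inf, hA'n, hC'n,
        Module.End.mem_eigenspace_iff]
      simp [boolSign]
    rw [this]
    exact hodd
  have split : ∀ s : Bool × Bool → Bool, (Finset.univ.filter fun i => s (κ i) = true).card =
      ∑ k, if s k then (Finset.univ.filter fun i => κ i = k).card else 0 := by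
    intro s
    rw [Finset.card_eq_sum_card_fiberwise (f := κ) (t := Finset.univ) (by simp)]
    refine Finset.sum_congr rfl fun k _ => ?_
    rw [Finset.filter_filter]
    split_ifs with hs
    · congr 1
      ext i
      simp only [Finset.mem_filter, Finset.mem_univ, true_and]
      exact ⟨fun h => h.2, fun h => ⟨h ▸ hs, h⟩⟩
    · rw [Finset.card_eq_zero, Finset.filter_eq_empty_iff]
      rintro i - ⟨h1, h2⟩
      exact hs (h2 ▸ h1)
  -- Positive determinants make the total number of minus signs of each map even. Subtracting the
  -- odd number of (-,-) entries leaves odd numbers of (-,+) and (+,-) entries.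
  have hdetA := even_of_prod_boolSign_pos _ (det_diagMap b _ ▸ hP.det_pos h2)
  have hdetC := even_of_prod_boolSign_pos _ (det_diagMap b _ ▸ hP.det_pos (hP.swap h2))
  rw [split Prod.fst] at hdetA
  rw [split Prod.snd] at hdetC
  simp only [Fintype.sum_prod_type, Fintype.sum_bool, if_true, Bool.false_eq_true, if_false,
    add_zero] at hdetA hdetC
  have hodd' : ∀ k ≠ (false, false), Odd (Finset.univ.filter fun i => κ i = k).card := by
    rintro ⟨_ | _, _ | _⟩ hk
    · exact absurd rfl hk
    · exact (Nat.even_add'.1 hdetC).1 htt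
    · exact (Nat.even_add'.1 hdetA).1 htt
    · exact htt
  obtain ⟨κ', hκ', h3⟩ := hP.exists_reduced b κ hodd' h2
  have hex : ∀ k ≠ (false, false), ∃ i, κ' i = k ∧ ∀ j, κ' j = k → j = i := fun k hk => by
    obtain ⟨i, hi⟩ := Finset.card_eq_one.1 (hκ' k hk)
    simp only [Finset.ext_iff, Finset.mem_filter, Finset.mem_univ, true_and,
      Finset.mem_singleton] at hi
    exact ⟨i, (hi i).2 rfl, fun j => (hi j).1⟩
  obtain ⟨i₀, h0, h0'⟩ := hex (true, false) (by simp)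
  obtain ⟨i₁, h1', h1''⟩ := hex (true, true) (by simp)
  obtain ⟨i₂, h2', h2''⟩ := hex (false, true) (by simp)
  have h01 : i₀ ≠ i₁ := fun h => by rw [h, h1'] at h0; simp at h0
  have h02 : i₀ ≠ i₂ := fun h => by rw [h, h2'] at h0; simp at h0
  have h12 : i₁ ≠ i₂ := fun h => by rw [h, h2'] at h1'; simp at h1'
  -- The (-,-) vector comes in the middle since index 1 is the one negated by both model maps. A
  -- permutation then moves the three vectors to positions 0, 1, 2.
  let x : Fin 3 ↪ Fin n := ⟨![i₀, i₁, i₂], by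
    intro u v huv
    fin_cases u <;> fin_cases v <;> simp [h01, h02, h12, h01.symm, h02.symm, h12.symm] at huv ⊢⟩
  have hn3 : 3 ≤ n := by simpa using Fintype.card_le_of_embedding x
  obtain ⟨g, hg⟩ := (Equiv.Perm.isMultiplyPretransitive (Fin n) 3).exists_smul_eq x (Fin.castLEEmb hn3)
  have hg' : ∀ u : Fin 3, g (x u) = Fin.castLE hn3 u := fun u => DFunLike.congr_fun hg u
  have hg0 : (g i₀).val = 0 := congrArg Fin.val (hg' 0)
  have hg1 : (g i₁).val = 1 := congrArg Fin.val (hg' 1)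
  have hg2 : (g i₂).val = 2 := congrArg Fin.val (hg' 2)
  refine ⟨b.reindex g, hn3, ?_⟩
  have hfin : ∀ α β : Fin n → ℝ, (∀ i, α i = β (g i)) → diagMap b α = diagMap (b.reindex g) β := by
    intro α β hαβ
    refine b.clm_ext fun i => ?_
    have := diagMap_apply (b.reindex g) β (g i)
    rw [Basis.reindex_apply, Equiv.symm_apply_apply] at this
    rw [this, diagMap_apply, hαβ]
  have hval : ∀ i m, (g i).val = m → ∀ j, (g j).val = m → j = i := fun i m hi j hj =>
    g.injective (Fin.ext (hj.trans hi.symm))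
  rwa [hfin _ _ ?_, hfin _ _ ?_] at h3
  · intro i
    rcases hi : κ' i with ⟨_ | _, _ | _⟩
    · have : i ≠ i₀ := fun h => by rw [h, h0] at hi; simp at hi
      have : i ≠ i₁ := fun h => by rw [h, h1'] at hi; simp at hi
      have : i ≠ i₂ := fun h => by rw [h, h2'] at hi; simp at hi
      rw [if_neg]
      · simp [boolSign]
      · rintro (h | h)
        · exact ‹i ≠ i₁› (hval _ _ hg1 _ h)
        · exact ‹i ≠ i₂› (hval _ _ hg2 _ h)
    · obtain rfl := h2'' i hi
      simp [boolSign, hg2]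
    · obtain rfl := h0' i hi
      simp [boolSign, hg0]
    · obtain rfl := h1'' i hi
      simp [boolSign, hg1]
  · intro i
    rcases hi : κ' i with ⟨_ | _, _ | _⟩
    · have : i ≠ i₀ := fun h => by rw [h, h0] at hi; simp at hi
      have : i ≠ i₁ := fun h => by rw [h, h1'] at hi; simp at hi
      rw [if_neg]
      · simp [boolSign]
      · rintro (h | h)
        · exact ‹i ≠ i₀› (hval _ _ hg0 _ h)
        · exact ‹i ≠ i₁› (hval _ _ hg1 _ h)
    · obtain rfl := h2'' i hi
      simp [boolSign, hg2]
    · obtain rfl := h0' i hi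
      simp [boolSign, hg0]
    · obtain rfl := h1'' i hi
      simp [boolSign, hg1]

end NormalForm

/-! ### Charts onto the whole of the model space -/

section Charts

variable {n : ℕ} {X : Type*} [TopologicalSpace X] [ChartedSpace (EuclideanSpace ℝ (Fin n)) X]

theorem trans_mem_maximalAtlas [IsManifold (𝓡 n) ∞ X]
    {ψ : OpenPartialHomeomorph X (EuclideanSpace ℝ (Fin n))}
    (hψ : ψ ∈ IsManifold.maximalAtlas (𝓡 n) ∞ X)
    {θ : OpenPartialHomeomorph (EuclideanSpace ℝ (Fin n)) (EuclideanSpace ℝ (Fin n))}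
    (hθ : ContDiffOn ℝ ∞ θ θ.source) (hθ' : ContDiffOn ℝ ∞ θ.symm θ.target) :
    ψ.trans θ ∈ IsManifold.maximalAtlas (𝓡 n) ∞ X := by
  refine OpenPartialHomeomorph.mem_maximalAtlas_of_contMDiffOn _ ?_ ?_
  · exact hθ.contMDiffOn.comp ((contMDiffOn_of_mem_maximalAtlas hψ).mono (by simp))
      (fun p hp => by simpa using hp.2)
  · rw [OpenPartialHomeomorph.trans_symm_eq_symm_trans_symm]
    refine (contMDiffOn_symm_of_mem_maximalAtlas hψ).comp (hθ'.contMDiffOn.mono ?_) ?_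
    · intro v hv
      simp at hv
      exact hv.1
    · intro v hv
      simp at hv
      exact hv.2

/-- The linear coordinate change `g` as an open partial homeomorphism. -/
noncomputable abbrev linearChange (g : EuclideanSpace ℝ (Fin n) ≃L[ℝ] EuclideanSpace ℝ (Fin n)) :
    OpenPartialHomeomorph (EuclideanSpace ℝ (Fin n)) (EuclideanSpace ℝ (Fin n)) :=
  g.toHomeomorph.toOpenPartialHomeomorph

theorem linearChange_mem_maximalAtlas [IsManifold (𝓡 n) ∞ X]
    {ψ : OpenPartialHomeomorph X (EuclideanSpace ℝ (Fin n))}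
    (hψ : ψ ∈ IsManifold.maximalAtlas (𝓡 n) ∞ X)
    (g : EuclideanSpace ℝ (Fin n) ≃L[ℝ] EuclideanSpace ℝ (Fin n)) :
    ψ.trans (linearChange g) ∈ IsManifold.maximalAtlas (𝓡 n) ∞ X :=
  trans_mem_maximalAtlas hψ g.contDiff.contDiffOn g.symm.contDiff.contDiffOn

theorem univBall_symm_mem_maximalAtlas [IsManifold (𝓡 n) ∞ X]
    {ψ : OpenPartialHomeomorph X (EuclideanSpace ℝ (Fin n))}
    (hψ : ψ ∈ IsManifold.maximalAtlas (𝓡 n) ∞ X) (v : EuclideanSpace ℝ (Fin n)) {r : ℝ}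
    (hr : 0 < r) :
    ψ.trans (OpenPartialHomeomorph.univBall v r).symm ∈ IsManifold.maximalAtlas (𝓡 n) ∞ X := by
  refine trans_mem_maximalAtlas hψ ?_ ?_
  · rw [OpenPartialHomeomorph.symm_source, OpenPartialHomeomorph.univBall_target v hr]
    exact OpenPartialHomeomorph.contDiffOn_univBall_symm
  · rw [OpenPartialHomeomorph.symm_symm]
    exact OpenPartialHomeomorph.contDiff_univBall.contDiffOn

theorem univBall_target_eq_univ {ψ : OpenPartialHomeomorph X (EuclideanSpace ℝ (Fin n))}
    {v : EuclideanSpace ℝ (Fin n)} {r : ℝ} (hr : 0 < r) (h : Metric.ball v r ⊆ ψ.target) :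
    (ψ.trans (OpenPartialHomeomorph.univBall v r).symm).target = univ := by
  rw [OpenPartialHomeomorph.trans_target, OpenPartialHomeomorph.symm_target,
    OpenPartialHomeomorph.univBall_source, univ_inter, OpenPartialHomeomorph.symm_symm,
    eq_univ_iff_forall]
  intro w
  apply h
  rw [← OpenPartialHomeomorph.univBall_target v hr]
  exact (OpenPartialHomeomorph.univBall v r).map_source (by simp)

theorem isPreconnected_source_of_target_eq_univ
    {φ : OpenPartialHomeomorph X (EuclideanSpace ℝ (Fin n))} (h : φ.target = univ) :
    IsPreconnected φ.source := by
  rw [← φ.symm_image_target_eq_source, h]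
  exact isPreconnected_univ.image _ (h ▸ φ.continuousOn_symm)

/-- Shrinking to a ball and stretching the ball onto ℝⁿ gives a connected source, which makes the
chart coherent. -/
theorem exists_centered_chart [IsManifold (𝓡 n) ∞ X] (o : ManifoldOrientation n X) (x : X) :
    ∃ ψ ∈ IsManifold.maximalAtlas (𝓡 n) ∞ X, x ∈ ψ.source ∧ ψ x = 0 ∧ o.CoherentChart ψ := by
  set c := chartAt (EuclideanSpace ℝ (Fin n)) x
  obtain ⟨r, hr, hball⟩ := Metric.isOpen_iff.1 c.open_target _
    (c.map_source (mem_chart_source _ x))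
  have hψ := univBall_symm_mem_maximalAtlas
    (IsManifold.chart_mem_maximalAtlas x : c ∈ IsManifold.maximalAtlas (𝓡 n) ∞ X) (c x) hr
  refine ⟨c.trans (OpenPartialHomeomorph.univBall (c x) r).symm, hψ, ?_, ?_, ManifoldOrientation.coherentChart_of_isPreconnected hψ
    (isPreconnected_source_of_target_eq_univ (univBall_target_eq_univ hr hball))⟩
  · rw [OpenPartialHomeomorph.trans_source]
    refine ⟨mem_chart_source _ x, ?_⟩
    rw [mem_preimage, OpenPartialHomeomorph.symm_source, OpenPartialHomeomorph.univBall_target _ hr]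
    exact Metric.mem_ball_self hr
  · rw [OpenPartialHomeomorph.coe_trans, Function.comp_apply,
      OpenPartialHomeomorph.univBall_symm_apply_center]

end Charts

/-! ### Diagonal maps of Euclidean space -/

section EuclideanDiagonal

variable {n : ℕ}

/-- The diagonal linear map with entries `α`. -/
noncomputable def euclideanDiag (α : Fin n → ℝ) :
    EuclideanSpace ℝ (Fin n) →L[ℝ] EuclideanSpace ℝ (Fin n) :=
  diagMap (EuclideanSpace.basisFun (Fin n) ℝ).toBasis α

theorem toEuclideanLin_diagonal (α : Fin n → ℝ) :
    Matrix.toEuclideanLin (Matrix.diagonal α) = (euclideanDiag α).toLinearMap := by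
  refine (EuclideanSpace.basisFun (Fin n) ℝ).toBasis.ext fun i => ?_
  have h := diagMap_apply (EuclideanSpace.basisFun (Fin n) ℝ).toBasis α i
  refine Eq.trans ?_ h.symm
  ext j
  simp [Matrix.toLpLin_apply]

theorem euclideanDiag_apply (α : Fin n → ℝ) (v : EuclideanSpace ℝ (Fin n)) (j : Fin n) :
    euclideanDiag α v j = α j * v j := by
  have := congrArg (fun L : EuclideanSpace ℝ (Fin n) →ₗ[ℝ] EuclideanSpace ℝ (Fin n) => L v j)
    (toEuclideanLin_diagonal α)
  refine this.symm.trans ?_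
  simp [Matrix.toLpLin_apply, Matrix.mulVec_diagonal]

theorem norm_euclideanDiag {α : Fin n → ℝ} (hα : ∀ j, α j * α j = 1)
    (v : EuclideanSpace ℝ (Fin n)) : ‖euclideanDiag α v‖ = ‖v‖ := by
  rw [EuclideanSpace.norm_eq, EuclideanSpace.norm_eq]
  congr 1
  refine Finset.sum_congr rfl fun j _ => ?_
  rw [euclideanDiag_apply, Real.norm_eq_abs, sq_abs, Real.norm_eq_abs, sq_abs]
  linear_combination (v j) ^ 2 * hα j

theorem euclideanDiag_comm (α β : Fin n → ℝ) (v : EuclideanSpace ℝ (Fin n)) :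
    euclideanDiag α (euclideanDiag β v) = euclideanDiag β (euclideanDiag α v) := by
  ext j
  simp only [euclideanDiag_apply]
  ring

theorem euclideanDiag_euclideanDiag {α : Fin n → ℝ} (hα : ∀ j, α j * α j = 1)
    (v : EuclideanSpace ℝ (Fin n)) : euclideanDiag α (euclideanDiag α v) = v := by
  ext j
  simp only [euclideanDiag_apply]
  linear_combination v j * hα j

theorem det_euclideanDiag (α : Fin n → ℝ) : (euclideanDiag α).det = ∏ j, α j := det_diagMap _ _

/-- The diagonal entries of `rotK`. -/
def signK (j : Fin n) : ℝ := if j.val = 0 ∨ j.val = 1 then -1 else 1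

/-- The diagonal entries of `rotI`. -/
def signI (j : Fin n) : ℝ := if j.val = 1 ∨ j.val = 2 then -1 else 1

theorem signK_mul_self (j : Fin n) : signK j * signK j = 1 := by unfold signK; split_ifs <;> norm_num

theorem signI_mul_self (j : Fin n) : signI j * signI j = 1 := by unfold signI; split_ifs <;> norm_num

theorem rotK_eq : rotK n = (euclideanDiag signK).toLinearMap := toEuclideanLin_diagonal _

theorem rotI_eq : rotI n = (euclideanDiag signI).toLinearMap := toEuclideanLin_diagonal _

theorem univBall_zero_apply {r : ℝ} (hr : 0 < r) (v : EuclideanSpace ℝ (Fin n)) :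
    OpenPartialHomeomorph.univBall 0 r v = r • (Real.sqrt (1 + ‖v‖ ^ 2))⁻¹ • v := by
  rw [OpenPartialHomeomorph.univBall, dif_pos hr]
  change OpenPartialHomeomorph.unitBallBall 0 r hr (OpenPartialHomeomorph.univUnitBall v) = _
  rw [OpenPartialHomeomorph.unitBallBall_apply, OpenPartialHomeomorph.univUnitBall_apply]
  simp

/-- The rescaling `univBall` multiplies v by a function of ‖v‖, so it commutes with linear
isometries. -/
theorem univBall_symm_euclideanDiag {r : ℝ} (hr : 0 < r) {α : Fin n → ℝ}
    (hα : ∀ j, α j * α j = 1) {v : EuclideanSpace ℝ (Fin n)} (hv : v ∈ Metric.ball 0 r) :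
    (OpenPartialHomeomorph.univBall 0 r).symm (euclideanDiag α v) =
      euclideanDiag α ((OpenPartialHomeomorph.univBall 0 r).symm v) := by
  have hv' : v ∈ (OpenPartialHomeomorph.univBall (0 : EuclideanSpace ℝ (Fin n)) r).target := by
    rwa [OpenPartialHomeomorph.univBall_target _ hr]
  have h : euclideanDiag α v = OpenPartialHomeomorph.univBall 0 r
      (euclideanDiag α ((OpenPartialHomeomorph.univBall 0 r).symm v)) := by
    conv_lhs => rw [← (OpenPartialHomeomorph.univBall 0 r).right_inv hv']
    rw [univBall_zero_apply hr, univBall_zero_apply hr, norm_euclideanDiag hα, map_smul, map_smul]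
  rw [h, OpenPartialHomeomorph.left_inv _ (by simp)]

end EuclideanDiagonal

/-! ### Existence of standardized pairs -/

section Standardize

variable {n : ℕ} {X : Type*} [TopologicalSpace X] [ChartedSpace (EuclideanSpace ℝ (Fin n)) X]
  {o : ManifoldOrientation n X} {ψ : OpenPartialHomeomorph X (EuclideanSpace ℝ (Fin n))} {x : X}

/-- A diffeomorphism can be made linear near a fixed point. -/
theorem exists_linearized [T2Space X] (hn : 0 < n) (hco : o.CoherentChart ψ)
    (hψ : ψ ∈ IsManifold.maximalAtlas (𝓡 n) ∞ X) (hx : x ∈ ψ.source) (hx0 : ψ x = 0)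
    {a c : X ≃ₘ⟮𝓡 n, 𝓡 n⟯ X} (ha : o.Preserves a) (hax : a x = x) (hcx : c x = x)
    (hi : IsotopicToIdAt ψ x (diffCommutator a c)) :
    ∃ a' : X ≃ₘ⟮𝓡 n, 𝓡 n⟯ X, o.Preserves a' ∧ a' x = x ∧
      (∀ᶠ v in 𝓝 0, a' (ψ.symm v) = ψ.symm (coordDeriv ψ ψ a x v)) ∧
      IsotopicToIdAt ψ x (diffCommutator a' c) := by
  obtain ⟨δ, hδ, H⟩ := exists_family_of_germ hn hco hψ hx hx0
  have hcomm : Commute (coordDeriv ψ ψ a x) (coordDeriv ψ ψ c x) := by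
    obtain ⟨b, -, hb0, -, hbx⟩ := hi
    rw [← coordDeriv_diffCommutator hψ hx hax hcx, ← hb0]
    exact (hbx 0).2
  set A := coordDeriv ψ ψ a x with hA
  -- In coordinates this is a⁻¹ ∘ A, so that a ∘ k = A; it is tangent to the identity because A is
  -- the differential of a. The segment h from the identity to k has identity differential
  -- throughout.
  let k : EuclideanSpace ℝ (Fin n) → EuclideanSpace ℝ (Fin n) := (ψ ∘ a.symm ∘ ψ.symm) ∘ A
  let W₀ : Set (EuclideanSpace ℝ (Fin n)) := A ⁻¹' (ψ.target ∩ ψ.symm ⁻¹' (a.symm ⁻¹' ψ.source))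
  have hax' := Diffeomorph.symm_fixed hax
  have hW₀ : IsOpen W₀ := (ψ.symm.isOpen_inter_preimage
    (ψ.open_source.preimage a.symm.continuous)).preimage A.continuous
  have hsymm0 : ψ.symm 0 = x := by rw [← hx0, ψ.left_inv hx]
  have h0W₀ : (0 : EuclideanSpace ℝ (Fin n)) ∈ W₀ := by
    refine ⟨?_, ?_⟩
    · rw [map_zero, ← hx0]; exact ψ.map_source hx
    · simpa [hsymm0, hax'] using hx
  have hk : ContDiffOn ℝ ∞ k W₀ := fun v hv => by
    have h1 := contDiffAt_coord hψ hψ (f := a.symm) (ψ.map_target hv.1) hv.2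
      a.symm.contMDiff.contMDiffAt
    rw [ψ.right_inv hv.1] at h1
    exact (h1.comp v A.contDiff.contDiffAt).contDiffWithinAt
  have hk0 : k 0 = 0 := by simp [k, hsymm0, hax', hx0]
  have hkd : HasFDerivAt k (1 : EuclideanSpace ℝ (Fin n) →L[ℝ] EuclideanSpace ℝ (Fin n)) 0 := by
    have h1 := differentiableAt_coord hψ hψ (f := a.symm) hx (by rwa [hax'])
      a.symm.contMDiff.contMDiffAt
    have h2 := h1.hasFDerivAt
    rw [show fderiv ℝ (ψ ∘ a.symm ∘ ψ.symm) (ψ x) = coordDeriv ψ ψ a.symm x from rfl, hx0,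
      ← map_zero A] at h2
    have h3 := h2.comp 0 A.hasFDerivAt
    rwa [show (coordDeriv ψ ψ a.symm x).comp A = 1 from coordDeriv_symm_mul hψ hx hax] at h3
  let h : ℝ × EuclideanSpace ℝ (Fin n) → EuclideanSpace ℝ (Fin n) :=
    fun q => q.2 + q.1 • (k q.2 - q.2)
  have hd : ∀ t, fderiv ℝ (fun v => h (t, v)) 0 = ContinuousLinearMap.id ℝ _ := fun t => by
    have := ((hasFDerivAt_id (𝕜 := ℝ) (0 : EuclideanSpace ℝ (Fin n))).add
      ((hkd.sub (hasFDerivAt_id 0)).const_smul t)).fderiv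
    refine this.trans ?_
    rw [show (1 : EuclideanSpace ℝ (Fin n) →L[ℝ] EuclideanSpace ℝ (Fin n)) =
      ContinuousLinearMap.id ℝ _ from rfl, sub_self, smul_zero, add_zero]
  obtain ⟨r, hr, hrW⟩ := Metric.isOpen_iff.1 hW₀ 0 h0W₀
  obtain ⟨ρ, hρ, hρr, hρt, T, hT, hTo, hTx, -, hTm, hTeq, hTid, -, hTd⟩ := H h (univ ×ˢ W₀)
    (isOpen_univ.prod hW₀)
    (contDiff_snd.contDiffOn.add (contDiff_fst.contDiffOn.smul
      ((hk.comp contDiff_snd.contDiffOn fun q hq => hq.2).sub contDiff_snd.contDiffOn)))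
    (fun t _ => ⟨mem_univ _, h0W₀⟩) (fun t _ => by simp [h, hk0])
    (fun t ht => by rw [hd, sub_self, norm_zero]; exact hδ.le) r hr
  have hαx : ∀ t, ((T t).trans a) x = x := fun t => (congrArg a (hTx t)).trans hax
  have hαd : ∀ t, coordDeriv ψ ψ ((T t).trans a) x = A := fun t => by
    rw [coordDeriv_trans hψ hx (hTx t) hax, hTd, hd]
    exact mul_one A
  refine ⟨(T 1).trans a, (hTo 1).trans ha, hαx 1, ?_, ?_⟩
  · filter_upwards [Metric.closedBall_mem_nhds _ hρ] with v hv
    have hvt : v ∈ ψ.target := hρt hv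
    have hvW : v ∈ W₀ := hrW (Metric.closedBall_subset_ball hρr hv)
    have hvs := ψ.map_target hvt
    have h1 := hTeq 1 _ hvs (by rw [ψ.right_inv hvt]; exact mem_closedBall_zero_iff.1 hv)
    rw [ψ.right_inv hvt, Real.smoothTransition.one] at h1
    have h2 : ψ (T 1 (ψ.symm v)) = ψ (a.symm (ψ.symm (A v))) := by
      rw [h1]; simp [h, k]
    have h3 := ψ.injOn ((hTm 1 _).2 hvs) hvW.2 h2
    change a (T 1 (ψ.symm v)) = _
    rw [h3, a.apply_symm_apply]
  · refine IsotopicToIdAt.deform hψ hx (α := fun t => (T t).trans a) (γ := fun _ => c)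
      (hT.trans (.const a)) (.const c) hαx (fun _ => hcx) (fun t => ?_) ?_
    · rw [hαd]; exact hcomm
    · have : T 0 = Diffeomorph.refl (𝓡 n) X ∞ := hTid 0 fun v _ => by
        simp [h, Real.smoothTransition.zero]
      simpa only [this, Diffeomorph.refl_trans] using hi

/-- An isotopy through diffeomorphisms with trivial first order germ can be made relative to a
neighbourhood of the fixed point, if its ends are. -/
theorem IsotopicToIdAt.exists_isotopy_rel [T2Space X] (hn : 0 < n) (hco : o.CoherentChart ψ)
    (hψ : ψ ∈ IsManifold.maximalAtlas (𝓡 n) ∞ X) (hx : x ∈ ψ.source) (hx0 : ψ x = 0)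
    {f : X ≃ₘ⟮𝓡 n, 𝓡 n⟯ X} (hf : ∀ᶠ v in 𝓝 0, f (ψ.symm v) = ψ.symm v)
    (hi : IsotopicToIdAt ψ x f) :
    ∃ b : ℝ → (X ≃ₘ⟮𝓡 n, 𝓡 n⟯ X), IsSmoothIsotopy b f (Diffeomorph.refl (𝓡 n) X ∞) ∧
      ∃ ρ > 0, ∀ t, ∀ p ∈ ψ.source, ‖ψ p‖ < ρ → b t p = p := by
  obtain ⟨δ, hδ, H⟩ := exists_family_of_germ hn hco hψ hx hx0
  obtain ⟨g, hg, hg0, hg1, hgx⟩ := hi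
  -- The isotopy itself, read in the chart; its germ will be cut off to T and divided out.
  let h : ℝ × EuclideanSpace ℝ (Fin n) → EuclideanSpace ℝ (Fin n) :=
    fun q => ψ (g q.1 (ψ.symm q.2))
  let S : Set (ℝ × EuclideanSpace ℝ (Fin n)) := univ ×ˢ ψ.target
  let G : ℝ × EuclideanSpace ℝ (Fin n) → X := fun q => g q.1 (ψ.symm q.2)
  have hS : IsOpen S := isOpen_univ.prod ψ.open_target
  have hG : ∀ q ∈ S, ContMDiffAt 𝓘(ℝ, ℝ × EuclideanSpace ℝ (Fin n)) (𝓡 n) ∞ G q := fun q hq => by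
    have h1 : ContMDiffAt 𝓘(ℝ, ℝ × EuclideanSpace ℝ (Fin n)) (𝓡 n) ∞
        (fun q : ℝ × EuclideanSpace ℝ (Fin n) => ψ.symm q.2) q :=
      (contMDiffAt_symm_of_mem_maximalAtlas hψ hq.2).comp q
        (f := fun q : ℝ × EuclideanSpace ℝ (Fin n) => q.2) contDiff_snd.contMDiff.contMDiffAt
    exact hg.contMDiffAt.comp q (contDiff_fst.contMDiff.contMDiffAt.prodMk h1)
  have hGc : ContinuousOn G S := fun q hq => (hG q hq).continuousAt.continuousWithinAt
  let W := S ∩ G ⁻¹' ψ.source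
  have hW : IsOpen W := hGc.isOpen_inter_preimage hS ψ.open_source
  have hsymm0 : ψ.symm 0 = x := by rw [← hx0, ψ.left_inv hx]
  have h0t : (0 : EuclideanSpace ℝ (Fin n)) ∈ ψ.target := hx0 ▸ ψ.map_source hx
  have hh : ContDiffOn ℝ ∞ h W := fun q hq => by
    have : ContMDiffAt 𝓘(ℝ, ℝ × EuclideanSpace ℝ (Fin n)) (𝓡 n) ∞ h q :=
      (contMDiffAt_of_mem_maximalAtlas hψ hq.2).comp q (hG q hq.1)
    exact (contMDiffAt_iff_contDiffAt.1 this).contDiffWithinAt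
  have hd : ∀ t, fderiv ℝ (fun v => h (t, v)) 0 = ContinuousLinearMap.id ℝ _ := fun t => by
    have := (hgx t).2
    unfold coordDeriv at this
    rw [hx0] at this
    exact this
  obtain ⟨r, hr, hrt⟩ := Metric.eventually_nhds_iff.1 (hf.and (ψ.open_target.eventually_mem h0t))
  simp only [dist_zero_right] at hrt
  obtain ⟨ρ, hρ, hρr, hρt, T, hT, -, hTx, hTW, hTm, hTeq, hTid, hTn, -⟩ := H h W hW hh
    (fun t _ => ⟨⟨mem_univ _, h0t⟩, by simpa [G, hsymm0, (hgx t).1] using hx⟩)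
    (fun t _ => by simp [h, hsymm0, (hgx t).1, hx0])
    (fun t ht => by rw [hd, sub_self, norm_zero]; exact hδ.le) r hr
  -- Both ends of the isotopy are the identity on the ball of radius r, so the correction T is
  -- trivial there and the ends are unchanged.
  have hT0 : T 0 = Diffeomorph.refl (𝓡 n) X ∞ := hTid 0 fun v hv => by
    simp only [h, Real.smoothTransition.zero, hg0, (hrt hv).1]
    exact ψ.right_inv (hrt hv).2
  have hT1 : T 1 = Diffeomorph.refl (𝓡 n) X ∞ := hTid 1 fun v hv => by
    simp only [h, Real.smoothTransition.one, hg1]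
    exact ψ.right_inv (hrt hv).2
  -- T and g have the same germ at x, so g ∘ T⁻¹ is the identity near x. The radius is halved
  -- because T⁻¹ at most doubles the norm in the chart.
  refine ⟨fun t => (T t).symm.trans (g (Real.smoothTransition t)), ⟨?_, ?_, ?_⟩, ρ / 2,
    half_pos hρ, fun t p hp hpρ => ?_⟩
  · exact (contMDiff_family_comp (f := fun t => (T t).symm)
      (g := fun t => g (Real.smoothTransition t)) hT.2
      (contMDiff_family_reparam (f := fun t => g t) hg Real.smoothTransition.contDiff)).contMDiffOn
  · ext p
    simp [hT0, hg0, Real.smoothTransition.zero]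
  · ext p
    simp [hT1, hg1, Real.smoothTransition.one]
  · have hσ : Real.smoothTransition t ∈ Icc (0 : ℝ) 1 :=
      ⟨Real.smoothTransition.nonneg t, Real.smoothTransition.le_one t⟩
    obtain ⟨q, rfl⟩ := (T t).surjective p
    change ‖ψ (T t q)‖ < ρ / 2 at hpρ
    have hq := (hTm t q).1 hp
    have hqn : ‖ψ q‖ ≤ ρ := (hTn t q hq).trans (by linarith)
    have h1 := hTeq t q hq hqn
    have h2 := (hTW _ hσ _ hqn).2
    simp only [G, h, mem_preimage, ψ.left_inv hq] at h1 h2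
    change g (Real.smoothTransition t) ((T t).symm (T t q)) = _
    rw [Diffeomorph.symm_apply_apply]
    exact (ψ.injOn hp h2 h1).symm

/-- A diffeomorphism is given near `x`, in the coordinates `ψ`, by the linear map `A`. -/
def IsLinearNear (ψ : OpenPartialHomeomorph X (EuclideanSpace ℝ (Fin n))) (a : X → X)
    (A : EuclideanSpace ℝ (Fin n) →L[ℝ] EuclideanSpace ℝ (Fin n)) : Prop :=
  ∀ᶠ v in 𝓝 0, a (ψ.symm v) = ψ.symm (A v)

theorem ContinuousLinearMap.tendsto_zero' {E : Type*} [NormedAddCommGroup E] [NormedSpace ℝ E]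
    (A : E →L[ℝ] E) : Tendsto A (𝓝 0) (𝓝 0) := by
  simpa using A.continuous.tendsto 0

theorem IsLinearNear.comp {a c : X → X}
    {A C : EuclideanSpace ℝ (Fin n) →L[ℝ] EuclideanSpace ℝ (Fin n)} (ha : IsLinearNear ψ a A)
    (hc : IsLinearNear ψ c C) : IsLinearNear ψ (a ∘ c) (A * C) := by
  filter_upwards [hc, C.tendsto_zero'.eventually ha] with v h1 h2
  simp [h1, h2]

theorem IsLinearNear.symm {a : X ≃ₘ⟮𝓡 n, 𝓡 n⟯ X}
    {A : EuclideanSpace ℝ (Fin n) →L[ℝ] EuclideanSpace ℝ (Fin n)} (ha : IsLinearNear ψ a A)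
    (hA : A * A = 1) : IsLinearNear ψ a.symm A := by
  filter_upwards [A.tendsto_zero'.eventually ha] with v h1
  rw [← mul_apply_eq_comp, hA] at h1
  rw [show ψ.symm v = a (ψ.symm (A v)) from h1.symm, a.symm_apply_apply]

/-- Near the fixed point the commutator is A C A⁻¹ C⁻¹, where the inverses are A and C themselves.
-/
theorem IsLinearNear.diffCommutator {a c : X ≃ₘ⟮𝓡 n, 𝓡 n⟯ X}
    {A C : EuclideanSpace ℝ (Fin n) →L[ℝ] EuclideanSpace ℝ (Fin n)} (ha : IsLinearNear ψ a A)
    (hc : IsLinearNear ψ c C) (hA : A * A = 1) (hC : C * C = 1) (hAC : Commute A C) :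
    ∀ᶠ v in 𝓝 0, diffCommutator a c (ψ.symm v) = ψ.symm v := by
  have h := (ha.comp hc).comp ((ha.symm hA).comp (hc.symm hC))
  have h1 : A * C * (A * C) = 1 := by
    rw [mul_assoc, ← mul_assoc C, ← hAC.eq, mul_assoc A C C, hC, mul_one, hA]
  rw [h1] at h
  exact h

theorem exists_linearEquiv_diagMap (b : Module.Basis (Fin n) ℝ (EuclideanSpace ℝ (Fin n))) :
    ∃ g : EuclideanSpace ℝ (Fin n) ≃L[ℝ] EuclideanSpace ℝ (Fin n),
      ∀ (α : Fin n → ℝ) v, g (diagMap b α v) = euclideanDiag α (g v) := by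
  let e := (EuclideanSpace.basisFun (Fin n) ℝ).toBasis
  obtain ⟨g, hgb⟩ : ∃ g : EuclideanSpace ℝ (Fin n) ≃ₗ[ℝ] EuclideanSpace ℝ (Fin n),
      ∀ i, g (b i) = e i := ⟨b.equiv e (Equiv.refl _), fun i => b.equiv_apply i _ _⟩
  refine ⟨g.toContinuousLinearEquiv, fun α v => ?_⟩
  have h : g.toLinearMap ∘ₗ (diagMap b α).toLinearMap =
      (euclideanDiag α).toLinearMap ∘ₗ g.toLinearMap := b.ext fun i => by
    have h1 : euclideanDiag α (e i) = α i • e i := diagMap_apply e α i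
    change g (diagMap b α (b i)) = euclideanDiag α (g (b i))
    rw [diagMap_apply, map_smul, hgb, h1]
  exact LinearMap.congr_fun h v

theorem diagMap_mul_self (b : Module.Basis (Fin n) ℝ (EuclideanSpace ℝ (Fin n))) {α : Fin n → ℝ}
    (hα : ∀ j, α j * α j = 1) : diagMap b α * diagMap b α = 1 :=
  b.clm_ext fun i => by
    change diagMap b α (diagMap b α (b i)) = b i
    rw [diagMap_apply, map_smul, diagMap_apply, smul_smul, hα, one_smul]

/-- Coordinates onto the whole of the model space, obtained by restricting `ψ` to a small
ellipsoid. -/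
theorem exists_ellipsoid_chart [IsManifold (𝓡 n) ∞ X]
    (hψ : ψ ∈ IsManifold.maximalAtlas (𝓡 n) ∞ X) (hx : x ∈ ψ.source) (hx0 : ψ x = 0)
    (b : Module.Basis (Fin n) ℝ (EuclideanSpace ℝ (Fin n)))
    {s : Set (EuclideanSpace ℝ (Fin n))} (hs : s ∈ 𝓝 0) :
    ∃ φ ∈ IsManifold.maximalAtlas (𝓡 n) ∞ X, φ.target = univ ∧ x ∈ φ.source ∧ φ x = 0 ∧
      (∀ p ∈ φ.source, p ∈ ψ.source ∧ ψ p ∈ s) ∧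
      ∀ (f : X → X) (α : Fin n → ℝ), (∀ j, α j * α j = 1) →
        (∀ v ∈ s, f (ψ.symm v) = ψ.symm (diagMap b α v)) →
        ∀ p ∈ φ.source, f p ∈ φ.source ∧ φ (f p) = euclideanDiag α (φ p) := by
  obtain ⟨g, hgd⟩ := exists_linearEquiv_diagMap b
  have h0t : (0 : EuclideanSpace ℝ (Fin n)) ∈ ψ.target := hx0 ▸ ψ.map_source hx
  have hev : ∀ᶠ w in 𝓝 (0 : EuclideanSpace ℝ (Fin n)), g.symm w ∈ ψ.target ∧ g.symm w ∈ s := by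
    have ht : Tendsto g.symm (𝓝 0) (𝓝 0) := by simpa using g.symm.continuous.tendsto 0
    exact (ht.eventually (ψ.open_target.eventually_mem h0t)).and (ht.eventually hs)
  obtain ⟨ε, hε, hball⟩ := Metric.eventually_nhds_iff_ball.1 hev
  have htarget : Metric.ball 0 ε ⊆ (ψ.trans (linearChange g)).target := fun w hw => by
    have := (hball w hw).1
    simpa [linearChange, OpenPartialHomeomorph.trans_target] using this
  -- In the coordinates g ∘ ψ the basis b is orthonormal and the sign matrices are isometries. A
  -- round ball there is therefore invariant, and the radial rescaling onto ℝⁿ keeps the matrices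
  -- linear.
  obtain ⟨φ, hφdef⟩ : ∃ φ, φ = (ψ.trans (linearChange g)).trans
    (OpenPartialHomeomorph.univBall 0 ε).symm := ⟨_, rfl⟩
  have hsrc : ∀ p, p ∈ φ.source ↔ p ∈ ψ.source ∧ g (ψ p) ∈ Metric.ball 0 ε := fun p => by
    have h1 : p ∈ φ.source ↔ p ∈ (ψ.trans (linearChange g)).source ∧ g (ψ p) ∈
        (OpenPartialHomeomorph.univBall (0 : EuclideanSpace ℝ (Fin n)) ε).target := by
      rw [hφdef]; exact Iff.rfl
    rw [h1, OpenPartialHomeomorph.univBall_target _ hε]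
    simp
  have hφ : ∀ p, φ p = (OpenPartialHomeomorph.univBall 0 ε).symm (g (ψ p)) := fun p => by
    rw [hφdef]; rfl
  refine ⟨φ, ?_, ?_, (hsrc x).2 ⟨hx, ?_⟩, ?_, fun p hp => ?_, fun f α hα hf p hp => ?_⟩
  · rw [hφdef]
    exact univBall_symm_mem_maximalAtlas (linearChange_mem_maximalAtlas hψ g) 0 hε
  · rw [hφdef]
    exact univBall_target_eq_univ hε htarget
  · rw [hx0, map_zero]; exact Metric.mem_ball_self hε
  · rw [hφ, hx0, map_zero]
    exact OpenPartialHomeomorph.univBall_symm_apply_center _ _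
  · obtain ⟨hpψ, hpb⟩ := (hsrc p).1 hp
    have := (hball _ hpb).2
    rw [g.symm_apply_apply] at this
    exact ⟨hpψ, this⟩
  · obtain ⟨hpψ, hpb⟩ := (hsrc p).1 hp
    have h0 := (hball _ hpb).2
    rw [g.symm_apply_apply] at h0
    have h1 := hf _ h0
    rw [ψ.left_inv hpψ] at h1
    have h2 : g (diagMap b α (ψ p)) ∈ Metric.ball 0 ε := by
      rw [hgd, mem_ball_zero_iff, norm_euclideanDiag hα]
      exact mem_ball_zero_iff.1 hpb
    have h3 : diagMap b α (ψ p) ∈ ψ.target := by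
      have := (hball _ h2).1
      rwa [g.symm_apply_apply] at this
    have h4 : ψ (f p) = diagMap b α (ψ p) := by rw [h1, ψ.right_inv h3]
    refine ⟨(hsrc _).2 ⟨h1 ▸ ψ.map_target h3, h4.symm ▸ h2⟩, ?_⟩
    rw [hφ, hφ, h4, hgd, univBall_symm_euclideanDiag hε hα hpb]

/-- First a is made linear with c held fixed, then c with the new a held fixed, the roles being
exchanged by `commutator_swap`. The commutator is then trivial near x and its isotopy can be made
relative to a neighbourhood. -/
theorem exists_standardized_of_isRealized [T2Space X] [IsManifold (𝓡 n) ∞ X] (hn : 0 < n)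
    (hco : o.CoherentChart ψ)
    (hψ : ψ ∈ IsManifold.maximalAtlas (𝓡 n) ∞ X) (hx : x ∈ ψ.source) (hx0 : ψ x = 0)
    (b : Module.Basis (Fin n) ℝ (EuclideanSpace ℝ (Fin n)))
    (h : IsRealized o ψ x (diagMap b signK) (diagMap b signI)) :
    ∃ (a c : X ≃ₘ⟮𝓡 n, 𝓡 n⟯ X) (φ : OpenPartialHomeomorph X (EuclideanSpace ℝ (Fin n))),
      IsStandardizedPair o a c φ x := by
  have hAC := h.commute hψ hx
  obtain ⟨a₀, c₀, ha₀, hc₀, ha₀x, hc₀x, hA, hC, hi₀⟩ := h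
  obtain ⟨a, ha, hax, haA, hi₁⟩ := exists_linearized hn hco hψ hx hx0 ha₀ ha₀x hc₀x hi₀
  obtain ⟨c, hc, hcx, hcC, hi₂⟩ := exists_linearized hn hco hψ hx hx0 hc₀ hc₀x hax
    (hi₁.commutator_swap hψ hx)
  have hi := hi₂.commutator_swap hψ hx
  rw [hA] at haA
  rw [hC] at hcC
  obtain ⟨β, hβ, ρ, hρ, hβρ⟩ := hi.exists_isotopy_rel hn hco hψ hx hx0
    (IsLinearNear.diffCommutator haA hcC (diagMap_mul_self b signK_mul_self)
      (diagMap_mul_self b signI_mul_self) hAC)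
  obtain ⟨φ, hφ, htarget, hxφ, hφx, hs, hlocal⟩ := exists_ellipsoid_chart hψ hx hx0 b
    (Filter.inter_mem (Metric.ball_mem_nhds _ hρ) (haA.and hcC))
  refine ⟨a, c, φ, ha, hc, hφ, htarget, hxφ, hφx, ?_, ?_, β, hβ, fun t _ p hp =>
    hβρ t p (hs p hp).1 (mem_ball_zero_iff.1 (hs p hp).2.1)⟩
  · rw [rotK_eq]
    exact hlocal a signK signK_mul_self fun v hv => hv.2.1
  · rw [rotI_eq]
    exact hlocal c signI signI_mul_self fun v hv => hv.2.2

end Standardize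

/-! ### Standardizing admissible pairs -/

section LinearChange

variable {n : ℕ} {X : Type*} [TopologicalSpace X] [ChartedSpace (EuclideanSpace ℝ (Fin n)) X]
  {Y : Type*} [TopologicalSpace Y] [ChartedSpace (EuclideanSpace ℝ (Fin n)) Y]
  {e : OpenPartialHomeomorph X (EuclideanSpace ℝ (Fin n))}
  {e' : OpenPartialHomeomorph Y (EuclideanSpace ℝ (Fin n))}

theorem coordDeriv_linearChange_right
    (g : EuclideanSpace ℝ (Fin n) ≃L[ℝ] EuclideanSpace ℝ (Fin n)) (f : X → Y) (p : X) :
    coordDeriv e (e'.trans (linearChange g)) f p =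
      (g : EuclideanSpace ℝ (Fin n) →L[ℝ] EuclideanSpace ℝ (Fin n)).comp (coordDeriv e e' f p) :=
  g.comp_fderiv (f := e' ∘ f ∘ e.symm) (x := e p)

theorem coordDeriv_linearChange_left
    (g : EuclideanSpace ℝ (Fin n) ≃L[ℝ] EuclideanSpace ℝ (Fin n)) (f : X → Y) (p : X) :
    coordDeriv (e.trans (linearChange g)) e' f p = (coordDeriv e e' f p).comp
      (g.symm : EuclideanSpace ℝ (Fin n) →L[ℝ] EuclideanSpace ℝ (Fin n)) := by
  have h := g.symm.comp_right_fderiv (f := e' ∘ f ∘ e.symm) (x := g (e p))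
  rw [g.symm_apply_apply] at h
  exact h

/-- The diagonal entries of the reflection in the first coordinate. -/
def signReflection (j : Fin n) : ℝ := if j.val = 0 then -1 else 1

theorem signReflection_mul_self (j : Fin n) : signReflection j * signReflection j = 1 := by
  unfold signReflection; split_ifs <;> norm_num

/-- The reflection in the first coordinate. -/
noncomputable def coordReflection (n : ℕ) :
    EuclideanSpace ℝ (Fin n) ≃L[ℝ] EuclideanSpace ℝ (Fin n) :=
  ContinuousLinearEquiv.equivOfInverse (euclideanDiag signReflection) (euclideanDiag signReflection)
    (euclideanDiag_euclideanDiag signReflection_mul_self)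
    (euclideanDiag_euclideanDiag signReflection_mul_self)

theorem coordReflection_euclideanDiag (α : Fin n → ℝ) (v : EuclideanSpace ℝ (Fin n)) :
    coordReflection n (euclideanDiag α v) = euclideanDiag α (coordReflection n v) :=
  euclideanDiag_comm _ _ _

theorem coe_coordReflection : (coordReflection n : EuclideanSpace ℝ (Fin n) →L[ℝ]
    EuclideanSpace ℝ (Fin n)) = euclideanDiag signReflection := rfl

theorem coe_coordReflection_symm : ((coordReflection n).symm : EuclideanSpace ℝ (Fin n) →L[ℝ]
    EuclideanSpace ℝ (Fin n)) = euclideanDiag signReflection := rfl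

theorem det_signReflection (hn : 0 < n) :
    (euclideanDiag (signReflection : Fin n → ℝ)).det = -1 := by
  rw [det_euclideanDiag, Finset.prod_eq_single (⟨0, hn⟩ : Fin n)]
  · simp [signReflection]
  · intro j _ hj
    have : j.val ≠ 0 := fun h => hj (Fin.ext h)
    simp [signReflection, this]
  · simp

theorem det_coordDeriv_reflection_right (hn : 0 < n) (f : X → Y) (p : X) :
    (coordDeriv e (e'.trans (linearChange (coordReflection n))) f p).det =
      -(coordDeriv e e' f p).det := by
  rw [coordDeriv_linearChange_right, coe_coordReflection]
  refine (LinearMap.det_comp _ _).trans ?_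
  rw [show LinearMap.det (euclideanDiag (signReflection : Fin n → ℝ)).toLinearMap = -1 from
    det_signReflection hn, neg_one_mul]

theorem det_coordDeriv_reflection_left (hn : 0 < n) (f : X → Y) (p : X) :
    (coordDeriv (e.trans (linearChange (coordReflection n))) e' f p).det =
      -(coordDeriv e e' f p).det := by
  rw [coordDeriv_linearChange_left, coe_coordReflection_symm]
  refine (LinearMap.det_comp _ _).trans ?_
  rw [show LinearMap.det (euclideanDiag (signReflection : Fin n → ℝ)).toLinearMap = -1 from
    det_signReflection hn, mul_neg_one]

end LinearChange

/-! ### From admissible to standardized pairs, with charts of either sign. -/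

section Standardize

variable {n : ℕ} {X : Type*} [TopologicalSpace X] [ChartedSpace (EuclideanSpace ℝ (Fin n)) X]
  [IsManifold (𝓡 n) ∞ X] {o : ManifoldOrientation n X} {x : X}

/-- Admissibility controls the isotopy on [0, 1] only; precomposing with the smooth transition makes
it smooth for all times with the same ends. -/
theorem IsAdmissiblePair.isotopicToIdAt {a c : X ≃ₘ⟮𝓡 n, 𝓡 n⟯ X} (h : IsAdmissiblePair o a c x)
    {ψ : OpenPartialHomeomorph X (EuclideanSpace ℝ (Fin n))}
    (hψ : ψ ∈ IsManifold.maximalAtlas (𝓡 n) ∞ X) (hx : x ∈ ψ.source) :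
    IsotopicToIdAt ψ x (diffCommutator a c) := by
  obtain ⟨b, ⟨hb, hb0, hb1⟩, hbx⟩ := h.isotopy
  have hσ : ∀ t, Real.smoothTransition t ∈ Icc (0 : ℝ) 1 := fun t =>
    ⟨Real.smoothTransition.nonneg t, Real.smoothTransition.le_one t⟩
  refine ⟨fun t => b (Real.smoothTransition t), ?_, by simp [hb0], by simp [hb1], fun t => ?_⟩
  · rw [← contMDiffOn_univ]
    exact hb.comp (f := fun q : ℝ × X => (Real.smoothTransition q.1, q.2))
      ((Real.smoothTransition.contDiff.contMDiff.comp contMDiff_fst).prodMk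
        contMDiff_snd).contMDiffOn fun q _ => ⟨hσ _, mem_univ _⟩
  · obtain ⟨h1, h2⟩ := hbx _ (hσ t)
    exact ⟨h1, (fixedPointDifferential_eq_id_iff hψ hx (b _).contMDiff.contMDiffAt h1).1 h2⟩

theorem IsAdmissiblePair.exists_standardized [T2Space X] {a c : X ≃ₘ⟮𝓡 n, 𝓡 n⟯ X}
    (h : IsAdmissiblePair o a c x) :
    0 < n ∧ ∃ (a' c' : X ≃ₘ⟮𝓡 n, 𝓡 n⟯ X) (φ : OpenPartialHomeomorph X (EuclideanSpace ℝ (Fin n))),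
      IsStandardizedPair o a' c' φ x := by
  obtain ⟨ψ, hψ, hx, hx0, hco⟩ := exists_centered_chart o x
  obtain ⟨L, hL⟩ := exists_conj_fixedPointDifferential hψ hx
  have hodd : Odd (Module.finrank ℝ (commonNegativeSubspace (coordDeriv ψ ψ a x).toLinearMap
      (coordDeriv ψ ψ c x).toLinearMap)) := by
    rw [← finrank_commonNegativeSubspace_conj L, ← hL _ a.contMDiff.contMDiffAt h.fixed_a,
      ← hL _ c.contMDiff.contMDiffAt h.fixed_c]
    exact h.odd_finrank
  -- An odd-dimensional subspace is nonzero.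
  have hn : 0 < n := by
    have := hodd.pos.trans_le (Submodule.finrank_le _)
    rwa [finrank_euclideanSpace_fin] at this
  have unit : ∀ {f : X ≃ₘ⟮𝓡 n, 𝓡 n⟯ X}, f x = x → IsUnit (coordDeriv ψ ψ f x) := fun {f} hf =>
    ⟨⟨_, _, coordDeriv_mul_symm hψ hx hf, coordDeriv_symm_mul hψ hx hf⟩, rfl⟩
  have hP : IsDeformable (IsRealized o ψ x) :=
    { swap := IsRealized.swap hψ hx
      commute := IsRealized.commute hψ hx
      det_pos := IsRealized.det_pos hψ hx
      of_path := IsRealized.of_path hn hco hψ hx hx0 }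
  obtain ⟨b, -, hb⟩ := hP.exists_normal_form finrank_euclideanSpace_fin
    ⟨a, c, h.preserves_a, h.preserves_c, h.fixed_a, h.fixed_c, rfl, rfl,
      h.isotopicToIdAt hψ hx⟩ (unit h.fixed_a) (unit h.fixed_c) hodd
  exact ⟨hn, exists_standardized_of_isRealized hn hco hψ hx hx0 b hb⟩

theorem IsStandardizedPair.coherentChart {a c : X ≃ₘ⟮𝓡 n, 𝓡 n⟯ X}
    {φ : OpenPartialHomeomorph X (EuclideanSpace ℝ (Fin n))} (h : IsStandardizedPair o a c φ x) :
    o.CoherentChart φ :=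
  ManifoldOrientation.coherentChart_of_isPreconnected h.smooth_chart
    (isPreconnected_source_of_target_eq_univ h.target_chart)

/-- The reflection is diagonal and hence commutes with both model maps; this makes the sign of the
chart a free choice. -/
theorem IsStandardizedPair.reflect {a c : X ≃ₘ⟮𝓡 n, 𝓡 n⟯ X}
    {φ : OpenPartialHomeomorph X (EuclideanSpace ℝ (Fin n))} (h : IsStandardizedPair o a c φ x) :
    IsStandardizedPair o a c (φ.trans (linearChange (coordReflection n))) x := by
  have hsrc : (φ.trans (linearChange (coordReflection n))).source = φ.source := by simp
  refine ⟨h.preserves_a, h.preserves_c, linearChange_mem_maximalAtlas h.smooth_chart _, ?_,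
    hsrc ▸ h.mem_source, ?_, fun p hp => ?_, fun p hp => ?_, hsrc ▸ h.isotopy⟩
  · simp [h.target_chart]
  · change coordReflection n (φ x) = 0
    rw [h.map_center, map_zero]
  · rw [hsrc] at hp ⊢
    refine ⟨(h.local_a p hp).1, ?_⟩
    change coordReflection n (φ (a p)) = rotK n (coordReflection n (φ p))
    rw [(h.local_a p hp).2, rotK_eq]
    exact coordReflection_euclideanDiag _ _
  · rw [hsrc] at hp ⊢
    refine ⟨(h.local_c p hp).1, ?_⟩
    change coordReflection n (φ (c p)) = rotI n (coordReflection n (φ p))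
    rw [(h.local_c p hp).2, rotI_eq]
    exact coordReflection_euclideanDiag _ _

theorem positiveChart_reflect (hn : 0 < n) {φ : OpenPartialHomeomorph X (EuclideanSpace ℝ (Fin n))}
    (h : o.NegativeChart φ) :
    o.PositiveChart (φ.trans (linearChange (coordReflection n))) := fun e he p hp hp' => by
  have := det_coordDeriv_reflection_right (e := e) (e' := φ) hn id p
  refine (neg_pos.2 (h e he p hp (by simpa using hp'))).trans_eq this.symm

theorem negativeChart_reflect (hn : 0 < n) {φ : OpenPartialHomeomorph X (EuclideanSpace ℝ (Fin n))}
    (h : o.PositiveChart φ) :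
    o.NegativeChart (φ.trans (linearChange (coordReflection n))) := fun e he p hp hp' => by
  have := det_coordDeriv_reflection_right (e := e) (e' := φ) hn id p
  refine this.trans_lt (neg_lt_zero.2 (h e he p hp (by simpa using hp')))

theorem IsAdmissiblePair.exists_standardized_positive [T2Space X] {a c : X ≃ₘ⟮𝓡 n, 𝓡 n⟯ X}
    (h : IsAdmissiblePair o a c x) :
    ∃ (a' c' : X ≃ₘ⟮𝓡 n, 𝓡 n⟯ X) (φ : OpenPartialHomeomorph X (EuclideanSpace ℝ (Fin n))),
      IsStandardizedPair o a' c' φ x ∧ o.PositiveChart φ := by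
  obtain ⟨hn, a', c', φ, hs⟩ := h.exists_standardized
  rcases hs.coherentChart.positive_or_negative with h1 | h1
  · exact ⟨a', c', φ, hs, h1⟩
  · exact ⟨a', c', _, hs.reflect, positiveChart_reflect hn h1⟩

theorem IsAdmissiblePair.exists_standardized_negative [T2Space X] {a c : X ≃ₘ⟮𝓡 n, 𝓡 n⟯ X}
    (h : IsAdmissiblePair o a c x) :
    ∃ (a' c' : X ≃ₘ⟮𝓡 n, 𝓡 n⟯ X) (φ : OpenPartialHomeomorph X (EuclideanSpace ℝ (Fin n))),
      IsStandardizedPair o a' c' φ x ∧ o.NegativeChart φ := by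
  obtain ⟨hn, a', c', φ, hs⟩ := h.exists_standardized
  rcases hs.coherentChart.positive_or_negative with h1 | h1
  · exact ⟨a', c', _, hs.reflect, negativeChart_reflect hn h1⟩
  · exact ⟨a', c', φ, hs, h1⟩

end Standardize

/-! ### The smooth structure of a glued space -/

section OpenPiece

variable {X : Type*} [TopologicalSpace X] {G : Type*} [TopologicalSpace G] {U : Opens X} {ι : U → G}

/-- An open embedding of an open subset `U` of `X`, as an open partial homeomorphism on `X`. -/
noncomputable def openPiece (hι : IsOpenEmbedding ι) (hU : Nonempty U) :
    OpenPartialHomeomorph X G :=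
  (U.openPartialHomeomorphSubtypeCoe hU).symm.trans (hι.toOpenPartialHomeomorph ι)

variable (hι : IsOpenEmbedding ι) (hU : Nonempty U)

theorem openPiece_source : (openPiece hι hU).source = U := by
  simp [openPiece]

theorem openPiece_target : (openPiece hι hU).target = range ι := by
  simp [openPiece]

theorem openPiece_apply (p : U) : openPiece hι hU p = ι p := by
  have h : (U.openPartialHomeomorphSubtypeCoe hU).symm p = p :=
    (U.openPartialHomeomorphSubtypeCoe hU).left_inv (mem_univ p)
  change ι ((U.openPartialHomeomorphSubtypeCoe hU).symm p) = ι p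
  rw [h]

theorem openPiece_symm_apply (p : U) : (openPiece hι hU).symm (ι p) = p := by
  rw [← openPiece_apply hι hU]
  exact (openPiece hι hU).left_inv (by rw [openPiece_source]; exact p.2)

theorem mem_atlas_opens {H : Type*} [TopologicalSpace H] [ChartedSpace H X]
    {e : OpenPartialHomeomorph U H} (he : e ∈ atlas H U) :
    ∃ e₀ ∈ atlas H X, (∀ q : U, q ∈ e.source ↔ (q : X) ∈ e₀.source) ∧ (∀ q : U, e q = e₀ q) ∧
      ∀ v ∈ e.target, v ∈ e₀.target ∧ (e.symm v : X) = e₀.symm v := by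
  obtain ⟨x, hx⟩ := mem_iUnion.1 he
  obtain rfl := mem_singleton_iff.1 hx
  refine ⟨chartAt H x.1, chart_mem_atlas H _, fun q => ?_, fun q => rfl, fun v hv => ⟨?_, ?_⟩⟩
  · rw [OpenPartialHomeomorph.subtypeRestr_source]; rfl
  · exact OpenPartialHomeomorph.subtypeRestr_target_subset _ _ hv
  · exact OpenPartialHomeomorph.subtypeRestr_symm_apply _ _ hv

end OpenPiece

section Smooth

variable {n : ℕ} {X : Type*} [TopologicalSpace X] [ChartedSpace (EuclideanSpace ℝ (Fin n)) X]
  [IsManifold (𝓡 n) ∞ X] {Y : Type*} [TopologicalSpace Y]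
  [ChartedSpace (EuclideanSpace ℝ (Fin n)) Y] [IsManifold (𝓡 n) ∞ Y]
  {G : Type*} [TopologicalSpace G] {U : Opens X} {V : Opens Y} {ι : U → G} {κ : V → G}

/-- Charts carried over from two open pieces are compatible if the transition function between the
pieces is smooth. -/
theorem contDiffOn_lift_trans (hι : IsOpenEmbedding ι) (hκ : IsOpenEmbedding κ)
    {e : OpenPartialHomeomorph U (EuclideanSpace ℝ (Fin n))}
    {e' : OpenPartialHomeomorph V (EuclideanSpace ℝ (Fin n))}
    (he : e ∈ atlas (EuclideanSpace ℝ (Fin n)) U) (he' : e' ∈ atlas (EuclideanSpace ℝ (Fin n)) V)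
    {τ : X → Y} (hτ : ∀ p q, ι p = κ q → ContMDiffAt (𝓡 n) (𝓡 n) ∞ τ p ∧ τ p = q) :
    ContDiffOn ℝ ∞ ((e.lift_openEmbedding hι).symm ≫ₕ e'.lift_openEmbedding hκ)
      ((e.lift_openEmbedding hι).symm ≫ₕ e'.lift_openEmbedding hκ).source := by
  obtain ⟨e₀, he₀, hes, hee, het⟩ := mem_atlas_opens he
  obtain ⟨e₀', he₀', hes', hee', het'⟩ := mem_atlas_opens he'
  have key : ∀ v ∈ ((e.lift_openEmbedding hι).symm ≫ₕ e'.lift_openEmbedding hκ).source,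
      v ∈ e.target ∧ ∃ q ∈ e'.source, ι (e.symm v) = κ q := fun v hv => by
    rw [OpenPartialHomeomorph.trans_source] at hv
    obtain ⟨q, hq, hqv⟩ := hv.2
    exact ⟨hv.1, q, hq, hqv.symm⟩
  intro v hv
  have hsm : ContMDiffAt (𝓡 n) (𝓡 n) ∞ (e₀' ∘ τ ∘ e₀.symm) v := by
    obtain ⟨hvt, q, hq, hqv⟩ := key v hv
    obtain ⟨h1, h2⟩ := hτ _ _ hqv
    rw [(het v hvt).2] at h1 h2
    have h3 : ContMDiffAt (𝓡 n) (𝓡 n) ∞ e₀' (τ (e₀.symm v)) := by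
      rw [h2]
      exact contMDiffAt_of_mem_maximalAtlas (IsManifold.subset_maximalAtlas he₀') ((hes' q).1 hq)
    exact h3.comp v (f := τ ∘ e₀.symm) (h1.comp v (contMDiffAt_symm_of_mem_maximalAtlas
      (IsManifold.subset_maximalAtlas he₀) (het v hvt).1))
  refine (contMDiffAt_iff_contDiffAt.1 hsm).contDiffWithinAt.congr_of_mem (fun w hw => ?_) hv
  obtain ⟨hwt, q, hq, hqw⟩ := key w hw
  change e'.lift_openEmbedding hκ (ι (e.symm w)) = e₀' (τ (e₀.symm w))
  rw [hqw, OpenPartialHomeomorph.lift_openEmbedding_apply, hee', ← (het w hwt).2, (hτ _ _ hqw).2]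

/-- In a chart of X and its transport to G, the inclusion is the identity. -/
theorem contMDiffOn_openPiece [ChartedSpace (EuclideanSpace ℝ (Fin n)) G] [IsManifold (𝓡 n) ∞ G]
    (hι : IsOpenEmbedding ι) (hU : Nonempty U)
    (H : ∀ e ∈ atlas (EuclideanSpace ℝ (Fin n)) U,
      e.lift_openEmbedding hι ∈ atlas (EuclideanSpace ℝ (Fin n)) G) :
    ContMDiffOn (𝓡 n) (𝓡 n) ∞ (openPiece hι hU) (openPiece hι hU).source ∧
      ContMDiffOn (𝓡 n) (𝓡 n) ∞ (openPiece hι hU).symm (openPiece hι hU).target := by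
  have hex : ∀ p : U, ∃ (E : OpenPartialHomeomorph G (EuclideanSpace ℝ (Fin n)))
      (e₀ : OpenPartialHomeomorph X (EuclideanSpace ℝ (Fin n))),
      E ∈ IsManifold.maximalAtlas (𝓡 n) ∞ G ∧ e₀ ∈ IsManifold.maximalAtlas (𝓡 n) ∞ X ∧
      ι p ∈ E.source ∧ (p : X) ∈ e₀.source ∧ ∀ q : U, E (ι q) = e₀ q := fun p => by
    obtain ⟨e₀, he₀, hes, hee, -⟩ := mem_atlas_opens (chart_mem_atlas (EuclideanSpace ℝ (Fin n)) p)
    exact ⟨_, e₀, IsManifold.subset_maximalAtlas (H _ (chart_mem_atlas _ p)),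
      IsManifold.subset_maximalAtlas he₀, ⟨p, mem_chart_source _ p, rfl⟩,
      (hes p).1 (mem_chart_source _ p), fun q =>
        (OpenPartialHomeomorph.lift_openEmbedding_apply _ _).trans (hee q)⟩
  constructor
  · rw [openPiece_source]
    intro p hp
    obtain ⟨E, e₀, hE, he₀, hpE, hpe, heq⟩ := hex ⟨p, hp⟩
    have h1 : ContMDiffAt (𝓡 n) (𝓡 n) ∞ (E.symm ∘ e₀) p := by
      refine ContMDiffAt.comp p (g := E.symm) ?_ (contMDiffAt_of_mem_maximalAtlas he₀ hpe)
      refine contMDiffAt_symm_of_mem_maximalAtlas hE ?_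
      rw [← heq ⟨p, hp⟩]
      exact E.map_source hpE
    refine (h1.congr_of_eventuallyEq ?_).contMDiffWithinAt
    have hc : ContinuousAt (openPiece hι hU) p :=
      (openPiece hι hU).continuousAt (by rwa [openPiece_source])
    filter_upwards [U.isOpen.mem_nhds hp, hc.eventually_mem (E.open_source.mem_nhds
      (by rwa [openPiece_apply hι hU ⟨p, hp⟩]))] with q hq hqE
    have := openPiece_apply hι hU ⟨q, hq⟩
    dsimp only at this
    rw [this] at hqE ⊢
    change _ = E.symm (e₀ q)
    rw [← heq ⟨q, hq⟩, E.left_inv hqE]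
  · rw [openPiece_target]
    rintro _ ⟨p, rfl⟩
    obtain ⟨E, e₀, hE, he₀, hpE, hpe, heq⟩ := hex p
    have h1 : ContMDiffAt (𝓡 n) (𝓡 n) ∞ (e₀.symm ∘ E) (ι p) := by
      refine ContMDiffAt.comp (ι p) (g := e₀.symm) ?_ (contMDiffAt_of_mem_maximalAtlas hE hpE)
      refine contMDiffAt_symm_of_mem_maximalAtlas he₀ ?_
      rw [heq]
      exact e₀.map_source hpe
    refine (h1.congr_of_eventuallyEq ?_).contMDiffWithinAt
    have h2 : ∀ᶠ q : U in 𝓝 p, (q : X) ∈ e₀.source :=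
      continuous_subtype_val.continuousAt.eventually_mem (e₀.open_source.mem_nhds hpe)
    rw [EventuallyEq, ← hι.map_nhds_eq, eventually_map]
    filter_upwards [h2] with q hq
    rw [openPiece_symm_apply]
    change _ = e₀.symm (E (ι q))
    rw [heq, e₀.left_inv hq]

theorem Glue.isManifold {g : OpenPartialHomeomorph X Y}
    (hg : ContMDiffOn (𝓡 n) (𝓡 n) ∞ g g.source)
    (hg' : ContMDiffOn (𝓡 n) (𝓡 n) ∞ g.symm g.target) : IsManifold (𝓡 n) ∞ (Glue U V g) := by
  refine isManifold_of_contDiffOn _ _ _ fun E E' hE hE' => ?_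
  suffices h : ContDiffOn ℝ ∞ (E.symm ≫ₕ E') (E.symm ≫ₕ E').source by simpa using h
  rcases hE with ⟨e, he, rfl⟩ | ⟨e, he, rfl⟩ <;> rcases hE' with ⟨e', he', rfl⟩ | ⟨e', he', rfl⟩
  · exact contDiffOn_lift_trans _ _ he he' (τ := id) fun p q h =>
      ⟨contMDiffAt_id, congrArg Subtype.val (Glue.inl_eq_inl.1 h)⟩
  · exact contDiffOn_lift_trans _ _ he he' (τ := g) fun p q h =>
      ⟨hg.contMDiffAt (g.open_source.mem_nhds (Glue.inl_eq_inr.1 h).1), (Glue.inl_eq_inr.1 h).2⟩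
  · refine contDiffOn_lift_trans _ _ he he' (τ := g.symm) fun p q h => ?_
    obtain ⟨h1, h2⟩ := Glue.inl_eq_inr.1 h.symm
    rw [← h2]
    exact ⟨hg'.contMDiffAt (g.open_target.mem_nhds (g.map_source h1)), g.left_inv h1⟩
  · exact contDiffOn_lift_trans _ _ he he' (τ := id) fun p q h =>
      ⟨contMDiffAt_id, congrArg Subtype.val (Glue.inr_eq_inr.1 h)⟩

end Smooth

/-! ### The topology and the smooth structure of a connected sum -/

section Inversion

variable {n : ℕ}

theorem contDiffOn_sphereInversion :
    ContDiffOn ℝ ∞ (sphereInversion n) (sphereInversion n).source := fun v hv => by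
  have hv' : v ≠ 0 := hv
  have h : ContDiffAt ℝ ∞ (fun v : EuclideanSpace ℝ (Fin n) => (‖v‖ ^ 2)⁻¹ • v) v :=
    ((contDiff_norm_sq ℝ).contDiffAt.inv (pow_ne_zero 2 (norm_ne_zero_iff.2 hv'))).smul contDiffAt_id
  exact h.contDiffWithinAt

theorem norm_sphereInversion (v : EuclideanSpace ℝ (Fin n)) : ‖(‖v‖ ^ 2)⁻¹ • v‖ = ‖v‖⁻¹ := by
  rcases eq_or_ne v 0 with rfl | hv
  · simp
  · have : ‖v‖ ≠ 0 := norm_ne_zero_iff.2 hv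
    rw [norm_smul, norm_inv, norm_pow, norm_norm]
    field_simp

end Inversion

namespace ConnectedSum

section Topology

variable {n : ℕ} {X₁ : Type*} {X₂ : Type*} [TopologicalSpace X₁] [TopologicalSpace X₂]
  [T2Space X₁] [T2Space X₂] {φ : OpenPartialHomeomorph X₁ (EuclideanSpace ℝ (Fin n))}
  {φ₁ : OpenPartialHomeomorph X₁ (EuclideanSpace ℝ (Fin n))}
  {φ₂ : OpenPartialHomeomorph X₂ (EuclideanSpace ℝ (Fin n))}

theorem chart_ne_zero (p : puncture φ) (hp : (p : X₁) ∈ φ.source) : φ p ≠ 0 := fun h =>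
  p.2 (by rw [mem_singleton_iff, ← h, φ.left_inv hp])

theorem symm_mem_puncture (h : φ.target = univ) {v : EuclideanSpace ℝ (Fin n)} (hv : v ≠ 0) :
    φ.symm v ∈ puncture φ := fun h' => hv (by
  rw [mem_singleton_iff] at h'
  exact φ.symm.injOn (by simp [h]) (by simp [h]) h')

theorem symm_mem_source (h : φ.target = univ) (v : EuclideanSpace ℝ (Fin n)) :
    φ.symm v ∈ φ.source := φ.map_target (by simp [h])

theorem apply_symm (h : φ.target = univ) (v : EuclideanSpace ℝ (Fin n)) : φ (φ.symm v) = v :=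
  φ.right_inv (by simp [h])

theorem nonempty_puncture (hn : 0 < n) (h : φ.target = univ) : Nonempty (puncture φ) :=
  ⟨⟨_, symm_mem_puncture h (v := EuclideanSpace.single ⟨0, hn⟩ 1) (by simp)⟩⟩

/-- The transition map of a connected sum. -/
noncomputable abbrev transition (φ₁ : OpenPartialHomeomorph X₁ (EuclideanSpace ℝ (Fin n)))
    (φ₂ : OpenPartialHomeomorph X₂ (EuclideanSpace ℝ (Fin n))) : OpenPartialHomeomorph X₁ X₂ :=
  (φ₁.trans (sphereInversion n)).trans φ₂.symm

theorem transition_apply (p : X₁) : transition φ₁ φ₂ p = φ₂.symm ((‖φ₁ p‖ ^ 2)⁻¹ • φ₁ p) := rfl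

theorem mem_transition_source (h₂ : φ₂.target = univ) {p : X₁} :
    p ∈ (transition φ₁ φ₂).source ↔ p ∈ φ₁.source ∧ φ₁ p ≠ 0 := by
  simp only [OpenPartialHomeomorph.trans_source, OpenPartialHomeomorph.symm_source, h₂,
    preimage_univ, inter_univ]
  exact Iff.rfl

theorem inl_eq_inr_iff (h₂ : φ₂.target = univ) {p : puncture φ₁} {q : puncture φ₂} :
    inl φ₁ φ₂ p = inr φ₁ φ₂ q ↔ (p : X₁) ∈ φ₁.source ∧ (q : X₂) ∈ φ₂.source ∧
      φ₂ q = (‖φ₁ p‖ ^ 2)⁻¹ • φ₁ p := by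
  refine Glue.inl_eq_inr.trans ?_
  rw [mem_transition_source h₂, transition_apply]
  constructor
  · rintro ⟨⟨hp, -⟩, h⟩
    rw [← h]
    exact ⟨hp, symm_mem_source h₂ _, apply_symm h₂ _⟩
  · rintro ⟨hp, hq, h⟩
    rw [← h, φ₂.left_inv hq]
    exact ⟨⟨hp, chart_ne_zero p hp⟩, rfl⟩

theorem exists_inl_eq_inr (h₂ : φ₂.target = univ) {p : puncture φ₁} (hp : (p : X₁) ∈ φ₁.source) :
    ∃ q, inl φ₁ φ₂ p = inr φ₁ φ₂ q :=
  ⟨⟨_, symm_mem_puncture h₂ (mapsTo_sphereInversion_aux (chart_ne_zero p hp))⟩,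
    (inl_eq_inr_iff h₂).2 ⟨hp, symm_mem_source h₂ _, apply_symm h₂ _⟩⟩

theorem exists_inr_eq_inl (h₁ : φ₁.target = univ) (h₂ : φ₂.target = univ) {q : puncture φ₂}
    (hq : (q : X₂) ∈ φ₂.source) : ∃ p, inl φ₁ φ₂ p = inr φ₁ φ₂ q :=
  ⟨⟨_, symm_mem_puncture h₁ (mapsTo_sphereInversion_aux (chart_ne_zero q hq))⟩,
    (inl_eq_inr_iff h₂).2 ⟨symm_mem_source h₁ _, hq, by
      dsimp only
      rw [apply_symm h₁, sphereInversion_aux (chart_ne_zero q hq)]⟩⟩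

theorem isOpenEmbedding_inl : IsOpenEmbedding (inl φ₁ φ₂) := Glue.isOpenEmbedding_inl

theorem isOpenEmbedding_inr : IsOpenEmbedding (inr φ₁ φ₂) := Glue.isOpenEmbedding_inr

theorem exists_rep (z : ConnectedSum φ₁ φ₂) :
    (∃ p, inl φ₁ φ₂ p = z) ∨ (∃ q, inr φ₁ φ₂ q = z) := Glue.exists_rep z

theorem disjoint_nhds_of_isOpenEmbedding {Y G : Type*} [TopologicalSpace Y] [T2Space Y]
    [TopologicalSpace G] {ι : Y → G} (hι : IsOpenEmbedding ι) {p q : Y} (h : ι p ≠ ι q) :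
    Disjoint (𝓝 (ι p)) (𝓝 (ι q)) := by
  rw [← hι.map_nhds_eq, ← hι.map_nhds_eq, disjoint_map hι.injective]
  exact disjoint_nhds_nhds.2 fun h' => h (congrArg ι h')

theorem isCompact_symm_image (h : φ.target = univ) {K : Set (EuclideanSpace ℝ (Fin n))}
    (hK : IsCompact K) : IsCompact (φ.symm '' K) :=
  hK.image_of_continuousOn (φ.continuousOn_symm.mono (by simp [h]))

/-- The inversion exchanges ‖v‖ > 1/ε with ‖v‖ < ε. A point p outside the chart domain avoids the
compact ball of radius 1/ε for every ε, while q avoids the ball of radius ε for some ε; the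
complements of these balls do not meet in the glued space. -/
theorem disjoint_nhds_inl_inr (h₁ : φ₁.target = univ) (h₂ : φ₂.target = univ) {p : puncture φ₁}
    {q : puncture φ₂} (hp : (p : X₁) ∉ φ₁.source) :
    Disjoint (𝓝 (inl φ₁ φ₂ p)) (𝓝 (inr φ₁ φ₂ q)) := by
  obtain ⟨ε, hε, hq⟩ : ∃ ε > 0, (q : X₂) ∉ φ₂.symm '' Metric.closedBall 0 ε := by
    by_cases hq : (q : X₂) ∈ φ₂.source
    · have := norm_pos_iff.2 (chart_ne_zero q hq)
      refine ⟨‖φ₂ q‖ / 2, half_pos this, ?_⟩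
      rintro ⟨v, hv, hvq⟩
      rw [mem_closedBall_zero_iff, ← hvq, apply_symm h₂] at hv
      rw [← hvq, apply_symm h₂] at this
      linarith
    · refine ⟨1, one_pos, ?_⟩
      rintro ⟨v, -, hvq⟩
      exact hq (hvq ▸ symm_mem_source h₂ v)
  have hK₁ := isCompact_symm_image h₁ (isCompact_closedBall (0 : EuclideanSpace ℝ (Fin n)) ε⁻¹)
  have hK₂ := isCompact_symm_image h₂ (isCompact_closedBall (0 : EuclideanSpace ℝ (Fin n)) ε)
  have hp' : (p : X₁) ∉ φ₁.symm '' Metric.closedBall 0 ε⁻¹ := by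
    rintro ⟨v, -, hvp⟩
    exact hp (hvp ▸ symm_mem_source h₁ v)
  refine Filter.disjoint_iff.2 ⟨_,
    isOpenEmbedding_inl.isOpenMap.image_mem_nhds (continuous_subtype_val.continuousAt.preimage_mem_nhds
      (hK₁.isClosed.isOpen_compl.mem_nhds hp')), _,
    isOpenEmbedding_inr.isOpenMap.image_mem_nhds (continuous_subtype_val.continuousAt.preimage_mem_nhds
      (hK₂.isClosed.isOpen_compl.mem_nhds hq)), ?_⟩
  rw [Set.disjoint_left]
  rintro _ ⟨p', hp', rfl⟩ ⟨q', hq', h⟩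
  obtain ⟨h3, h4, h5⟩ := (inl_eq_inr_iff h₂).1 h.symm
  have h6 : ε⁻¹ < ‖φ₁ p'‖ := by
    by_contra! hle
    exact hp' ⟨φ₁ p', mem_closedBall_zero_iff.2 hle, φ₁.left_inv h3⟩
  refine hq' ⟨φ₂ q', mem_closedBall_zero_iff.2 ?_, φ₂.left_inv h4⟩
  rw [h5, norm_sphereInversion]
  exact inv_le_of_inv_le₀ hε h6.le

/-- A point of the first chart domain also lies in the second piece, where the Hausdorff property of
X₂ applies; the other points are covered by `disjoint_nhds_inl_inr`. -/
theorem t2Space (h₁ : φ₁.target = univ) (h₂ : φ₂.target = univ) :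
    T2Space (ConnectedSum φ₁ φ₂) := by
  have key : ∀ p q, inl φ₁ φ₂ p ≠ inr φ₁ φ₂ q →
      Disjoint (𝓝 (inl φ₁ φ₂ p)) (𝓝 (inr φ₁ φ₂ q)) := fun p q h => by
    by_cases hp : (p : X₁) ∈ φ₁.source
    · obtain ⟨q', hq'⟩ := exists_inl_eq_inr h₂ hp
      rw [hq'] at h ⊢
      exact disjoint_nhds_of_isOpenEmbedding isOpenEmbedding_inr h
    · exact disjoint_nhds_inl_inr h₁ h₂ hp
  refine t2Space_iff_disjoint_nhds.2 fun z w h => ?_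
  rcases exists_rep z with ⟨p, rfl⟩ | ⟨q, rfl⟩ <;> rcases exists_rep w with ⟨p', rfl⟩ | ⟨q', rfl⟩
  · exact disjoint_nhds_of_isOpenEmbedding isOpenEmbedding_inl h
  · exact key _ _ h
  · exact (key _ _ h.symm).symm
  · exact disjoint_nhds_of_isOpenEmbedding isOpenEmbedding_inr h

theorem isCompact_compl_ball [CompactSpace X₁] (h : φ.target = univ) :
    IsCompact {p : puncture φ | (p : X₁) ∉ φ.symm '' Metric.ball 0 1} := by
  have hopen : IsOpen (φ.symm '' Metric.ball 0 1) :=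
    φ.symm.isOpen_image_of_subset_source Metric.isOpen_ball (by simp [h])
  rw [Subtype.isCompact_iff]
  convert hopen.isClosed_compl.isCompact using 1
  ext p
  constructor
  · rintro ⟨p, hp, rfl⟩
    exact hp
  · intro hp
    refine ⟨⟨p, fun h0 => hp ⟨0, by simp, ?_⟩⟩, hp, rfl⟩
    exact (mem_singleton_iff.1 h0).symm

/-- The complements of the two open unit balls are compact and cover everything, since the inversion
carries the punctured unit ball of one chart outside the unit ball of the other. -/
theorem compactSpace [CompactSpace X₁] [CompactSpace X₂] (h₁ : φ₁.target = univ)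
    (h₂ : φ₂.target = univ) : CompactSpace (ConnectedSum φ₁ φ₂) := by
  have hK := ((isCompact_compl_ball h₁).image (isOpenEmbedding_inl (φ₂ := φ₂)).continuous).union
    ((isCompact_compl_ball h₂).image (isOpenEmbedding_inr (φ₁ := φ₁)).continuous)
  refine ⟨?_⟩
  convert hK using 1
  refine (eq_univ_iff_forall.2 fun z => ?_).symm
  rcases exists_rep z with ⟨p, rfl⟩ | ⟨q, rfl⟩
  · by_cases hp : (p : X₁) ∈ φ₁.symm '' Metric.ball 0 1
    · obtain ⟨v, hv, hvp⟩ := hp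
      have hps : (p : X₁) ∈ φ₁.source := hvp ▸ symm_mem_source h₁ v
      obtain ⟨q, hq⟩ := exists_inl_eq_inr h₂ hps
      refine .inr ⟨q, ?_, hq.symm⟩
      rintro ⟨w, hw, hwq⟩
      obtain ⟨-, -, h5⟩ := (inl_eq_inr_iff h₂).1 hq
      have h0 := norm_pos_iff.2 (chart_ne_zero p hps)
      rw [← hwq, apply_symm h₂] at h5
      rw [h5, mem_ball_zero_iff, norm_sphereInversion] at hw
      rw [← hvp, apply_symm h₁] at hw h0
      exact absurd ((inv_lt_one₀ h0).1 hw) (mem_ball_zero_iff.1 hv).not_gt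
    · exact .inl ⟨p, hp, rfl⟩
  · by_cases hq : (q : X₂) ∈ φ₂.symm '' Metric.ball 0 1
    · obtain ⟨v, hv, hvq⟩ := hq
      have hqs : (q : X₂) ∈ φ₂.source := hvq ▸ symm_mem_source h₂ v
      obtain ⟨p, hp⟩ := exists_inr_eq_inl h₁ h₂ hqs
      refine .inl ⟨p, ?_, hp⟩
      rintro ⟨w, hw, hwp⟩
      obtain ⟨hps, -, h5⟩ := (inl_eq_inr_iff h₂).1 hp
      have h0 := norm_pos_iff.2 (chart_ne_zero p hps)
      rw [← hvq, apply_symm h₂] at h5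
      rw [h5, mem_ball_zero_iff, norm_sphereInversion] at hv
      rw [← hwp, apply_symm h₁] at hv h0
      exact absurd ((inv_lt_one₀ h0).1 hv) (mem_ball_zero_iff.1 hw).not_gt
    · exact .inr ⟨q, hq, rfl⟩

end Topology

section Smooth

variable {n : ℕ} {X₁ : Type*} {X₂ : Type*} [TopologicalSpace X₁] [TopologicalSpace X₂]
  [T2Space X₁] [T2Space X₂] [ChartedSpace (EuclideanSpace ℝ (Fin n)) X₁]
  [ChartedSpace (EuclideanSpace ℝ (Fin n)) X₂] [IsManifold (𝓡 n) ∞ X₁] [IsManifold (𝓡 n) ∞ X₂]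
  {φ₁ : OpenPartialHomeomorph X₁ (EuclideanSpace ℝ (Fin n))}
  {φ₂ : OpenPartialHomeomorph X₂ (EuclideanSpace ℝ (Fin n))}

theorem contMDiffOn_transition (hφ₁ : φ₁ ∈ IsManifold.maximalAtlas (𝓡 n) ∞ X₁)
    (hφ₂ : φ₂ ∈ IsManifold.maximalAtlas (𝓡 n) ∞ X₂) :
    ContMDiffOn (𝓡 n) (𝓡 n) ∞ (transition φ₁ φ₂) (transition φ₁ φ₂).source := by
  refine (contMDiffOn_symm_of_mem_maximalAtlas hφ₂).comp
    (contDiffOn_sphereInversion.contMDiffOn.comp ((contMDiffOn_of_mem_maximalAtlas hφ₁).mono ?_) ?_)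
    ?_ <;> intro p hp <;> simp at hp
  · exact hp.1.1
  · exact hp.1.2
  · exact hp.2

theorem contMDiffOn_transition_symm (hφ₁ : φ₁ ∈ IsManifold.maximalAtlas (𝓡 n) ∞ X₁)
    (hφ₂ : φ₂ ∈ IsManifold.maximalAtlas (𝓡 n) ∞ X₂) :
    ContMDiffOn (𝓡 n) (𝓡 n) ∞ (transition φ₁ φ₂).symm (transition φ₁ φ₂).target := by
  refine (contMDiffOn_symm_of_mem_maximalAtlas hφ₁).comp
    (contDiffOn_sphereInversion.contMDiffOn.comp ((contMDiffOn_of_mem_maximalAtlas hφ₂).mono ?_) ?_)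
    ?_ <;> intro p hp <;> simp at hp
  · exact hp.1
  · exact hp.2.1
  · exact hp.2.2

theorem isManifold (hφ₁ : φ₁ ∈ IsManifold.maximalAtlas (𝓡 n) ∞ X₁)
    (hφ₂ : φ₂ ∈ IsManifold.maximalAtlas (𝓡 n) ∞ X₂) : IsManifold (𝓡 n) ∞ (ConnectedSum φ₁ φ₂) :=
  Glue.isManifold (contMDiffOn_transition hφ₁ hφ₂) (contMDiffOn_transition_symm hφ₁ hφ₂)

theorem contMDiffOn_openPiece_inl [IsManifold (𝓡 n) ∞ (ConnectedSum φ₁ φ₂)]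
    (hU : Nonempty (puncture φ₁)) :
    ContMDiffOn (𝓡 n) (𝓡 n) ∞ (openPiece (isOpenEmbedding_inl (φ₁ := φ₁) (φ₂ := φ₂)) hU)
      (openPiece (isOpenEmbedding_inl (φ₁ := φ₁) (φ₂ := φ₂)) hU).source ∧
    ContMDiffOn (𝓡 n) (𝓡 n) ∞ (openPiece (isOpenEmbedding_inl (φ₁ := φ₁) (φ₂ := φ₂)) hU).symm
      (openPiece (isOpenEmbedding_inl (φ₁ := φ₁) (φ₂ := φ₂)) hU).target :=
  contMDiffOn_openPiece _ _ fun _ he => .inl ⟨_, he, rfl⟩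

theorem contMDiffOn_openPiece_inr [IsManifold (𝓡 n) ∞ (ConnectedSum φ₁ φ₂)]
    (hU : Nonempty (puncture φ₂)) :
    ContMDiffOn (𝓡 n) (𝓡 n) ∞ (openPiece (isOpenEmbedding_inr (φ₁ := φ₁) (φ₂ := φ₂)) hU)
      (openPiece (isOpenEmbedding_inr (φ₁ := φ₁) (φ₂ := φ₂)) hU).source ∧
    ContMDiffOn (𝓡 n) (𝓡 n) ∞ (openPiece (isOpenEmbedding_inr (φ₁ := φ₁) (φ₂ := φ₂)) hU).symm
      (openPiece (isOpenEmbedding_inr (φ₁ := φ₁) (φ₂ := φ₂)) hU).target :=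
  contMDiffOn_openPiece _ _ fun _ he => .inr ⟨_, he, rfl⟩

end Smooth

end ConnectedSum

/-! ### Connected sums of diffeomorphisms -/

section Family

variable {n : ℕ} {X : Type*} [TopologicalSpace X] [ChartedSpace (EuclideanSpace ℝ (Fin n)) X]
  {G : Type*} [TopologicalSpace G] [ChartedSpace (EuclideanSpace ℝ (Fin n)) G]

/-- Smoothness of a family of maps carried over to an open piece. -/
theorem contMDiffWithinAt_family_of_piece {J : OpenPartialHomeomorph X G}
    (hJ : ContMDiffOn (𝓡 n) (𝓡 n) ∞ J J.source)
    (hJ' : ContMDiffOn (𝓡 n) (𝓡 n) ∞ J.symm J.target) {f : ℝ → X → X} {F : ℝ → G → G} {S : Set ℝ}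
    (hf : ContMDiffOn (𝓘(ℝ, ℝ).prod (𝓡 n)) (𝓡 n) ∞ (fun q : ℝ × X => f q.1 q.2) (S ×ˢ univ))
    (hfF : ∀ t, ∀ p ∈ J.source, f t p ∈ J.source ∧ F t (J p) = J (f t p)) {t : ℝ} (ht : t ∈ S)
    {p : X} (hp : p ∈ J.source) :
    ContMDiffWithinAt (𝓘(ℝ, ℝ).prod (𝓡 n)) (𝓡 n) ∞ (fun q : ℝ × G => F q.1 q.2) (S ×ˢ univ)
      (t, J p) := by
  have h1 : ContMDiffAt (𝓘(ℝ, ℝ).prod (𝓡 n)) (𝓘(ℝ, ℝ).prod (𝓡 n)) ∞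
      (fun q : ℝ × G => (q.1, J.symm q.2)) (t, J p) :=
    contMDiffAt_fst.prodMk (ContMDiffAt.comp (t, J p) (g := J.symm)
      (hJ'.contMDiffAt (J.open_target.mem_nhds (J.map_source hp))) contMDiffAt_snd)
  have h2 : ContMDiffWithinAt (𝓘(ℝ, ℝ).prod (𝓡 n)) (𝓡 n) ∞ (fun q : ℝ × X => f q.1 q.2)
      (S ×ˢ univ) (t, J.symm (J p)) := hf _ ⟨ht, mem_univ _⟩
  have h3 : ContMDiffWithinAt (𝓘(ℝ, ℝ).prod (𝓡 n)) (𝓡 n) ∞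
      (fun q : ℝ × G => f q.1 (J.symm q.2)) (S ×ˢ univ) (t, J p) :=
    ContMDiffWithinAt.comp (t, J p) (f := fun q : ℝ × G => (q.1, J.symm q.2))
      (g := fun q : ℝ × X => f q.1 q.2) h2 h1.contMDiffWithinAt
      fun q hq => mk_mem_prod hq.1 (mem_univ _)
  have h4 : ContMDiffAt (𝓡 n) (𝓡 n) ∞ J (f t (J.symm (J p))) := by
    rw [J.left_inv hp]
    exact hJ.contMDiffAt (J.open_source.mem_nhds (hfF t p hp).1)
  have h5 := h4.comp_contMDiffWithinAt (t, J p) h3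
  have heq : ∀ q : ℝ × G, q.2 ∈ J.target → F q.1 q.2 = J (f q.1 (J.symm q.2)) := fun q hq => by
    rw [← (hfF q.1 _ (J.map_target hq)).2, J.right_inv hq]
  refine h5.congr_of_eventuallyEq (mem_nhdsWithin_of_mem_nhds ?_) (heq _ (J.map_source hp))
  filter_upwards [continuousAt_snd.eventually_mem (J.open_target.mem_nhds (J.map_source hp))]
    with q hq
  exact heq q hq

end Family

section Diagonal

variable {n : ℕ} {X : Type*} [TopologicalSpace X]

/-- In the coordinates `φ` the map `f` is the diagonal map with entries `α`. -/
def IsDiagonalOn (φ : OpenPartialHomeomorph X (EuclideanSpace ℝ (Fin n))) (α : Fin n → ℝ)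
    (f : X → X) : Prop :=
  ∀ p ∈ φ.source, f p ∈ φ.source ∧ φ (f p) = euclideanDiag α (φ p)

variable [T2Space X] {φ : OpenPartialHomeomorph X (EuclideanSpace ℝ (Fin n))} {α : Fin n → ℝ}
  {f : X → X}

theorem IsDiagonalOn.mapsTo_puncture (h : IsDiagonalOn φ α f) (hφ : φ.target = univ)
    (hf : Function.Injective f) : MapsTo f (puncture φ) (puncture φ) := by
  have h0 := h _ (ConnectedSum.symm_mem_source hφ 0)
  have h1 : f (φ.symm 0) = φ.symm 0 := φ.injOn h0.1 (ConnectedSum.symm_mem_source hφ 0) (by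
    rw [h0.2, ConnectedSum.apply_symm hφ, map_zero])
  intro p hp hp'
  exact hp (hf ((mem_singleton_iff.1 hp').trans h1.symm))

theorem IsDiagonalOn.symm (hφ : φ.target = univ) (hα : ∀ j, α j * α j = 1) {g : X → X}
    (h : IsDiagonalOn φ α f) (hg : Function.LeftInverse g f) : IsDiagonalOn φ α g := fun p hp => by
  have h1 := h _ (ConnectedSum.symm_mem_source hφ (euclideanDiag α (φ p)))
  rw [ConnectedSum.apply_symm hφ, euclideanDiag_euclideanDiag hα] at h1
  have h2 : g p = φ.symm (euclideanDiag α (φ p)) :=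
    (congrArg g (φ.injOn h1.1 hp h1.2)).symm.trans (hg _)
  rw [h2]
  exact ⟨ConnectedSum.symm_mem_source hφ _, ConnectedSum.apply_symm hφ _⟩

theorem isDiagonalOn_one (h : ∀ p ∈ φ.source, f p = p) : IsDiagonalOn φ 1 f := fun p hp => by
  rw [h p hp]
  refine ⟨hp, ?_⟩
  ext j
  simp [euclideanDiag_apply]

end Diagonal

namespace ConnectedSum

variable {n : ℕ} {X₁ : Type*} {X₂ : Type*} [TopologicalSpace X₁] [TopologicalSpace X₂]
  [T2Space X₁] [T2Space X₂] {φ₁ : OpenPartialHomeomorph X₁ (EuclideanSpace ℝ (Fin n))}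
  {φ₂ : OpenPartialHomeomorph X₂ (EuclideanSpace ℝ (Fin n))} {α : Fin n → ℝ}

/-- The two maps agree on the overlap because a linear isometry commutes with the inversion. -/
theorem exists_isSumMap (hφ₂ : φ₂.target = univ) (hα : ∀ j, α j * α j = 1) {f₁ : X₁ → X₁}
    {f₂ : X₂ → X₂} (h₁ : IsDiagonalOn φ₁ α f₁) (h₂ : IsDiagonalOn φ₂ α f₂)
    (hm₁ : MapsTo f₁ (puncture φ₁) (puncture φ₁)) (hm₂ : MapsTo f₂ (puncture φ₂) (puncture φ₂)) :
    ∃ F, IsSumMap φ₁ φ₂ f₁ f₂ F := by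
  let u₁ : puncture φ₁ → puncture φ₁ := fun p => ⟨f₁ p, hm₁ p.2⟩
  let u₂ : puncture φ₂ → puncture φ₂ := fun q => ⟨f₂ q, hm₂ q.2⟩
  have key : ∀ p q, inl φ₁ φ₂ p = inr φ₁ φ₂ q → inl φ₁ φ₂ (u₁ p) = inr φ₁ φ₂ (u₂ q) :=
    fun p q h => by
      obtain ⟨hp, hq, hpq⟩ := (inl_eq_inr_iff hφ₂).1 h
      refine (inl_eq_inr_iff hφ₂).2 ⟨(h₁ p hp).1, (h₂ q hq).1, ?_⟩
      change φ₂ (f₂ q) = (‖φ₁ (f₁ p)‖ ^ 2)⁻¹ • φ₁ (f₁ p)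
      rw [(h₁ p hp).2, (h₂ q hq).2, hpq, norm_euclideanDiag hα, map_smul]
  have hex : ∀ z, ∃ w, (∀ p, inl φ₁ φ₂ p = z → inl φ₁ φ₂ (u₁ p) = w) ∧
      ∀ q, inr φ₁ φ₂ q = z → inr φ₁ φ₂ (u₂ q) = w := fun z => by
    rcases exists_rep z with ⟨p, rfl⟩ | ⟨q, rfl⟩
    · refine ⟨inl φ₁ φ₂ (u₁ p), fun p' h => ?_, fun q h => (key p q h.symm).symm⟩
      rw [isOpenEmbedding_inl.injective h]
    · refine ⟨inr φ₁ φ₂ (u₂ q), fun p h => key p q h, fun q' h => ?_⟩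
      rw [isOpenEmbedding_inr.injective h]
  choose F hF₁ hF₂ using hex
  refine ⟨F, fun p p' h => ?_, fun q q' h => ?_⟩
  · rw [← hF₁ _ p rfl]
    exact congrArg _ (Subtype.ext h)
  · rw [← hF₂ _ q rfl]
    exact congrArg _ (Subtype.ext h)

theorem IsSumMap.comp {f₁ g₁ : X₁ → X₁} {f₂ g₂ : X₂ → X₂}
    {F F' : ConnectedSum φ₁ φ₂ → ConnectedSum φ₁ φ₂} (hF : IsSumMap φ₁ φ₂ f₁ f₂ F)
    (hF' : IsSumMap φ₁ φ₂ g₁ g₂ F') (hm₁ : MapsTo f₁ (puncture φ₁) (puncture φ₁))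
    (hm₂ : MapsTo f₂ (puncture φ₂) (puncture φ₂)) :
    IsSumMap φ₁ φ₂ (g₁ ∘ f₁) (g₂ ∘ f₂) (F' ∘ F) := by
  refine ⟨fun p p' h => ?_, fun q q' h => ?_⟩
  · rw [Function.comp_apply, hF.1 p ⟨f₁ p, hm₁ p.2⟩ rfl]
    exact hF'.1 _ _ h
  · rw [Function.comp_apply, hF.2 q ⟨f₂ q, hm₂ q.2⟩ rfl]
    exact hF'.2 _ _ h

theorem IsSumMap.eq {f₁ : X₁ → X₁} {f₂ : X₂ → X₂} {F F' : ConnectedSum φ₁ φ₂ → ConnectedSum φ₁ φ₂}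
    (hF : IsSumMap φ₁ φ₂ f₁ f₂ F) (hF' : IsSumMap φ₁ φ₂ f₁ f₂ F')
    (hm₁ : MapsTo f₁ (puncture φ₁) (puncture φ₁)) (hm₂ : MapsTo f₂ (puncture φ₂) (puncture φ₂)) :
    F = F' := by
  funext z
  rcases exists_rep z with ⟨p, rfl⟩ | ⟨q, rfl⟩
  · rw [hF.1 p ⟨f₁ p, hm₁ p.2⟩ rfl, hF'.1 p ⟨f₁ p, hm₁ p.2⟩ rfl]
  · rw [hF.2 q ⟨f₂ q, hm₂ q.2⟩ rfl, hF'.2 q ⟨f₂ q, hm₂ q.2⟩ rfl]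

theorem isSumMap_id : IsSumMap φ₁ φ₂ id id id :=
  ⟨fun _ _ h => congrArg (inl φ₁ φ₂) (Subtype.ext h),
    fun _ _ h => congrArg (inr φ₁ φ₂) (Subtype.ext h)⟩

theorem IsSumMap.symm {f₁ g₁ : X₁ → X₁} {f₂ g₂ : X₂ → X₂}
    {F F' : ConnectedSum φ₁ φ₂ → ConnectedSum φ₁ φ₂} (hF : IsSumMap φ₁ φ₂ f₁ f₂ F)
    (hg₁ : Function.RightInverse g₁ f₁) (hg₂ : Function.RightInverse g₂ f₂)
    (hF' : Function.LeftInverse F' F) : IsSumMap φ₁ φ₂ g₁ g₂ F' := by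
  refine ⟨fun p p' h => ?_, fun q q' h => ?_⟩
  · rw [← hF.1 p' p (by rw [← h, hg₁]), hF']
  · rw [← hF.2 q' q (by rw [← h, hg₂]), hF']

variable [ChartedSpace (EuclideanSpace ℝ (Fin n)) X₁]
  [ChartedSpace (EuclideanSpace ℝ (Fin n)) X₂] [IsManifold (𝓡 n) ∞ X₁] [IsManifold (𝓡 n) ∞ X₂]
  [IsManifold (𝓡 n) ∞ (ConnectedSum φ₁ φ₂)]

theorem contMDiffOn_family {f₁ : ℝ → X₁ → X₁} {f₂ : ℝ → X₂ → X₂}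
    {F : ℝ → ConnectedSum φ₁ φ₂ → ConnectedSum φ₁ φ₂} {S : Set ℝ}
    (hF : ∀ t, IsSumMap φ₁ φ₂ (f₁ t) (f₂ t) (F t))
    (hm₁ : ∀ t, MapsTo (f₁ t) (puncture φ₁) (puncture φ₁))
    (hm₂ : ∀ t, MapsTo (f₂ t) (puncture φ₂) (puncture φ₂))
    (hf₁ : ContMDiffOn (𝓘(ℝ, ℝ).prod (𝓡 n)) (𝓡 n) ∞ (fun q : ℝ × X₁ => f₁ q.1 q.2) (S ×ˢ univ))
    (hf₂ : ContMDiffOn (𝓘(ℝ, ℝ).prod (𝓡 n)) (𝓡 n) ∞ (fun q : ℝ × X₂ => f₂ q.1 q.2) (S ×ˢ univ)) :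
    ContMDiffOn (𝓘(ℝ, ℝ).prod (𝓡 n)) (𝓡 n) ∞
      (fun q : ℝ × ConnectedSum φ₁ φ₂ => F q.1 q.2) (S ×ˢ univ) := by
  rintro ⟨t, z⟩ ⟨ht, -⟩
  rcases exists_rep z with ⟨p, rfl⟩ | ⟨q, rfl⟩
  · have hU : Nonempty (puncture φ₁) := ⟨p⟩
    obtain ⟨h1, h2⟩ := contMDiffOn_openPiece_inl (φ₂ := φ₂) hU
    have h3 := contMDiffWithinAt_family_of_piece (F := F) h1 h2 hf₁ (fun t p hp => ?_) ht
      (p := p) (by rw [openPiece_source]; exact p.2)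
    · rwa [openPiece_apply] at h3
    · rw [openPiece_source] at hp ⊢
      refine ⟨hm₁ t hp, ?_⟩
      rw [openPiece_apply _ hU ⟨p, hp⟩, openPiece_apply _ hU ⟨f₁ t p, hm₁ t hp⟩]
      exact (hF t).1 _ _ rfl
  · have hU : Nonempty (puncture φ₂) := ⟨q⟩
    obtain ⟨h1, h2⟩ := contMDiffOn_openPiece_inr (φ₁ := φ₁) hU
    have h3 := contMDiffWithinAt_family_of_piece (F := F) h1 h2 hf₂ (fun t p hp => ?_) ht
      (p := q) (by rw [openPiece_source]; exact q.2)
    · rwa [openPiece_apply] at h3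
    · rw [openPiece_source] at hp ⊢
      refine ⟨hm₂ t hp, ?_⟩
      rw [openPiece_apply _ hU ⟨p, hp⟩, openPiece_apply _ hU ⟨f₂ t p, hm₂ t hp⟩]
      exact (hF t).2 _ _ rfl

theorem IsSumMap.contMDiff {f₁ : X₁ → X₁} {f₂ : X₂ → X₂}
    {F : ConnectedSum φ₁ φ₂ → ConnectedSum φ₁ φ₂} (hF : IsSumMap φ₁ φ₂ f₁ f₂ F)
    (hm₁ : MapsTo f₁ (puncture φ₁) (puncture φ₁)) (hm₂ : MapsTo f₂ (puncture φ₂) (puncture φ₂))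
    (hf₁ : ContMDiff (𝓡 n) (𝓡 n) ∞ f₁) (hf₂ : ContMDiff (𝓡 n) (𝓡 n) ∞ f₂) :
    ContMDiff (𝓡 n) (𝓡 n) ∞ F := by
  have h := contMDiffOn_family (S := univ) (fun _ => hF) (fun _ => hm₁) (fun _ => hm₂)
    (hf₁.comp contMDiff_snd).contMDiffOn (hf₂.comp contMDiff_snd).contMDiffOn
  rw [univ_prod_univ, contMDiffOn_univ] at h
  exact h.comp (contMDiff_const (c := (0 : ℝ)).prodMk contMDiff_id)

theorem exists_diffeomorph (hφ₁ : φ₁.target = univ) (hφ₂ : φ₂.target = univ)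
    (hα : ∀ j, α j * α j = 1) {f₁ : X₁ ≃ₘ⟮𝓡 n, 𝓡 n⟯ X₁} {f₂ : X₂ ≃ₘ⟮𝓡 n, 𝓡 n⟯ X₂}
    (h₁ : IsDiagonalOn φ₁ α f₁) (h₂ : IsDiagonalOn φ₂ α f₂) :
    ∃ a : ConnectedSum φ₁ φ₂ ≃ₘ⟮𝓡 n, 𝓡 n⟯ ConnectedSum φ₁ φ₂, IsSumMap φ₁ φ₂ f₁ f₂ a := by
  have h₁' : IsDiagonalOn φ₁ α f₁.symm := h₁.symm hφ₁ hα f₁.symm_apply_apply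
  have h₂' : IsDiagonalOn φ₂ α f₂.symm := h₂.symm hφ₂ hα f₂.symm_apply_apply
  have m₁ := h₁.mapsTo_puncture hφ₁ f₁.injective
  have m₂ := h₂.mapsTo_puncture hφ₂ f₂.injective
  have m₁' := h₁'.mapsTo_puncture hφ₁ f₁.symm.injective
  have m₂' := h₂'.mapsTo_puncture hφ₂ f₂.symm.injective
  obtain ⟨F, hF⟩ := exists_isSumMap hφ₂ hα h₁ h₂ m₁ m₂
  obtain ⟨F', hF'⟩ := exists_isSumMap hφ₂ hα h₁' h₂' m₁' m₂'
  have e1 : F' ∘ F = id := by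
    refine (hF.comp hF' m₁ m₂).eq ?_ (m₁'.comp m₁) (m₂'.comp m₂)
    rw [show f₁.symm ∘ f₁ = id from funext f₁.symm_apply_apply,
      show f₂.symm ∘ f₂ = id from funext f₂.symm_apply_apply]
    exact isSumMap_id
  have e2 : F ∘ F' = id := by
    refine (hF'.comp hF m₁' m₂').eq ?_ (m₁.comp m₁') (m₂.comp m₂')
    rw [show f₁ ∘ f₁.symm = id from funext f₁.apply_symm_apply,
      show f₂ ∘ f₂.symm = id from funext f₂.apply_symm_apply]
    exact isSumMap_id
  exact ⟨⟨⟨F, F', congrFun e1, congrFun e2⟩, hF.contMDiff m₁ m₂ f₁.contMDiff f₂.contMDiff,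
    hF'.contMDiff m₁' m₂' f₁.symm.contMDiff f₂.symm.contMDiff⟩, hF⟩

/-- The connected sum of isotopies to the identity which fix the coordinate domains. -/
theorem exists_isSmoothIsotopy (hφ₁ : φ₁.target = univ) (hφ₂ : φ₂.target = univ)
    {f₁ : X₁ ≃ₘ⟮𝓡 n, 𝓡 n⟯ X₁} {f₂ : X₂ ≃ₘ⟮𝓡 n, 𝓡 n⟯ X₂}
    {F : ConnectedSum φ₁ φ₂ ≃ₘ⟮𝓡 n, 𝓡 n⟯ ConnectedSum φ₁ φ₂} (hF : IsSumMap φ₁ φ₂ f₁ f₂ F)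
    {b₁ : ℝ → (X₁ ≃ₘ⟮𝓡 n, 𝓡 n⟯ X₁)} (hb₁ : IsSmoothIsotopy b₁ f₁ (Diffeomorph.refl (𝓡 n) X₁ ∞))
    (hi₁ : ∀ t ∈ Icc (0 : ℝ) 1, ∀ p ∈ φ₁.source, b₁ t p = p)
    {b₂ : ℝ → (X₂ ≃ₘ⟮𝓡 n, 𝓡 n⟯ X₂)} (hb₂ : IsSmoothIsotopy b₂ f₂ (Diffeomorph.refl (𝓡 n) X₂ ∞))
    (hi₂ : ∀ t ∈ Icc (0 : ℝ) 1, ∀ p ∈ φ₂.source, b₂ t p = p) :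
    ∃ b : ℝ → (ConnectedSum φ₁ φ₂ ≃ₘ⟮𝓡 n, 𝓡 n⟯ ConnectedSum φ₁ φ₂),
      IsSmoothIsotopy b F (Diffeomorph.refl (𝓡 n) (ConnectedSum φ₁ φ₂) ∞) ∧
      ∀ t, ∀ p : puncture φ₁, (p : X₁) ∈ φ₁.source → b t (inl φ₁ φ₂ p) = inl φ₁ φ₂ p := by
  -- Clamping time to [0, 1] makes the gluing possible for every real t. Its lack of smoothness at
  -- the ends is harmless, as it is the identity on [0, 1], where smoothness is required.
  let τ : ℝ → ℝ := fun t => projIcc 0 1 zero_le_one t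
  have hτ : ∀ t, τ t ∈ Icc (0 : ℝ) 1 := fun t => (projIcc 0 1 zero_le_one t).2
  have hτ' : ∀ t ∈ Icc (0 : ℝ) 1, τ t = t := fun t ht =>
    congrArg Subtype.val (projIcc_of_mem zero_le_one ht)
  have hd₁ : ∀ t, IsDiagonalOn φ₁ 1 (b₁ (τ t)) := fun t => isDiagonalOn_one (hi₁ _ (hτ t))
  have hd₂ : ∀ t, IsDiagonalOn φ₂ 1 (b₂ (τ t)) := fun t => isDiagonalOn_one (hi₂ _ (hτ t))
  have m₁ := fun t => (hd₁ t).mapsTo_puncture hφ₁ (b₁ (τ t)).injective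
  have m₂ := fun t => (hd₂ t).mapsTo_puncture hφ₂ (b₂ (τ t)).injective
  choose b hb using fun t => exists_diffeomorph (φ₁ := φ₁) (φ₂ := φ₂) hφ₁ hφ₂ (by simp) (hd₁ t)
    (hd₂ t)
  refine ⟨b, ⟨?_, ?_, ?_⟩, fun t p hp => (hb t).1 _ _ (hi₁ _ (hτ t) _ hp)⟩
  · refine contMDiffOn_family (f₁ := fun t => b₁ (τ t)) (f₂ := fun t => b₂ (τ t)) hb m₁ m₂ ?_ ?_
    · exact hb₁.1.congr fun q hq => by rw [hτ' _ hq.1]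
    · exact hb₂.1.congr fun q hq => by rw [hτ' _ hq.1]
  · refine Diffeomorph.ext fun z => congrFun ((hb 0).eq ?_ (m₁ 0) (m₂ 0)) z
    rw [hτ' 0 (by simp), hb₁.2.1, hb₂.2.1]
    exact hF
  · refine Diffeomorph.ext fun z => congrFun ((hb 1).eq ?_ (m₁ 1) (m₂ 1)) z
    rw [hτ' 1 (by simp), hb₁.2.2, hb₂.2.2]
    exact isSumMap_id

end ConnectedSum

/-! ### Orientations of glued spaces -/

section Inversion

variable {n : ℕ}

/-- The derivative at v is a positive multiple of the reflection in the hyperplane orthogonal to v.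
-/
theorem det_fderiv_sphereInversion_neg {v : EuclideanSpace ℝ (Fin n)} (hv : v ≠ 0) :
    (fderiv ℝ (sphereInversion n) v).det < 0 := by
  have h1 : (sphereInversion n : EuclideanSpace ℝ (Fin n) → EuclideanSpace ℝ (Fin n)) =
      EuclideanGeometry.inversion 0 1 := by
    funext w
    simp [sphereInversion, EuclideanGeometry.inversion]
  rw [h1, (EuclideanGeometry.hasFDerivAt_inversion (R := 1) hv).fderiv]
  set K : Submodule ℝ (EuclideanSpace ℝ (Fin n)) := (Submodule.span ℝ {v - 0})ᗮ
  have h2 : LinearMap.det K.reflection.toLinearMap = -1 := by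
    rw [Submodule.det_reflection, Submodule.orthogonal_orthogonal,
      finrank_span_singleton (by simpa using hv), pow_one]
  have h3 : ((1 / dist v 0) ^ 2 • (K.reflection : EuclideanSpace ℝ (Fin n) →L[ℝ]
      EuclideanSpace ℝ (Fin n))).det = ((1 / dist v 0) ^ 2) ^ n * -1 := by
    rw [← h2]
    refine (LinearMap.det_smul _ _).trans ?_
    rw [finrank_euclideanSpace_fin]
    rfl
  rw [h3, mul_neg_one, neg_lt_zero]
  have := dist_pos.2 hv
  positivity

end Inversion

section Piece

variable {X : Type*} [TopologicalSpace X] {G : Type*} [TopologicalSpace G]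

/-- An open partial homeomorphism which is smooth in both directions. -/
structure IsSmoothPiece (n : ℕ) [ChartedSpace (EuclideanSpace ℝ (Fin n)) X]
    [ChartedSpace (EuclideanSpace ℝ (Fin n)) G] (J : OpenPartialHomeomorph X G) : Prop where
  contMDiffOn : ContMDiffOn (𝓡 n) (𝓡 n) ∞ J J.source
  contMDiffOn_symm : ContMDiffOn (𝓡 n) (𝓡 n) ∞ J.symm J.target

variable {n : ℕ} [ChartedSpace (EuclideanSpace ℝ (Fin n)) X]
  [ChartedSpace (EuclideanSpace ℝ (Fin n)) G]
  {X' : Type*} [TopologicalSpace X'] [ChartedSpace (EuclideanSpace ℝ (Fin n)) X']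
  {J : OpenPartialHomeomorph X G} {J' : OpenPartialHomeomorph X' G}
  {e : OpenPartialHomeomorph X (EuclideanSpace ℝ (Fin n))}
  {e' : OpenPartialHomeomorph X' (EuclideanSpace ℝ (Fin n))}

theorem IsSmoothPiece.mem_maximalAtlas [IsManifold (𝓡 n) ∞ X] [IsManifold (𝓡 n) ∞ G]
    (hJ : IsSmoothPiece n J)
    (he : e ∈ IsManifold.maximalAtlas (𝓡 n) ∞ X) :
    J.symm.trans e ∈ IsManifold.maximalAtlas (𝓡 n) ∞ G := by
  refine OpenPartialHomeomorph.mem_maximalAtlas_of_contMDiffOn _ ?_ ?_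
  · refine (contMDiffOn_of_mem_maximalAtlas he).comp (hJ.2.mono ?_) ?_ <;> intro p hp <;>
      simp at hp
    · exact hp.1
    · exact hp.2
  · rw [OpenPartialHomeomorph.trans_symm_eq_symm_trans_symm, OpenPartialHomeomorph.symm_symm]
    refine hJ.1.comp ((contMDiffOn_symm_of_mem_maximalAtlas he).mono ?_) ?_ <;> intro p hp <;>
      simp at hp
    · exact hp.1
    · exact hp.2

theorem mem_pieceChart_source {p : X} (hp : p ∈ J.source) (hpe : p ∈ e.source) :
    J p ∈ (J.symm.trans e).source := by
  simp [hp, hpe]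

theorem exists_of_mem_pieceChart_source {z : G} (hz : z ∈ (J.symm.trans e).source) :
    ∃ p ∈ J.source, p ∈ e.source ∧ J p = z := by
  simp at hz
  exact ⟨J.symm z, J.map_target hz.1, hz.2, J.right_inv hz.1⟩

theorem coordDeriv_pieceChart {F : G → G} {f : X → X'} {p : X} (hp : p ∈ J.source)
    (hpe : p ∈ e.source) (h : ∀ᶠ q in 𝓝 p, J'.symm (F (J q)) = f q) :
    coordDeriv (J.symm.trans e) (J'.symm.trans e') F (J p) = coordDeriv e e' f p := by
  rw [← coordDeriv_congr hpe (f := J'.symm ∘ F ∘ J) h]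
  have h1 : (J.symm.trans e) (J p) = e p := by simp [J.left_inv hp]
  unfold coordDeriv
  rw [h1]
  rfl

end Piece

/-! ### Reversing, gluing and testing orientations. -/

namespace ManifoldOrientation

variable {n : ℕ} {X : Type*} [TopologicalSpace X] [ChartedSpace (EuclideanSpace ℝ (Fin n)) X]
  {X' : Type*} [TopologicalSpace X'] [ChartedSpace (EuclideanSpace ℝ (Fin n)) X']
  {G : Type*} [TopologicalSpace G] [ChartedSpace (EuclideanSpace ℝ (Fin n)) G]

/-- The opposite orientation. -/
noncomputable def reverse [IsManifold (𝓡 n) ∞ X] (hn : 0 < n) (o : ManifoldOrientation n X) :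
    ManifoldOrientation n X where
  charts := (fun e => e.trans (linearChange (coordReflection n))) '' o.charts
  charts_smooth := by
    rintro _ ⟨e, he, rfl⟩
    exact linearChange_mem_maximalAtlas (o.charts_smooth he) _
  charts_cover p := by
    obtain ⟨e, he, hp⟩ := o.charts_cover p
    exact ⟨_, ⟨e, he, rfl⟩, by simpa using hp⟩
  det_pos := by
    rintro _ ⟨e, he, rfl⟩ _ ⟨e', he', rfl⟩ p hp hp'
    have h := det_coordDeriv_reflection_left (e := e)
      (e' := e'.trans (linearChange (coordReflection n))) hn id p
    rw [det_coordDeriv_reflection_right (e := e) hn, neg_neg] at h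
    exact (o.det_coordDeriv_pos he he' (by simpa using hp) (by simpa using hp')).trans_eq h.symm

theorem Preserves.reverse [IsManifold (𝓡 n) ∞ X] (hn : 0 < n) {o : ManifoldOrientation n X}
    {f : X ≃ₘ⟮𝓡 n, 𝓡 n⟯ X} (hf : o.Preserves f) : (o.reverse hn).Preserves f := by
  rintro _ ⟨e, he, rfl⟩ _ ⟨e', he', rfl⟩ p hp hp'
  have h := det_coordDeriv_reflection_left (e := e)
    (e' := e'.trans (linearChange (coordReflection n))) hn f p
  rw [det_coordDeriv_reflection_right (e := e) hn, neg_neg] at h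
  exact (hf e he e' he' p (by simpa using hp) (by simpa using hp')).trans_eq h.symm

theorem PositiveChart.reverse [IsManifold (𝓡 n) ∞ X] (hn : 0 < n) {o : ManifoldOrientation n X}
    {φ : OpenPartialHomeomorph X (EuclideanSpace ℝ (Fin n))} (h : o.PositiveChart φ) :
    (o.reverse hn).NegativeChart φ := by
  rintro _ ⟨e, he, rfl⟩ p hp hp'
  have h1 := det_coordDeriv_reflection_left (e := e) (e' := φ) hn id p
  exact h1.trans_lt (neg_lt_zero.2 (h e he p (by simpa using hp) hp'))

theorem NegativeChart.reverse [IsManifold (𝓡 n) ∞ X] (hn : 0 < n) {o : ManifoldOrientation n X}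
    {φ : OpenPartialHomeomorph X (EuclideanSpace ℝ (Fin n))} (h : o.NegativeChart φ) :
    (o.reverse hn).PositiveChart φ := by
  rintro _ ⟨e, he, rfl⟩ p hp hp'
  have h1 := det_coordDeriv_reflection_left (e := e) (e' := φ) hn id p
  exact (neg_pos.2 (h e he p (by simpa using hp) hp')).trans_eq h1.symm

/-- Orientations of two open pieces which agree on the overlap define an orientation. -/
def ofPieces [IsManifold (𝓡 n) ∞ X] [IsManifold (𝓡 n) ∞ X'] [IsManifold (𝓡 n) ∞ G]
    {J : OpenPartialHomeomorph X G} {J' : OpenPartialHomeomorph X' G}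
    (hJ : IsSmoothPiece n J) (hJ' : IsSmoothPiece n J') (hcover : ∀ z, z ∈ J.target ∨ z ∈ J'.target)
    (o : ManifoldOrientation n X) (o' : ManifoldOrientation n X')
    (hoo' : ∀ e ∈ o.charts, ∀ e' ∈ o'.charts, ∀ p ∈ J.source, ∀ q ∈ J'.source, p ∈ e.source →
      q ∈ e'.source → J p = J' q → 0 < (coordDeriv e e' (J'.symm ∘ J) p).det) :
    ManifoldOrientation n G where
  charts := (fun e => J.symm.trans e) '' o.charts ∪ (fun e => J'.symm.trans e) '' o'.charts
  charts_smooth := by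
    rintro _ (⟨e, he, rfl⟩ | ⟨e, he, rfl⟩)
    · exact hJ.mem_maximalAtlas (o.charts_smooth he)
    · exact hJ'.mem_maximalAtlas (o'.charts_smooth he)
  charts_cover z := by
    rcases hcover z with h | h
    · obtain ⟨e, he, hp⟩ := o.charts_cover (J.symm z)
      exact ⟨_, .inl ⟨e, he, rfl⟩, by simp [h, hp]⟩
    · obtain ⟨e, he, hp⟩ := o'.charts_cover (J'.symm z)
      exact ⟨_, .inr ⟨e, he, rfl⟩, by simp [h, hp]⟩
  det_pos := by
    have cross : ∀ e ∈ o.charts, ∀ e' ∈ o'.charts, ∀ z ∈ (J.symm.trans e).source,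
        z ∈ (J'.symm.trans e').source →
        0 < (coordDeriv (J.symm.trans e) (J'.symm.trans e') id z).det := by
      intro e he e' he' z hz hz'
      obtain ⟨p, hp, hpe, rfl⟩ := exists_of_mem_pieceChart_source hz
      obtain ⟨q, hq, hqe, hqp⟩ := exists_of_mem_pieceChart_source hz'
      rw [coordDeriv_pieceChart (J' := J') (f := J'.symm ∘ J) hp hpe (.of_forall fun q => rfl)]
      exact hoo' e he e' he' p hp q hq hpe hqe hqp.symm
    rintro _ (⟨e, he, rfl⟩ | ⟨e, he, rfl⟩) _ (⟨e', he', rfl⟩ | ⟨e', he', rfl⟩) z hz hz'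
    · obtain ⟨p, hp, hpe, rfl⟩ := exists_of_mem_pieceChart_source hz
      refine (o.det_coordDeriv_pos he he' hpe (by simpa [hp] using hz')).trans_eq
        (congrArg ContinuousLinearMap.det (coordDeriv_pieceChart (F := id) hp hpe ?_).symm)
      filter_upwards [J.open_source.mem_nhds hp] with q hq
      exact J.left_inv hq
    · exact cross e he e' he' z hz hz'
    -- The opposite coordinate change is inverse to one already treated, so its determinant has the
    -- same sign.
    · have h := det_coordDeriv_id_mul (hJ'.mem_maximalAtlas (o'.charts_smooth he))
        (hJ.mem_maximalAtlas (o.charts_smooth he')) hz hz'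
      exact pos_of_mul_pos_right (h.symm ▸ one_pos) (cross e' he' e he z hz' hz).le
    · obtain ⟨p, hp, hpe, rfl⟩ := exists_of_mem_pieceChart_source hz
      refine (o'.det_coordDeriv_pos he he' hpe (by simpa [hp] using hz')).trans_eq
        (congrArg ContinuousLinearMap.det (coordDeriv_pieceChart (F := id) hp hpe ?_).symm)
      filter_upwards [J'.open_source.mem_nhds hp] with q hq
      exact J'.left_inv hq

/-- One pair of oriented charts at each point is enough, because all other pairs differ by positive
determinants. -/
theorem preserves_of_exists {o : ManifoldOrientation n G} {f : G ≃ₘ⟮𝓡 n, 𝓡 n⟯ G}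
    (h : ∀ z, ∃ e ∈ o.charts, ∃ e' ∈ o.charts, z ∈ e.source ∧ f z ∈ e'.source ∧
      0 < (coordDeriv e e' f z).det) : o.Preserves f := by
  intro e he e' he' z hz hz'
  obtain ⟨c, hc, c', hc', hzc, hzc', hpos⟩ := h z
  have h1 := det_coordDeriv_comp (f := id) (g := f) (o.charts_smooth he) (o.charts_smooth hc)
    (o.charts_smooth hc') hz hzc hzc' contMDiffAt_id f.contMDiff.contMDiffAt
  have h2 := det_coordDeriv_comp (f := f) (g := id) (o.charts_smooth he) (o.charts_smooth hc')
    (o.charts_smooth he') hz hzc' hz' f.contMDiff.contMDiffAt contMDiffAt_id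
  rw [Function.comp_id] at h1
  rw [Function.id_comp, h1] at h2
  exact (mul_pos (o.det_coordDeriv_pos hc' he' hzc' hz')
    (mul_pos hpos (o.det_coordDeriv_pos he hc hz hzc))).trans_eq h2.symm

theorem Preserves.exists_of_piece {o : ManifoldOrientation n X} {o' : ManifoldOrientation n G}
    {J : OpenPartialHomeomorph X G} (hJ : ∀ e ∈ o.charts, J.symm.trans e ∈ o'.charts)
    {f : X ≃ₘ⟮𝓡 n, 𝓡 n⟯ X} (hf : o.Preserves f) {F : G → G}
    (hfF : ∀ p ∈ J.source, f p ∈ J.source ∧ F (J p) = J (f p)) {p : X} (hp : p ∈ J.source) :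
    ∃ e ∈ o'.charts, ∃ e' ∈ o'.charts, J p ∈ e.source ∧ F (J p) ∈ e'.source ∧
      0 < (coordDeriv e e' F (J p)).det := by
  obtain ⟨e, he, hpe⟩ := o.charts_cover p
  obtain ⟨e', he', hpe'⟩ := o.charts_cover (f p)
  refine ⟨_, hJ e he, _, hJ e' he', mem_pieceChart_source hp hpe, ?_, ?_⟩
  · rw [(hfF p hp).2]
    exact mem_pieceChart_source (hfF p hp).1 hpe'
  · rw [coordDeriv_pieceChart (f := f) hp hpe]
    · exact hf e he e' he' p hpe hpe'
    · filter_upwards [J.open_source.mem_nhds hp] with q hq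
      rw [(hfF q hq).2, J.left_inv (hfF q hq).1]

theorem preservesOn_openPiece {U : Opens X} {ι : U → G} (hι : IsOpenEmbedding ι) (hU : Nonempty U)
    {o : ManifoldOrientation n X} {o' : ManifoldOrientation n G}
    (hJ : ∀ e ∈ o.charts, (openPiece hι hU).symm.trans e ∈ o'.charts) :
    o.PreservesOn o' U ι := by
  intro e he e' he' p hp hp'
  have hpJ : (p : X) ∈ (openPiece hι hU).source := by rw [openPiece_source]; exact p.2
  have h := o'.det_coordDeriv_pos (hJ e he) he' (p := ι p)
    (by rw [← openPiece_apply hι hU]; exact mem_pieceChart_source hpJ hp) hp'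
  have h1 : ((openPiece hι hU).symm.trans e) (ι p) = e p := by
    change e ((openPiece hι hU).symm (ι p)) = e p
    rw [openPiece_symm_apply]
  unfold coordDeriv at h
  rw [h1] at h
  refine h.trans_eq (congrArg ContinuousLinearMap.det (EventuallyEq.fderiv_eq ?_))
  have hc := e.continuousAt_symm (e.map_source hp)
  filter_upwards [hc.eventually_mem (U.isOpen.mem_nhds (by rw [e.left_inv hp]; exact p.2))] with v hv
  have hv' : e.symm v ∈ U := hv
  rw [dif_pos hv', ← openPiece_apply hι hU]
  rfl

end ManifoldOrientation

namespace ConnectedSum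

variable {n : ℕ} {X₁ : Type*} {X₂ : Type*} [TopologicalSpace X₁] [TopologicalSpace X₂]
  [T2Space X₁] [T2Space X₂] [ChartedSpace (EuclideanSpace ℝ (Fin n)) X₁]
  [ChartedSpace (EuclideanSpace ℝ (Fin n)) X₂] [IsManifold (𝓡 n) ∞ X₁] [IsManifold (𝓡 n) ∞ X₂]
  {φ₁ : OpenPartialHomeomorph X₁ (EuclideanSpace ℝ (Fin n))}
  {φ₂ : OpenPartialHomeomorph X₂ (EuclideanSpace ℝ (Fin n))}

theorem coordDeriv_transition (hφ₁ : φ₁.target = univ) (hφ₂ : φ₂.target = univ) (p : X₁) :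
    coordDeriv φ₁ φ₂ (transition φ₁ φ₂) p = fderiv ℝ (sphereInversion n) (φ₁ p) := by
  unfold coordDeriv
  congr 1
  funext v
  change φ₂ (φ₂.symm (sphereInversion n (φ₁ (φ₁.symm v)))) = _
  rw [apply_symm hφ₁, apply_symm hφ₂]

/-- The sign is the product of the signs of the two charts and of the inversion. The latter is
negative, so opposite charts give a positive result. -/
theorem det_coordDeriv_transition_pos (hφ₁ : φ₁ ∈ IsManifold.maximalAtlas (𝓡 n) ∞ X₁)
    (hφ₂ : φ₂ ∈ IsManifold.maximalAtlas (𝓡 n) ∞ X₂) (ht₁ : φ₁.target = univ)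
    (ht₂ : φ₂.target = univ) {o₁ : ManifoldOrientation n X₁} {o₂ : ManifoldOrientation n X₂}
    (ho : (o₁.PositiveChart φ₁ ∧ o₂.NegativeChart φ₂) ∨
      (o₁.NegativeChart φ₁ ∧ o₂.PositiveChart φ₂))
    {e : OpenPartialHomeomorph X₁ (EuclideanSpace ℝ (Fin n))} (he : e ∈ o₁.charts)
    {e' : OpenPartialHomeomorph X₂ (EuclideanSpace ℝ (Fin n))} (he' : e' ∈ o₂.charts) {p : X₁}
    (hp : p ∈ (transition φ₁ φ₂).source) (hpe : p ∈ e.source)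
    (hpe' : transition φ₁ φ₂ p ∈ e'.source) :
    0 < (coordDeriv e e' (transition φ₁ φ₂) p).det := by
  obtain ⟨hp₁, hp0⟩ := (mem_transition_source ht₂).1 hp
  have hp₂ : transition φ₁ φ₂ p ∈ φ₂.source := symm_mem_source ht₂ _
  have hs := o₁.charts_smooth he
  have hs' := o₂.charts_smooth he'
  have hT : ContMDiffAt (𝓡 n) (𝓡 n) ∞ (transition φ₁ φ₂) p :=
    (contMDiffOn_transition hφ₁ hφ₂).contMDiffAt ((transition φ₁ φ₂).open_source.mem_nhds hp)
  have h1 := det_coordDeriv_comp (f := transition φ₁ φ₂) (g := id) hs hφ₂ hs' hpe hp₂ hpe' hT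
    contMDiffAt_id
  have h2 := det_coordDeriv_comp (f := id) (g := transition φ₁ φ₂) hs hφ₁ hφ₂ hpe hp₁ hp₂
    contMDiffAt_id hT
  have h3 := det_coordDeriv_id_mul hs' hφ₂ hpe' hp₂
  rw [Function.id_comp] at h1
  rw [Function.comp_id] at h2
  rw [h1, h2, id_eq, coordDeriv_transition ht₁ ht₂]
  have h4 := det_fderiv_sphereInversion_neg hp0
  rcases ho with ⟨ho₁, ho₂⟩ | ⟨ho₁, ho₂⟩
  · have h5 : 0 < (coordDeriv e φ₁ id p).det := ho₁ e he p hpe hp₁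
    have h6 : (coordDeriv e' φ₂ id (transition φ₁ φ₂ p)).det < 0 := ho₂ e' he' _ hpe' hp₂
    refine mul_pos_of_neg_of_neg ?_ (mul_neg_of_neg_of_pos h4 h5)
    by_contra! h
    nlinarith
  · have h5 : (coordDeriv e φ₁ id p).det < 0 := ho₁ e he p hpe hp₁
    have h6 : 0 < (coordDeriv e' φ₂ id (transition φ₁ φ₂ p)).det := ho₂ e' he' _ hpe' hp₂
    refine mul_pos ?_ (mul_pos_of_neg_of_neg h4 h5)
    by_contra! h
    nlinarith

/-- The orientation of a connected sum, when the coordinates have opposite signs. -/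
theorem exists_orientation [IsManifold (𝓡 n) ∞ (ConnectedSum φ₁ φ₂)]
    (hφ₁ : φ₁ ∈ IsManifold.maximalAtlas (𝓡 n) ∞ X₁)
    (hφ₂ : φ₂ ∈ IsManifold.maximalAtlas (𝓡 n) ∞ X₂) (ht₁ : φ₁.target = univ)
    (ht₂ : φ₂.target = univ) {o₁ : ManifoldOrientation n X₁} {o₂ : ManifoldOrientation n X₂}
    (ho : (o₁.PositiveChart φ₁ ∧ o₂.NegativeChart φ₂) ∨
      (o₁.NegativeChart φ₁ ∧ o₂.PositiveChart φ₂))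
    (hU₁ : Nonempty (puncture φ₁)) (hU₂ : Nonempty (puncture φ₂)) :
    ∃ o : ManifoldOrientation n (ConnectedSum φ₁ φ₂),
      (∀ e ∈ o₁.charts, (openPiece (isOpenEmbedding_inl (φ₁ := φ₁) (φ₂ := φ₂)) hU₁).symm.trans e ∈
        o.charts) ∧
      ∀ e ∈ o₂.charts, (openPiece (isOpenEmbedding_inr (φ₁ := φ₁) (φ₂ := φ₂)) hU₂).symm.trans e ∈
        o.charts := by
  obtain ⟨h1, h2⟩ := contMDiffOn_openPiece_inl (φ₂ := φ₂) hU₁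
  obtain ⟨h3, h4⟩ := contMDiffOn_openPiece_inr (φ₁ := φ₁) hU₂
  refine ⟨ManifoldOrientation.ofPieces ⟨h1, h2⟩ ⟨h3, h4⟩ (fun z => ?_) o₁ o₂ ?_,
    fun e he => .inl ⟨e, he, rfl⟩, fun e he => .inr ⟨e, he, rfl⟩⟩
  · rw [openPiece_target, openPiece_target]
    exact exists_rep z
  · intro e he e' he' p hp q hq hpe hqe hpq
    rw [openPiece_source] at hp hq
    rw [openPiece_apply _ hU₁ ⟨p, hp⟩, openPiece_apply _ hU₂ ⟨q, hq⟩] at hpq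
    obtain ⟨hpT, hT⟩ := Glue.inl_eq_inr.1 hpq
    have hev : (openPiece (isOpenEmbedding_inr (φ₁ := φ₁) (φ₂ := φ₂)) hU₂).symm ∘
        openPiece (isOpenEmbedding_inl (φ₁ := φ₁) (φ₂ := φ₂)) hU₁ =ᶠ[𝓝 p] transition φ₁ φ₂ := by
      filter_upwards [(transition φ₁ φ₂).open_source.mem_nhds hpT, (puncture φ₁).isOpen.mem_nhds hp]
        with p' hp' hp''
      have h0 := ((mem_transition_source ht₂).1 hp')
      have hm : transition φ₁ φ₂ p' ∈ puncture φ₂ :=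
        symm_mem_puncture ht₂ (mapsTo_sphereInversion_aux h0.2)
      have h5 : inl φ₁ φ₂ ⟨p', hp''⟩ = inr φ₁ φ₂ ⟨transition φ₁ φ₂ p', hm⟩ :=
        Glue.inl_eq_inr.2 ⟨hp', rfl⟩
      rw [Function.comp_apply, openPiece_apply _ hU₁ ⟨p', hp''⟩, h5, openPiece_symm_apply]
    rw [coordDeriv_congr hpe hev]
    refine det_coordDeriv_transition_pos hφ₁ hφ₂ ht₁ ht₂ ho he he' hpT hpe ?_
    rwa [show transition φ₁ φ₂ p = q from hT]

theorem IsSumMap.preserves [IsManifold (𝓡 n) ∞ (ConnectedSum φ₁ φ₂)]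
    {o₁ : ManifoldOrientation n X₁} {o₂ : ManifoldOrientation n X₂}
    {o : ManifoldOrientation n (ConnectedSum φ₁ φ₂)}
    (hU₁ : Nonempty (puncture φ₁)) (hU₂ : Nonempty (puncture φ₂))
    (ho₁ : ∀ e ∈ o₁.charts, (openPiece (isOpenEmbedding_inl (φ₁ := φ₁) (φ₂ := φ₂)) hU₁).symm.trans e
      ∈ o.charts)
    (ho₂ : ∀ e ∈ o₂.charts, (openPiece (isOpenEmbedding_inr (φ₁ := φ₁) (φ₂ := φ₂)) hU₂).symm.trans e
      ∈ o.charts)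
    {f₁ : X₁ ≃ₘ⟮𝓡 n, 𝓡 n⟯ X₁} {f₂ : X₂ ≃ₘ⟮𝓡 n, 𝓡 n⟯ X₂} (hf₁ : o₁.Preserves f₁)
    (hf₂ : o₂.Preserves f₂) (hm₁ : MapsTo f₁ (puncture φ₁) (puncture φ₁))
    (hm₂ : MapsTo f₂ (puncture φ₂) (puncture φ₂))
    {F : ConnectedSum φ₁ φ₂ ≃ₘ⟮𝓡 n, 𝓡 n⟯ ConnectedSum φ₁ φ₂} (hF : IsSumMap φ₁ φ₂ f₁ f₂ F) :
    o.Preserves F := by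
  refine ManifoldOrientation.preserves_of_exists fun z => ?_
  rcases exists_rep z with ⟨p, rfl⟩ | ⟨q, rfl⟩
  · rw [← openPiece_apply isOpenEmbedding_inl hU₁]
    refine hf₁.exists_of_piece ho₁ (fun p hp => ?_) (by rw [openPiece_source]; exact p.2)
    rw [openPiece_source] at hp ⊢
    refine ⟨hm₁ hp, ?_⟩
    rw [openPiece_apply _ hU₁ ⟨p, hp⟩, openPiece_apply _ hU₁ ⟨f₁ p, hm₁ hp⟩]
    exact hF.1 _ _ rfl
  · rw [← openPiece_apply isOpenEmbedding_inr hU₂]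
    refine hf₂.exists_of_piece ho₂ (fun p hp => ?_) (by rw [openPiece_source]; exact q.2)
    rw [openPiece_source] at hp ⊢
    refine ⟨hm₂ hp, ?_⟩
    rw [openPiece_apply _ hU₂ ⟨p, hp⟩, openPiece_apply _ hU₂ ⟨f₂ p, hm₂ hp⟩]
    exact hF.2 _ _ rfl

end ConnectedSum

/-! ### Admissibility of the connected sum -/

/-- For v in the negative part, v + A v is fixed by A and still in the negative part, so it
vanishes. -/
theorem iSup_maxGenEigenspace_of_involution {V : Type*} [AddCommGroup V] [Module ℝ V]
    [FiniteDimensional ℝ V] {A : Module.End ℝ V} (hA : A * A = 1) :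
    (⨆ μ ∈ Iio (0 : ℝ), A.maxGenEigenspace μ) = A.eigenspace (-1) := by
  obtain ⟨N, -, hneg, -, hinv⟩ := exists_isCompl_negative A
  have hle : A.eigenspace (-1) ≤ ⨆ μ ∈ Iio (0 : ℝ), A.maxGenEigenspace μ :=
    (Module.End.genEigenspace_le_maximal A (-1) 1).trans
      (le_iSup₂_of_le (f := fun μ (_ : μ ∈ Iio (0 : ℝ)) => A.maxGenEigenspace μ) (-1)
        (by simp) le_rfl)
  refine le_antisymm (fun v hv => ?_) hle
  have h1 := (hinv A (Commute.refl A)).1 v hv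
  have h2 : A (A v) = v := LinearMap.congr_fun hA v
  rw [Module.End.mem_eigenspace_iff, neg_one_smul]
  by_contra hne
  have h3 : v + A v ≠ 0 := fun h => hne (eq_neg_of_add_eq_zero_right h)
  have := hneg _ (add_mem hv h1) 1 (by rw [map_add, h2, one_smul, add_comm]) h3
  linarith

theorem euclideanDiag_toLinearMap_mul_self {n : ℕ} {α : Fin n → ℝ} (hα : ∀ j, α j * α j = 1) :
    (euclideanDiag α).toLinearMap * (euclideanDiag α).toLinearMap = 1 :=
  LinearMap.ext fun v => euclideanDiag_euclideanDiag hα v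

theorem finrank_commonNegativeSubspace_signs {n : ℕ} (hn : 3 ≤ n) :
    Module.finrank ℝ (commonNegativeSubspace (euclideanDiag (signK : Fin n → ℝ)).toLinearMap
      (euclideanDiag (signI : Fin n → ℝ)).toLinearMap) = 1 := by
  let i : Fin n := ⟨1, by omega⟩
  have h : commonNegativeSubspace (euclideanDiag (signK : Fin n → ℝ)).toLinearMap
      (euclideanDiag (signI : Fin n → ℝ)).toLinearMap =
      Submodule.span ℝ {EuclideanSpace.single i (1 : ℝ)} := by
    unfold commonNegativeSubspace
    rw [iSup_maxGenEigenspace_of_involution (euclideanDiag_toLinearMap_mul_self signK_mul_self),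
      iSup_maxGenEigenspace_of_involution (euclideanDiag_toLinearMap_mul_self signI_mul_self)]
    ext v
    rw [Submodule.mem_inf, Module.End.mem_eigenspace_iff, Module.End.mem_eigenspace_iff,
      Submodule.mem_span_singleton]
    constructor
    · rintro ⟨h1, h2⟩
      refine ⟨v i, ?_⟩
      ext j
      have h3 : signK j * v j = -1 * v j := by
        rw [← euclideanDiag_apply]
        exact congrArg (fun w : EuclideanSpace ℝ (Fin n) => w j) h1
      have h4 : signI j * v j = -1 * v j := by
        rw [← euclideanDiag_apply]
        exact congrArg (fun w : EuclideanSpace ℝ (Fin n) => w j) h2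
      by_cases hj : j = i
      · subst hj; simp
      · have hj1 : j.val ≠ 1 := fun h => hj (Fin.ext h)
        have h5 : v j = 0 := by
          unfold signK at h3
          unfold signI at h4
          by_cases h0 : j.val = 0
          · simp [h0] at h4; linarith
          · simp [h0, hj1] at h3; linarith
        simp [hj, h5]
    · rintro ⟨r, rfl⟩
      constructor <;> ext j <;> by_cases hj : j = i <;>
        simp [euclideanDiag_apply, hj, signK, signI, i]
  rw [h, finrank_span_singleton (by simp)]

theorem IsStandardizedPair.isDiagonalOn_a {n : ℕ} {X : Type*} [TopologicalSpace X]
    [ChartedSpace (EuclideanSpace ℝ (Fin n)) X] {o : ManifoldOrientation n X}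
    {a c : X ≃ₘ⟮𝓡 n, 𝓡 n⟯ X} {φ : OpenPartialHomeomorph X (EuclideanSpace ℝ (Fin n))} {x : X}
    (h : IsStandardizedPair o a c φ x) : IsDiagonalOn φ signK a := fun p hp => by
  have := h.local_a p hp
  rwa [rotK_eq] at this

theorem IsStandardizedPair.isDiagonalOn_c {n : ℕ} {X : Type*} [TopologicalSpace X]
    [ChartedSpace (EuclideanSpace ℝ (Fin n)) X] {o : ManifoldOrientation n X}
    {a c : X ≃ₘ⟮𝓡 n, 𝓡 n⟯ X} {φ : OpenPartialHomeomorph X (EuclideanSpace ℝ (Fin n))} {x : X}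
    (h : IsStandardizedPair o a c φ x) : IsDiagonalOn φ signI c := fun p hp => by
  have := h.local_c p hp
  rwa [rotI_eq] at this

theorem IsDiagonalOn.coordDeriv_eq {n : ℕ} {X : Type*} [TopologicalSpace X]
    [T2Space X] [ChartedSpace (EuclideanSpace ℝ (Fin n)) X]
    {φ : OpenPartialHomeomorph X (EuclideanSpace ℝ (Fin n))} {α : Fin n → ℝ} {f : X → X}
    (h : IsDiagonalOn φ α f) (hφ : φ.target = univ) (p : X) :
    coordDeriv φ φ f p = euclideanDiag α := by
  have : φ ∘ f ∘ φ.symm = euclideanDiag α := by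
    funext v
    exact (h _ (ConnectedSum.symm_mem_source hφ v)).2.trans
      (congrArg _ (ConnectedSum.apply_symm hφ v))
  unfold coordDeriv
  rw [this]
  exact (euclideanDiag α).fderiv

theorem fixed_of_isDiagonalOn {n : ℕ} {X : Type*} [TopologicalSpace X] [T2Space X]
    {φ : OpenPartialHomeomorph X (EuclideanSpace ℝ (Fin n))} {α : Fin n → ℝ} {f : X → X}
    (h : IsDiagonalOn φ α f) (hφ : φ.target = univ) {v : EuclideanSpace ℝ (Fin n)}
    (hv : euclideanDiag α v = v) : f (φ.symm v) = φ.symm v := by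
  have h1 := h _ (ConnectedSum.symm_mem_source hφ v)
  refine φ.injOn h1.1 (ConnectedSum.symm_mem_source hφ v) ?_
  rw [h1.2, ConnectedSum.apply_symm hφ, hv]

namespace ConnectedSum

variable {n : ℕ} {X₁ : Type*} {X₂ : Type*} [TopologicalSpace X₁] [TopologicalSpace X₂]
  [T2Space X₁] [T2Space X₂] [ChartedSpace (EuclideanSpace ℝ (Fin n)) X₁]
  [ChartedSpace (EuclideanSpace ℝ (Fin n)) X₂] [IsManifold (𝓡 n) ∞ X₁] [IsManifold (𝓡 n) ∞ X₂]
  {φ₁ : OpenPartialHomeomorph X₁ (EuclideanSpace ℝ (Fin n))}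
  {φ₂ : OpenPartialHomeomorph X₂ (EuclideanSpace ℝ (Fin n))}

theorem IsSumMap.diffCommutator {a₁ c₁ : X₁ ≃ₘ⟮𝓡 n, 𝓡 n⟯ X₁} {a₂ c₂ : X₂ ≃ₘ⟮𝓡 n, 𝓡 n⟯ X₂}
    {a c : ConnectedSum φ₁ φ₂ ≃ₘ⟮𝓡 n, 𝓡 n⟯ ConnectedSum φ₁ φ₂} (ht₁ : φ₁.target = univ)
    (ht₂ : φ₂.target = univ) {α γ : Fin n → ℝ} (hα : ∀ j, α j * α j = 1) (hγ : ∀ j, γ j * γ j = 1)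
    (ha₁ : IsDiagonalOn φ₁ α a₁) (hc₁ : IsDiagonalOn φ₁ γ c₁) (ha₂ : IsDiagonalOn φ₂ α a₂)
    (hc₂ : IsDiagonalOn φ₂ γ c₂) (ha : IsSumMap φ₁ φ₂ a₁ a₂ a) (hc : IsSumMap φ₁ φ₂ c₁ c₂ c) :
    IsSumMap φ₁ φ₂ (_root_.diffCommutator a₁ c₁) (_root_.diffCommutator a₂ c₂)
      (_root_.diffCommutator a c) := by
  have ha' : IsSumMap φ₁ φ₂ a₁.symm a₂.symm a.symm :=
    ha.symm a₁.apply_symm_apply a₂.apply_symm_apply a.symm_apply_apply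
  have hc' : IsSumMap φ₁ φ₂ c₁.symm c₂.symm c.symm :=
    hc.symm c₁.apply_symm_apply c₂.apply_symm_apply c.symm_apply_apply
  have ma₁ := (ha₁.symm ht₁ hα a₁.symm_apply_apply).mapsTo_puncture ht₁ a₁.symm.injective
  have ma₂ := (ha₂.symm ht₂ hα a₂.symm_apply_apply).mapsTo_puncture ht₂ a₂.symm.injective
  have mc₁ := (hc₁.symm ht₁ hγ c₁.symm_apply_apply).mapsTo_puncture ht₁ c₁.symm.injective
  have mc₂ := (hc₂.symm ht₂ hγ c₂.symm_apply_apply).mapsTo_puncture ht₂ c₂.symm.injective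
  exact (hc'.comp ha' mc₁ mc₂).comp (hc.comp ha (hc₁.mapsTo_puncture ht₁ c₁.injective)
    (hc₂.mapsTo_puncture ht₂ c₂.injective)) (ma₁.comp mc₁) (ma₂.comp mc₂)

theorem coordDeriv_inl [IsManifold (𝓡 n) ∞ (ConnectedSum φ₁ φ₂)] {f₁ : X₁ → X₁} {f₂ : X₂ → X₂}
    {F : ConnectedSum φ₁ φ₂ → ConnectedSum φ₁ φ₂} (hF : IsSumMap φ₁ φ₂ f₁ f₂ F)
    (hm : MapsTo f₁ (puncture φ₁) (puncture φ₁)) (hU : Nonempty (puncture φ₁))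
    {e : OpenPartialHomeomorph X₁ (EuclideanSpace ℝ (Fin n))} {p : puncture φ₁}
    (hp : (p : X₁) ∈ e.source) :
    coordDeriv ((openPiece (isOpenEmbedding_inl (φ₁ := φ₁) (φ₂ := φ₂)) hU).symm.trans e)
      ((openPiece (isOpenEmbedding_inl (φ₁ := φ₁) (φ₂ := φ₂)) hU).symm.trans e) F
        (inl φ₁ φ₂ p) = coordDeriv e e f₁ p := by
  rw [← openPiece_apply (isOpenEmbedding_inl (φ₁ := φ₁) (φ₂ := φ₂)) hU]
  refine coordDeriv_pieceChart (by rw [openPiece_source]; exact p.2) hp ?_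
  filter_upwards [(puncture φ₁).isOpen.mem_nhds p.2] with q hq
  rw [openPiece_apply _ hU ⟨q, hq⟩, hF.1 ⟨q, hq⟩ ⟨f₁ q, hm hq⟩ rfl, openPiece_symm_apply]

/-- The point stays inside the first chart domain, on which the glued isotopy is the identity. The
model maps are linear, so their differential at v is the same as at the origin, and its common
negative subspace is a line. -/
theorem isAdmissiblePair [IsManifold (𝓡 n) ∞ (ConnectedSum φ₁ φ₂)]
    {o₁ : ManifoldOrientation n X₁} {o₂ : ManifoldOrientation n X₂}
    {o : ManifoldOrientation n (ConnectedSum φ₁ φ₂)} {a₁ c₁ : X₁ ≃ₘ⟮𝓡 n, 𝓡 n⟯ X₁}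
    {a₂ c₂ : X₂ ≃ₘ⟮𝓡 n, 𝓡 n⟯ X₂} {x₁ : X₁} {x₂ : X₂} (h₁ : IsStandardizedPair o₁ a₁ c₁ φ₁ x₁)
    (h₂ : IsStandardizedPair o₂ a₂ c₂ φ₂ x₂)
    {a c : ConnectedSum φ₁ φ₂ ≃ₘ⟮𝓡 n, 𝓡 n⟯ ConnectedSum φ₁ φ₂} (ha : IsSumMap φ₁ φ₂ a₁ a₂ a)
    (hc : IsSumMap φ₁ φ₂ c₁ c₂ c) (hoa : o.Preserves a) (hoc : o.Preserves c) (hn : 3 ≤ n)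
    {v : EuclideanSpace ℝ (Fin n)} (hvK : euclideanDiag signK v = v)
    (hvI : euclideanDiag signI v = v) {p : puncture φ₁} (hp : (p : X₁) = φ₁.symm v) :
    IsAdmissiblePair o a c (inl φ₁ φ₂ p) := by
  have ht₁ := h₁.target_chart
  have ht₂ := h₂.target_chart
  have hU : Nonempty (puncture φ₁) := ⟨p⟩
  have hps : (p : X₁) ∈ φ₁.source := hp ▸ symm_mem_source ht₁ v
  obtain ⟨hJ1, hJ2⟩ := contMDiffOn_openPiece_inl (φ₂ := φ₂) hU
  let ψ := (openPiece (isOpenEmbedding_inl (φ₁ := φ₁) (φ₂ := φ₂)) hU).symm.trans φ₁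
  have hψ : ψ ∈ IsManifold.maximalAtlas (𝓡 n) ∞ (ConnectedSum φ₁ φ₂) :=
    IsSmoothPiece.mem_maximalAtlas ⟨hJ1, hJ2⟩ h₁.smooth_chart
  have hz : inl φ₁ φ₂ p ∈ ψ.source := by
    rw [← openPiece_apply isOpenEmbedding_inl hU]
    exact mem_pieceChart_source (by rw [openPiece_source]; exact p.2) hps
  have hfa : a (inl φ₁ φ₂ p) = inl φ₁ φ₂ p :=
    ha.1 p p (by rw [hp]; exact fixed_of_isDiagonalOn h₁.isDiagonalOn_a ht₁ hvK)
  have hfc : c (inl φ₁ φ₂ p) = inl φ₁ φ₂ p :=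
    hc.1 p p (by rw [hp]; exact fixed_of_isDiagonalOn h₁.isDiagonalOn_c ht₁ hvI)
  obtain ⟨b₁, hb₁, hi₁⟩ := h₁.isotopy
  obtain ⟨b₂, hb₂, hi₂⟩ := h₂.isotopy
  obtain ⟨b, hb, hbi⟩ := exists_isSmoothIsotopy ht₁ ht₂
    (IsSumMap.diffCommutator ht₁ ht₂ signK_mul_self signI_mul_self h₁.isDiagonalOn_a
      h₁.isDiagonalOn_c h₂.isDiagonalOn_a h₂.isDiagonalOn_c ha hc) hb₁ hi₁ hb₂ hi₂
  refine ⟨hoa, hoc, hfa, hfc, ⟨b, hb, fun t _ => ⟨hbi t p hps, ?_⟩⟩, ?_⟩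
  · rw [fixedPointDifferential_eq_id_iff hψ hz (b t).contMDiff.contMDiffAt (hbi t p hps)]
    refine (coordDeriv_congr hz (f' := id) ?_).trans (coordDeriv_id hz)
    rw [EventuallyEq, ← (isOpenEmbedding_inl (φ₁ := φ₁) (φ₂ := φ₂)).map_nhds_eq, eventually_map]
    filter_upwards [continuous_subtype_val.continuousAt.preimage_mem_nhds
      (φ₁.open_source.mem_nhds hps)] with q hq
    exact hbi t q hq
  · obtain ⟨L, hL⟩ := exists_conj_fixedPointDifferential hψ hz
    have hodd : Odd (Module.finrank ℝ (commonNegativeSubspace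
        (coordDeriv ψ ψ a (inl φ₁ φ₂ p)).toLinearMap
        (coordDeriv ψ ψ c (inl φ₁ φ₂ p)).toLinearMap)) := by
      rw [coordDeriv_inl ha (h₁.isDiagonalOn_a.mapsTo_puncture ht₁ a₁.injective) hU hps,
        coordDeriv_inl hc (h₁.isDiagonalOn_c.mapsTo_puncture ht₁ c₁.injective) hU hps,
        h₁.isDiagonalOn_a.coordDeriv_eq ht₁, h₁.isDiagonalOn_c.coordDeriv_eq ht₁,
        finrank_commonNegativeSubspace_signs hn]
      exact odd_one
    rw [← finrank_commonNegativeSubspace_conj L, ← hL _ a.contMDiff.contMDiffAt hfa,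
      ← hL _ c.contMDiff.contMDiffAt hfc] at hodd
    exact hodd

/-- The connected sum can be oriented compatibly with the first summand, and with the second if the
coordinates have opposite signs. -/
theorem exists_orientation_preserved [IsManifold (𝓡 n) ∞ (ConnectedSum φ₁ φ₂)] (hn : 0 < n)
    {o₁ : ManifoldOrientation n X₁} {o₂ : ManifoldOrientation n X₂} {a₁ c₁ : X₁ ≃ₘ⟮𝓡 n, 𝓡 n⟯ X₁}
    {a₂ c₂ : X₂ ≃ₘ⟮𝓡 n, 𝓡 n⟯ X₂} {x₁ : X₁} {x₂ : X₂} (h₁ : IsStandardizedPair o₁ a₁ c₁ φ₁ x₁)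
    (h₂ : IsStandardizedPair o₂ a₂ c₂ φ₂ x₂)
    {a c : ConnectedSum φ₁ φ₂ ≃ₘ⟮𝓡 n, 𝓡 n⟯ ConnectedSum φ₁ φ₂} (ha : IsSumMap φ₁ φ₂ a₁ a₂ a)
    (hc : IsSumMap φ₁ φ₂ c₁ c₂ c) :
    ∃ o : ManifoldOrientation n (ConnectedSum φ₁ φ₂),
      o₁.PreservesOn o (puncture φ₁) (inl φ₁ φ₂) ∧
      ((o₁.PositiveChart φ₁ ∧ o₂.NegativeChart φ₂) ∨ (o₁.NegativeChart φ₁ ∧ o₂.PositiveChart φ₂) →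
        o₂.PreservesOn o (puncture φ₂) (inr φ₁ φ₂)) ∧ o.Preserves a ∧ o.Preserves c := by
  have hU₁ := nonempty_puncture hn h₁.target_chart
  have hU₂ := nonempty_puncture hn h₂.target_chart
  -- Charts of equal sign are handled by reversing the second orientation, which a₂ and c₂ still
  -- preserve; otherwise the orientation is kept, giving compatibility with both summands.
  obtain ⟨o₂', ho, ha₂, hc₂, heq⟩ : ∃ o₂' : ManifoldOrientation n X₂,
      ((o₁.PositiveChart φ₁ ∧ o₂'.NegativeChart φ₂) ∨
        (o₁.NegativeChart φ₁ ∧ o₂'.PositiveChart φ₂)) ∧ o₂'.Preserves a₂ ∧ o₂'.Preserves c₂ ∧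
      ((o₁.PositiveChart φ₁ ∧ o₂.NegativeChart φ₂) ∨ (o₁.NegativeChart φ₁ ∧ o₂.PositiveChart φ₂) →
        o₂' = o₂) := by
    by_cases ho : (o₁.PositiveChart φ₁ ∧ o₂.NegativeChart φ₂) ∨
      (o₁.NegativeChart φ₁ ∧ o₂.PositiveChart φ₂)
    · exact ⟨o₂, ho, h₂.preserves_a, h₂.preserves_c, fun _ => rfl⟩
    · refine ⟨o₂.reverse hn, ?_, h₂.preserves_a.reverse hn, h₂.preserves_c.reverse hn,
        fun h => absurd h ho⟩
      rcases h₁.coherentChart.positive_or_negative with hs₁ | hs₁ <;>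
        rcases h₂.coherentChart.positive_or_negative with hs₂ | hs₂
      · exact .inl ⟨hs₁, hs₂.reverse hn⟩
      · exact absurd (.inl ⟨hs₁, hs₂⟩) ho
      · exact absurd (.inr ⟨hs₁, hs₂⟩) ho
      · exact .inr ⟨hs₁, hs₂.reverse hn⟩
  obtain ⟨o, ho₁, ho₂⟩ := exists_orientation h₁.smooth_chart h₂.smooth_chart h₁.target_chart
    h₂.target_chart ho hU₁ hU₂
  refine ⟨o, ManifoldOrientation.preservesOn_openPiece _ hU₁ ho₁, fun h => ?_, ?_, ?_⟩
  · obtain rfl := heq h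
    exact ManifoldOrientation.preservesOn_openPiece _ hU₂ ho₂
  · exact ha.preserves hU₁ hU₂ ho₁ ho₂ h₁.preserves_a ha₂
      (h₁.isDiagonalOn_a.mapsTo_puncture h₁.target_chart a₁.injective)
      (h₂.isDiagonalOn_a.mapsTo_puncture h₂.target_chart a₂.injective)
  · exact hc.preserves hU₁ hU₂ ho₁ ho₂ h₁.preserves_c hc₂
      (h₁.isDiagonalOn_c.mapsTo_puncture h₁.target_chart c₁.injective)
      (h₂.isDiagonalOn_c.mapsTo_puncture h₂.target_chart c₂.injective)

end ConnectedSum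
theorem mainTheorem5 {n : ℕ}
    {X₁ : Type*} [TopologicalSpace X₁] [T2Space X₁] [CompactSpace X₁]
    [ChartedSpace (EuclideanSpace ℝ (Fin n)) X₁] [IsManifold (𝓡 n) ∞ X₁]
    {X₂ : Type*} [TopologicalSpace X₂] [T2Space X₂] [CompactSpace X₂]
    [ChartedSpace (EuclideanSpace ℝ (Fin n)) X₂] [IsManifold (𝓡 n) ∞ X₂]
    (o₁ : ManifoldOrientation n X₁) (o₂ : ManifoldOrientation n X₂)
    (a₁ c₁ : X₁ ≃ₘ⟮𝓡 n, 𝓡 n⟯ X₁) (x₁ : X₁) (h₁ : IsAdmissiblePair o₁ a₁ c₁ x₁)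
    (a₂ c₂ : X₂ ≃ₘ⟮𝓡 n, 𝓡 n⟯ X₂) (x₂ : X₂) (h₂ : IsAdmissiblePair o₂ a₂ c₂ x₂) :
    (∃ (a₁' c₁' : X₁ ≃ₘ⟮𝓡 n, 𝓡 n⟯ X₁)
        (φ₁ : OpenPartialHomeomorph X₁ (EuclideanSpace ℝ (Fin n))),
      IsStandardizedPair o₁ a₁' c₁' φ₁ x₁ ∧ o₁.PositiveChart φ₁) ∧
    (∃ (a₂' c₂' : X₂ ≃ₘ⟮𝓡 n, 𝓡 n⟯ X₂)
        (φ₂ : OpenPartialHomeomorph X₂ (EuclideanSpace ℝ (Fin n))),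
      IsStandardizedPair o₂ a₂' c₂' φ₂ x₂ ∧ o₂.NegativeChart φ₂) ∧
    ∀ (a₁' c₁' : X₁ ≃ₘ⟮𝓡 n, 𝓡 n⟯ X₁) (φ₁ : OpenPartialHomeomorph X₁ (EuclideanSpace ℝ (Fin n)))
      (a₂' c₂' : X₂ ≃ₘ⟮𝓡 n, 𝓡 n⟯ X₂) (φ₂ : OpenPartialHomeomorph X₂ (EuclideanSpace ℝ (Fin n))),
      IsStandardizedPair o₁ a₁' c₁' φ₁ x₁ → IsStandardizedPair o₂ a₂' c₂' φ₂ x₂ →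
      T2Space (ConnectedSum φ₁ φ₂) ∧ CompactSpace (ConnectedSum φ₁ φ₂) ∧
      IsManifold (𝓡 n) ∞ (ConnectedSum φ₁ φ₂) ∧
      ∃ (a c : ConnectedSum φ₁ φ₂ ≃ₘ⟮𝓡 n, 𝓡 n⟯ ConnectedSum φ₁ φ₂)
        (o : ManifoldOrientation n (ConnectedSum φ₁ φ₂)),
        ConnectedSum.IsSumMap φ₁ φ₂ a₁' a₂' a ∧ ConnectedSum.IsSumMap φ₁ φ₂ c₁' c₂' c ∧
        o₁.PreservesOn o (puncture φ₁) (ConnectedSum.inl φ₁ φ₂) ∧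
        ((o₁.PositiveChart φ₁ ∧ o₂.NegativeChart φ₂) ∨
            (o₁.NegativeChart φ₁ ∧ o₂.PositiveChart φ₂) →
          o₂.PreservesOn o (puncture φ₂) (ConnectedSum.inr φ₁ φ₂)) ∧
        o.Preserves a ∧ o.Preserves c ∧
        ∀ hn : 4 ≤ n, ∃ x : puncture φ₁,
          (x : X₁) = φ₁.symm (EuclideanSpace.single ⟨3, hn⟩ 2) ∧
          IsAdmissiblePair o a c (ConnectedSum.inl φ₁ φ₂ x) := by
  refine ⟨h₁.exists_standardized_positive, h₂.exists_standardized_negative, ?_⟩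
  intro a₁' c₁' φ₁ a₂' c₂' φ₂ s₁ s₂
  have hM := ConnectedSum.isManifold s₁.smooth_chart s₂.smooth_chart
  refine ⟨ConnectedSum.t2Space s₁.target_chart s₂.target_chart,
    ConnectedSum.compactSpace s₁.target_chart s₂.target_chart, hM, ?_⟩
  obtain ⟨a, ha⟩ := ConnectedSum.exists_diffeomorph s₁.target_chart s₂.target_chart signK_mul_self
    s₁.isDiagonalOn_a s₂.isDiagonalOn_a
  obtain ⟨c, hc⟩ := ConnectedSum.exists_diffeomorph s₁.target_chart s₂.target_chart signI_mul_self
    s₁.isDiagonalOn_c s₂.isDiagonalOn_c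
  obtain ⟨o, ho₁, ho₂, hoa, hoc⟩ := ConnectedSum.exists_orientation_preserved
    h₁.exists_standardized.1 s₁ s₂ ha hc
  -- The model maps change signs only of the coordinates 0, 1, 2, so a multiple of the basis vector
  -- of index 3 is fixed; this is where n ≥ 4 enters.
  refine ⟨a, c, o, ha, hc, ho₁, ho₂, hoa, hoc, fun hn => ⟨⟨_, ConnectedSum.symm_mem_puncture
    s₁.target_chart (v := EuclideanSpace.single ⟨3, hn⟩ 2) (by simp)⟩, rfl,
    ConnectedSum.isAdmissiblePair s₁ s₂ ha hc hoa hoc (by omega) ?_ ?_ rfl⟩⟩ <;>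
  · ext j
    by_cases hj : j = ⟨3, hn⟩ <;> simp [euclideanDiag_apply, hj, signK, signI]
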